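/- **Conventions.** All signatures are purely relational. A *theory* is a set of sentences $\forall\bar x(\varphi(\bar x)\to\psi(\bar x))$ with $\varphi,\psi$ coherent formulas (built from atomic formulas, including equality, by $\wedge,\vee,\top,\bot,\exists$). Models are ordinary set-valued structures and may be empty. 2-categories and 2-functors are strict; $\mathfrak C^{\mathrm{op}}$ reverses 1-cells only. $\mathcal K^o(X)$ is the set of compact open subsets of $X$. For $f:\mathbf n\to\mathbf m$, $f^{\times k}:\mathbf{nk}\to\mathbf{mk}$ is $f$ on each of the $k$ copies. **Theories.** An interpretation $(\Gamma,k):T\to T'$ ($k\ge1$) assigns to each $n$-ary relation symbol $R$ of $T$, including $=$, an $nk$-ary formula $\Gamma(R)$ of $T'$, taken modulo $T'$-equivalence. It is extended to formulas $\varphi(x_1,\dots,x_n)$ in context by translating $\varphi\wedge\bar x=\bar x$ (so all variables, free and quantified, are relativised to $\Gamma(x=x)$); it is required that $T\models\forall\bar x(\varphi\to\psi)$ implies $T'\models\forall\bar x_1\dots\bar x_n(\Gamma(\varphi)\to\Gamma(\psi))$, for all $n$, $\varphi(\bar x),\psi(\bar x)$, and that $T'\models\Gamma(R)(\bar x_1,\dots,\bar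 x_n)\to\bigwedge_i\Gamma(x=x)(\bar x_i)$ for all $R$ (including $=$). It is *strong* if $k=1$ and $\Gamma(x=y)$ is $x=y$. A morphism $(\Gamma,k)\to(\Gamma',k')$ is a formula $\theta(\bar x,\bar y)$ of $T'$, modulo $T'$, such that $T'$ entails: (1) $\Gamma(x=x)(\bar x)\to\exists\bar y\,\theta(\bar x,\bar y)$; (2) $\theta(\bar x,\bar y)\to\Gamma(x=x)(\bar x)\wedge\Gamma'(y=y)(\bar y)$; (3) $\theta(\bar x,\bar y)\wedge\Gamma(x=x')(\bar x,\bar x')\to\theta(\bar x',\bar y)$; (4) $\theta(\bar x,\bar y)\wedge\Gamma'(y=y')(\bar y,\bar y')\to\theta(\bar x,\bar y')$; (5) $\Gamma(\varphi)(\bar x_1,\dots,\bar x_n)\wedge\bigwedge_i\theta(\bar x_i,\bar y_i)\to\Gamma'(\varphi)(\bar y_1,\dots,\bar y_n)$ for every formula $\varphi(x_1,\dots,x_n)$ of $T$. The identity interpretation fixes all symbols; $(\Delta\Gamma)(R)=\Delta(\Gamma(R))$, with arity the product; the identity morphism of $\Gamma$ is $\Gamma(x=y)$; the vertical composite of $\theta,\eta$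 is $\exists\bar y(\theta(\bar x,\bar y)\wedge\eta(\bar y,\bar z))$; the horizontal composite of $\theta:(\Gamma,k)\to(\Gamma',k')$ (from $T$ to $T'$) and $\eta:(\Delta,\ell)\to(\Delta',\ell')$ (from $T'$ to $T''$) is $$\exists\bar y\,\bar w\Big(\Delta(\theta)(\bar x_1,\dots,\bar x_k,\bar y_1,\dots,\bar y_{k'})\wedge\bigwedge_{i=1}^{k'}\eta(\bar y_i,\bar w_i)\wedge\Delta'(\Gamma'(x=y))(\bar w,\bar z)\Big).$$ These give $\mathfrak{CohTheory}$; $\mathbf{CohTheory}$ has theories and strong interpretations. **Type space functors.** A type space functor is a functor $F:\mathbf{FinSet}^{\mathrm{op}}\to\mathbf{Spec}$ (spectral spaces, spectral maps) with all $F_f$ open, such that for each pushout square $h:\mathbf d\to\mathbf b$, $k:\mathbf d\to\mathbf c$, $f:\mathbf b\to\mathbf a$, $g:\mathbf c\to\mathbf a$ one has $F_g(F_f^{-1}(U))=F_k^{-1}(F_h(U))$ for all $U\in\mathcal K^o(F_b)$. A partial natural transformation $(\beta,k):F\dashrightarrow F'$ ($k\ge1$) is a family of spectral maps $\beta_n$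 from a compact open $\mathrm{dom}(\beta_n)\subseteq F_{nk}$ to $F'_n$ with $\mathrm{dom}(\beta_n)=\bigcap_{i=1}^nF_{j_{i}^{\times k}}^{-1}(\mathrm{dom}(\beta_1))$, where $j_{i}:\mathbf 1\to\mathbf n$ has value $i$, and $F'_f\beta_m=\beta_nF_{f^{\times k}}$ on $\mathrm{dom}(\beta_m)$ for every $f:\mathbf n\to\mathbf m$. It satisfies the *weak Beck–Chevalley condition* if for all $f:\mathbf n\to\mathbf m$ and $V\in\mathcal K^o(F'_m)$ $$\beta_n^{-1}(F'_f(V))\cap F_{f^{\times k}}(F_{mk})=F_{f^{\times k}}(\beta_m^{-1}(V)),$$ and for $n=0$ this also holds without the intersection. A natural transformation $\beta:F\to F'$ satisfies the *Beck–Chevalley condition* if $\beta_n^{-1}(F'_f(V))=F_f(\beta_m^{-1}(V))$ for all such $f,V$; it is regarded as a partial natural transformation of arity $1$. Partial natural transformations compose as partial maps $F_{n\ell k}\dashrightarrow F'_{n\ell}\dashrightarrow F''_n$. The signature $\mathcal L(F)$ has an $n$-ary symbol $R_U$ for each $U\in\mathcal K^o(F_n)$. Each $\mathcal L(F)$-formula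 in variables $x_1,\dots,x_n$ has a value $[\![\varphi]\!]\in\mathcal K^o(F_n)$: $[\![\top]\!]=F_n$, $[\![\bot]\!]=\emptyset$, $[\![R_U(x_{f(1)},\dots,x_{f(m)})]\!]=F_f^{-1}(U)$, $[\![x_i=x_j]\!]=F_e(F_n)$ where $e$ sends $i$ to $j$ and fixes the rest, $\wedge,\vee$ are $\cap,\cup$, and $[\![\exists x_{n+1}\varphi]\!]=F_\iota([\![\varphi]\!])$ for the inclusion $\iota:\mathbf n\to\mathbf{n+1}$. Put $\mathrm{Th}(F)=\{\forall\bar x(\varphi\to\psi):[\![\varphi]\!]\subseteq[\![\psi]\!]\}$. For $(\beta,k):F\dashrightarrow F'$ let $\mathrm{Th}(\beta,k)$ send $R_U$ to $R_{\beta_n^{-1}(U)}$ and $x=y$ to $R_{\beta_2^{-1}([\![x=y]\!])}$. A morphism $(\beta,k)\to(\beta',k')$ is a $\Theta\in\mathcal K^o(F_{k+k'})$ such that (1)–(5), with $\Gamma,\Gamma'$ given by $\mathrm{Th}(\beta,k),\mathrm{Th}(\beta',k')$, with $\theta=R_\Theta$, and with $\varphi$ in (5) ranging over the symbols $R_U$,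 $U\in\mathcal K^o(F'_n)$, hold in the internal logic, i.e. as inclusions between the sets $[\![\cdot]\!]$. Identities and vertical and horizontal composites of morphisms are the values $[\![\cdot]\!]$ of the formulas above. Put $\mathrm{Th}(\Theta)=R_\Theta$. These give $\mathfrak{TypeSpaceFunc}$ (type space functors; partial natural transformations satisfying the weak Beck–Chevalley condition; morphisms). $\mathbf{TypeSpaceFunc}$ has type space functors and natural transformations satisfying the Beck–Chevalley condition. **Statement.** With these operations $\mathfrak{CohTheory}$ and $\mathfrak{TypeSpaceFunc}$ are strict 2-categories. For every 1-cell $(\beta,k):F\dashrightarrow F'$ of $\mathfrak{TypeSpaceFunc}$, $\mathrm{Th}(\beta,k)$ is an interpretation $\mathrm{Th}(F')\to\mathrm{Th}(F)$, and for every 2-cell $\Theta$, $\mathrm{Th}(\Theta)$ is a morphism of interpretations; and $\mathrm{Th}$ is a strict 2-functor $\mathfrak{TypeSpaceFunc}\to\mathfrak{CohTheory}^{\mathrm{op}}$. Moreover, strong interpretations are closed under identities and composition, natural transformations satisfying the Beck–Chevalley condition are 1-cells of $\mathfrak{TypeSpaceFunc}$ (compatibly with identities and composition), $\mathrm{Th}$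 sends them to strong interpretations, and so $\mathrm{Th}$ restricts to a functor $\mathbf{TypeSpaceFunc}\to\mathbf{CohTheory}^{\mathrm{op}}$. -/

import Mathlib

open CategoryTheory TopologicalSpace

universe u v w

namespace PosLogic

/-! ## Strict 2-categories and strict 2-functors -/

/-- The data of a strict 2-category on a type of objects: 1-cells, 2-cells, identities, composition
of 1-cells, vertical and horizontal composition of 2-cells.  Compositions are written in
diagrammatic order. -/
structure TwoCatData (Obj : Type u) where
  Hom : Obj → Obj → Type v
  Hom₂ : ∀ {a b : Obj}, Hom a b → Hom a b → Type v
  id₁ : ∀ a : Obj, Hom a a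
  comp₁ : ∀ {a b c : Obj}, Hom a b → Hom b c → Hom a c
  id₂ : ∀ {a b : Obj} (f : Hom a b), Hom₂ f f
  vcomp : ∀ {a b : Obj} {f g h : Hom a b}, Hom₂ f g → Hom₂ g h → Hom₂ f h
  hcomp : ∀ {a b c : Obj} {f f' : Hom a b} {g g' : Hom b c},
    Hom₂ f f' → Hom₂ g g' → Hom₂ (comp₁ f g) (comp₁ f' g')

/-- The axioms of a strict 2-category. -/
structure TwoCatData.IsStrictTwoCategory {Obj : Type u} (C : TwoCatData.{u, v} Obj) : Prop where
  id_comp₁ : ∀ {a b : Obj} (f : C.Hom a b), C.comp₁ (C.id₁ a) f = f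
  comp₁_id : ∀ {a b : Obj} (f : C.Hom a b), C.comp₁ f (C.id₁ b) = f
  assoc₁ : ∀ {a b c d : Obj} (f : C.Hom a b) (g : C.Hom b c) (h : C.Hom c d),
    C.comp₁ (C.comp₁ f g) h = C.comp₁ f (C.comp₁ g h)
  id_vcomp : ∀ {a b : Obj} {f g : C.Hom a b} (α : C.Hom₂ f g), C.vcomp (C.id₂ f) α = α
  vcomp_id : ∀ {a b : Obj} {f g : C.Hom a b} (α : C.Hom₂ f g), C.vcomp α (C.id₂ g) = α
  vcomp_assoc : ∀ {a b : Obj} {f g h i : C.Hom a b} (α : C.Hom₂ f g) (β : C.Hom₂ g h)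
    (γ : C.Hom₂ h i), C.vcomp (C.vcomp α β) γ = C.vcomp α (C.vcomp β γ)
  hcomp_id₂ : ∀ {a b c : Obj} (f : C.Hom a b) (g : C.Hom b c),
    C.hcomp (C.id₂ f) (C.id₂ g) = C.id₂ (C.comp₁ f g)
  interchange : ∀ {a b c : Obj} {f f' f'' : C.Hom a b} {g g' g'' : C.Hom b c}
    (α : C.Hom₂ f f') (α' : C.Hom₂ f' f'') (β : C.Hom₂ g g') (β' : C.Hom₂ g' g''),
    C.hcomp (C.vcomp α α') (C.vcomp β β') = C.vcomp (C.hcomp α β) (C.hcomp α' β')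
  id_hcomp : ∀ {a b : Obj} {f g : C.Hom a b} (α : C.Hom₂ f g),
    HEq (C.hcomp (C.id₂ (C.id₁ a)) α) α
  hcomp_id : ∀ {a b : Obj} {f g : C.Hom a b} (α : C.Hom₂ f g),
    HEq (C.hcomp α (C.id₂ (C.id₁ b))) α
  hcomp_assoc : ∀ {a b c d : Obj} {f f' : C.Hom a b} {g g' : C.Hom b c} {h h' : C.Hom c d}
    (α : C.Hom₂ f f') (β : C.Hom₂ g g') (γ : C.Hom₂ h h'),
    HEq (C.hcomp (C.hcomp α β) γ) (C.hcomp α (C.hcomp β γ))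

/-- The opposite: 1-cells are reversed, the direction of the 2-cells does not change. -/
def TwoCatData.op {Obj : Type u} (C : TwoCatData.{u, v} Obj) : TwoCatData.{u, v} Obj where
  Hom a b := C.Hom b a
  Hom₂ f g := C.Hom₂ f g
  id₁ a := C.id₁ a
  comp₁ f g := C.comp₁ g f
  id₂ f := C.id₂ f
  vcomp α β := C.vcomp α β
  hcomp α β := C.hcomp β α

/-- The operations `obj`, `map₁`, `map₂` form a strict 2-functor. -/
structure IsStrictTwoFunctor {A : Type u} {B : Type u} (C : TwoCatData.{u, v} A)
    (D : TwoCatData.{u, v} B) (obj : A → B)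
    (map₁ : ∀ {a b : A}, C.Hom a b → D.Hom (obj a) (obj b))
    (map₂ : ∀ {a b : A} {f g : C.Hom a b}, C.Hom₂ f g → D.Hom₂ (map₁ f) (map₁ g)) : Prop where
  map_id₁ : ∀ a : A, map₁ (C.id₁ a) = D.id₁ (obj a)
  map_comp₁ : ∀ {a b c : A} (f : C.Hom a b) (g : C.Hom b c),
    map₁ (C.comp₁ f g) = D.comp₁ (map₁ f) (map₁ g)
  map_id₂ : ∀ {a b : A} (f : C.Hom a b), map₂ (C.id₂ f) = D.id₂ (map₁ f)
  map_vcomp : ∀ {a b : A} {f g h : C.Hom a b} (α : C.Hom₂ f g) (β : C.Hom₂ g h),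
    map₂ (C.vcomp α β) = D.vcomp (map₂ α) (map₂ β)
  map_hcomp : ∀ {a b c : A} {f f' : C.Hom a b} {g g' : C.Hom b c}
    (α : C.Hom₂ f f') (β : C.Hom₂ g g'),
    HEq (map₂ (C.hcomp α β)) (D.hcomp (map₂ α) (map₂ β))

/-! ## Tuples of variables

A variable of an `n * k`-ary formula is a pair: the `j`-th member of the `i`-th block, for `i : Fin n`
and `j : Fin k`, at position `finProdFinEquiv (i, j)`, that is `k * i + j`. -/

/-- The concatenation of `n` tuples of length `k`. -/
def concat {α : Type*} {n k : ℕ} (x : Fin n → Fin k → α) : Fin (n * k) → α :=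
  fun p => x (finProdFinEquiv.symm p).1 (finProdFinEquiv.symm p).2

/-- The `n` blocks of length `k` of a tuple of length `n * k`. -/
def blocks {α : Type*} {n k : ℕ} (x : Fin (n * k) → α) : Fin n → Fin k → α :=
  fun i j => x (finProdFinEquiv (i, j))

/-- The map `f^{×k}`, which is `f` on each of the `k` copies. -/
def times {n m : ℕ} (f : Fin n → Fin m) (k : ℕ) : Fin (n * k) → Fin (m * k) :=
  concat (fun i j => finProdFinEquiv (f i, j))

/-! ## Coherent logic -/

/-- Coherent formulas with free variables among `x_0, …, x_{n-1}`; the quantifier `ex` binds the last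
variable `x_n` of a formula in `n + 1` variables.  The signatures considered are relational, so
the only terms are variables. -/
inductive CohFormula (L : FirstOrder.Language.{0, u}) : ℕ → Type u
  | top {n : ℕ} : CohFormula L n
  | bot {n : ℕ} : CohFormula L n
  | eq {n : ℕ} (i j : Fin n) : CohFormula L n
  | rel {n m : ℕ} (R : L.Relations m) (x : Fin m → Fin n) : CohFormula L n
  | and {n : ℕ} (φ ψ : CohFormula L n) : CohFormula L n
  | or {n : ℕ} (φ ψ : CohFormula L n) : CohFormula L n
  | ex {n : ℕ} (φ : CohFormula L (n + 1)) : CohFormula L n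

namespace CohFormula

variable {L : FirstOrder.Language.{0, u}}

/-- Satisfaction in a (possibly empty) structure. -/
def Realize {M : Type w} [L.Structure M] : ∀ {n : ℕ}, CohFormula L n → (Fin n → M) → Prop
  | _, top, _ => True
  | _, bot, _ => False
  | _, eq i j, a => a i = a j
  | _, rel R x, a => FirstOrder.Language.Structure.RelMap R (fun i => a (x i))
  | _, and φ ψ, a => φ.Realize a ∧ ψ.Realize a
  | _, or φ ψ, a => φ.Realize a ∨ ψ.Realize a
  | _, ex φ, a => ∃ b : M, φ.Realize (Fin.snoc a b : Fin _ → M)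

/-- Substitution of variables: `φ(x_{f(0)}, …, x_{f(n-1)})`. -/
def subst : ∀ {n m : ℕ}, CohFormula L n → (Fin n → Fin m) → CohFormula L m
  | _, _, top, _ => top
  | _, _, bot, _ => bot
  | _, _, eq i j, f => eq (f i) (f j)
  | _, _, rel R x, f => rel R (fun i => f (x i))
  | _, _, and φ ψ, f => and (φ.subst f) (ψ.subst f)
  | _, _, or φ ψ, f => or (φ.subst f) (ψ.subst f)
  | _, m, ex φ, f =>
    ex (φ.subst (Fin.snoc (fun i => (f i).castSucc) (Fin.last m) : Fin _ → Fin (m + 1)))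

/-- Existential quantification over the last `k` variables. -/
def exs {n : ℕ} : ∀ k : ℕ, CohFormula L (n + k) → CohFormula L n
  | 0, φ => φ
  | k + 1, φ => exs k (ex φ)

/-- Finite conjunctions. -/
def conj {n : ℕ} : ∀ {m : ℕ}, (Fin m → CohFormula L n) → CohFormula L n
  | 0, _ => top
  | _ + 1, φ => and (φ 0) (conj fun i => φ i.succ)

theorem realize_subst {M : Type w} [L.Structure M] {n m : ℕ} (φ : CohFormula L n)
    (f : Fin n → Fin m) (a : Fin m → M) : (φ.subst f).Realize a ↔ φ.Realize (a ∘ f) := by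
  induction φ generalizing m with
  | top => rfl
  | bot => rfl
  | eq i j => rfl
  | rel R x => rfl
  | and φ ψ h h' => simp [subst, Realize, h, h']
  | or φ ψ h h' => simp [subst, Realize, h, h']
  | ex φ h =>
    simp only [subst, Realize, h]
    refine exists_congr fun b => ?_
    have e : (Fin.snoc a b : Fin (m + 1) → M) ∘
        (Fin.snoc (fun i => (f i).castSucc) (Fin.last m) : Fin _ → Fin (m + 1)) =
        (Fin.snoc (a ∘ f) b : Fin _ → M) := by
      funext i
      refine Fin.lastCases ?_ (fun i => ?_) i <;> simp
    rw [e]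

theorem realize_exs {M : Type w} [L.Structure M] {n : ℕ} (k : ℕ) (φ : CohFormula L (n + k))
    (a : Fin n → M) : (exs k φ).Realize a ↔ ∃ b : Fin k → M, φ.Realize (Fin.append a b) := by
  induction k with
  | zero =>
    have e : ∀ b : Fin 0 → M, (Fin.append a b : Fin (n + 0) → M) = a := by
      intro b
      funext i
      exact Fin.append_left a b i
    simp [exs, e]
  | succ k ih =>
    simp only [exs, ih, Realize]
    constructor
    · rintro ⟨b, c, h⟩
      refine ⟨(Fin.snoc b c : Fin (k + 1) → M), ?_⟩
      rw [Fin.append_snoc]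
      exact h
    · rintro ⟨b, h⟩
      refine ⟨Fin.init b, b (Fin.last k), ?_⟩
      rw [← Fin.append_snoc, Fin.snoc_init_self]
      exact h

end CohFormula

/-- The h-inductive sentence `∀ x_0 … x_{n-1} (prem → concl)`. -/
structure HInductive (L : FirstOrder.Language.{0, u}) : Type u where
  arity : ℕ
  prem : CohFormula L arity
  concl : CohFormula L arity

/-- A coherent theory: a set of h-inductive sentences in a purely relational signature. -/
structure CohTheory : Type (u + 1) where
  lang : FirstOrder.Language.{0, u}
  relational : lang.IsRelational
  sentences : Set (HInductive lang)

namespace CohTheory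

/-- The structure `M`, which may be empty, is a model of `T`. -/
def IsModel (T : CohTheory.{u}) (M : Type u) [T.lang.Structure M] : Prop :=
  ∀ s ∈ T.sentences, ∀ a : Fin s.arity → M, s.prem.Realize a → s.concl.Realize a

/-- `T ⊨ ∀ x̄ (φ(x̄) → ψ(x̄))`. -/
def Entails (T : CohTheory.{u}) {n : ℕ} (φ ψ : CohFormula T.lang n) : Prop :=
  ∀ (M : Type u) [T.lang.Structure M], T.IsModel M →
    ∀ a : Fin n → M, φ.Realize a → ψ.Realize a

/-- Equivalence of `n`-ary formulas modulo `T`. -/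
def setoid (T : CohTheory.{u}) (n : ℕ) : Setoid (CohFormula T.lang n) where
  r φ ψ := T.Entails φ ψ ∧ T.Entails ψ φ
  iseqv :=
    { refl := fun _ => ⟨fun _ _ _ _ h => h, fun _ _ _ _ h => h⟩
      symm := fun h => ⟨h.2, h.1⟩
      trans := fun h h' => ⟨fun M _ hM a x => h'.1 M hM a (h.1 M hM a x),
        fun M _ hM a x => h.2 M hM a (h'.2 M hM a x)⟩ }

/-- The Lindenbaum-Tarski algebra of `T`: `n`-ary formulas modulo `T`. -/
def Lind (T : CohTheory.{u}) (n : ℕ) : Type u := Quotient (T.setoid n)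

namespace Lind

variable {T : CohTheory.{u}} {n m : ℕ}

/-- The class of a formula. -/
def mk (φ : CohFormula T.lang n) : T.Lind n := Quotient.mk (T.setoid n) φ

/-- Substitution of variables, on classes. -/
def subst (c : T.Lind n) (f : Fin n → Fin m) : T.Lind m :=
  Quotient.map' (s₁ := T.setoid n) (s₂ := T.setoid m) (fun φ => φ.subst f)
    (fun φ ψ h => ⟨fun M _ hM a x => (CohFormula.realize_subst ψ f a).2
        (h.1 M hM _ ((CohFormula.realize_subst φ f a).1 x)),
      fun M _ hM a x => (CohFormula.realize_subst φ f a).2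
        (h.2 M hM _ ((CohFormula.realize_subst ψ f a).1 x))⟩) c

/-- Existential quantification over the last `k` variables, on classes. -/
def exs (k : ℕ) (c : T.Lind (n + k)) : T.Lind n :=
  Quotient.map' (s₁ := T.setoid (n + k)) (s₂ := T.setoid n) (fun φ => φ.exs k)
    (fun φ ψ h => ⟨fun M _ hM a x => (CohFormula.realize_exs k ψ a).2
        (((CohFormula.realize_exs k φ a).1 x).imp fun _ y => h.1 M hM _ y),
      fun M _ hM a x => (CohFormula.realize_exs k φ a).2
        (((CohFormula.realize_exs k ψ a).1 x).imp fun _ y => h.2 M hM _ y)⟩) c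

/-- The order is entailment modulo `T`, and meets and joins are conjunction and disjunction. -/
instance : Lattice (T.Lind n) where
  le := Quotient.lift₂ (s₁ := T.setoid n) (s₂ := T.setoid n) (fun φ ψ => T.Entails φ ψ)
    (fun φ ψ φ' ψ' h h' => propext
      ⟨fun e M _ hM a x => h'.1 M hM a (e M hM a (h.2 M hM a x)),
       fun e M _ hM a x => h'.2 M hM a (e M hM a (h.1 M hM a x))⟩)
  le_refl := by rintro ⟨φ⟩ M _ hM a x; exact x
  le_trans := by rintro ⟨φ⟩ ⟨ψ⟩ ⟨χ⟩ h h' M _ hM a x; exact h' M hM a (h M hM a x)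
  le_antisymm := by rintro ⟨φ⟩ ⟨ψ⟩ h h'; exact Quotient.sound ⟨h, h'⟩
  inf := Quotient.map₂ (fun φ ψ => φ.and ψ) (fun φ φ' h ψ ψ' h' =>
    ⟨fun M _ hM a x => ⟨h.1 M hM a x.1, h'.1 M hM a x.2⟩,
     fun M _ hM a x => ⟨h.2 M hM a x.1, h'.2 M hM a x.2⟩⟩)
  sup := Quotient.map₂ (fun φ ψ => φ.or ψ) (fun φ φ' h ψ ψ' h' =>
    ⟨fun M _ hM a x => x.imp (h.1 M hM a) (h'.1 M hM a),
     fun M _ hM a x => x.imp (h.2 M hM a) (h'.2 M hM a)⟩)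
  inf_le_left := by rintro ⟨φ⟩ ⟨ψ⟩ M _ hM a x; exact x.1
  inf_le_right := by rintro ⟨φ⟩ ⟨ψ⟩ M _ hM a x; exact x.2
  le_inf := by rintro ⟨φ⟩ ⟨ψ⟩ ⟨χ⟩ h h' M _ hM a x; exact ⟨h M hM a x, h' M hM a x⟩
  le_sup_left := by rintro ⟨φ⟩ ⟨ψ⟩ M _ hM a x; exact Or.inl x
  le_sup_right := by rintro ⟨φ⟩ ⟨ψ⟩ M _ hM a x; exact Or.inr x
  sup_le := by rintro ⟨φ⟩ ⟨ψ⟩ ⟨χ⟩ h h' M _ hM a x; exact x.elim (h M hM a) (h' M hM a)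

instance : BoundedOrder (T.Lind n) where
  top := mk .top
  le_top := by rintro ⟨φ⟩ M _ hM a x; trivial
  bot := mk .bot
  bot_le := by rintro ⟨φ⟩ M _ hM a x; exact x.elim

end Lind

/-! ## Interpretations -/

/-- The data of an interpretation `T → T'` of arity `k`: an `n * k`-ary formula of `T'`, taken modulo
`T'`, for every `n`-ary relation symbol of `T`, and a `2 * k`-ary one for equality. -/
structure PreInterp (T T' : CohTheory.{u}) : Type u where
  arity : ℕ
  arity_pos : 1 ≤ arity
  eqv : T'.Lind (2 * arity)
  rel : ∀ {n : ℕ}, T.lang.Relations n → T'.Lind (n * arity)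

namespace PreInterp

variable {T T' : CohTheory.{u}} (Γ : PreInterp T T')

/-- `Γ(x = y)(x̄, ȳ)` for tuples of variables `x̄`, `ȳ` of length `k`. -/
def eqAt {m : ℕ} (x y : Fin Γ.arity → Fin m) : T'.Lind m := Γ.eqv.subst (concat ![x, y])

/-- `Γ(x = x)(x̄_0) ∧ … ∧ Γ(x = x)(x̄_{n-1})`. -/
def domain (n : ℕ) : T'.Lind (n * Γ.arity) :=
  Finset.univ.inf fun i : Fin n =>
    Γ.eqAt (fun j => finProdFinEquiv (i, j)) (fun j => finProdFinEquiv (i, j))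

/-- The extension of `Γ` to formulas `φ(x_0, …, x_{n-1})`.  The value is the translation of the
formula `φ ∧ x_0 = x_0 ∧ … ∧ x_{n-1} = x_{n-1}`, in which all the variables appear; quantifiers
accordingly range over tuples satisfying `Γ(x = x)`. -/
def onFormula : ∀ {n : ℕ}, CohFormula T.lang n → T'.Lind (n * Γ.arity)
  | n, .top => Γ.domain n
  | _, .bot => ⊥
  | n, .eq i j => Γ.domain n ⊓ Γ.eqv.subst (times ![i, j] Γ.arity)
  | n, .rel R x => Γ.domain n ⊓ (Γ.rel R).subst (times x Γ.arity)
  | _, .and φ ψ => onFormula φ ⊓ onFormula ψ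
  | _, .or φ ψ => onFormula φ ⊔ onFormula ψ
  | n, .ex φ => Lind.exs Γ.arity ((onFormula φ).subst (Fin.cast (Nat.succ_mul n Γ.arity)))

/-- `Γ` is an interpretation: the consequences of `T` are carried to consequences of `T'`.  The last
two clauses are the instances for `R(x̄) → R(x̄) ∧ x̄ = x̄` and `x = y → x = y ∧ x = x ∧ y = y`. -/
structure IsInterp : Prop where
  entails : ∀ {n : ℕ} (φ ψ : CohFormula T.lang n),
    T.Entails φ ψ → Γ.onFormula φ ≤ Γ.onFormula ψ
  rel_le : ∀ {n : ℕ} (R : T.lang.Relations n), Γ.rel R ≤ Γ.domain n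
  eqv_le : Γ.eqv ≤ Γ.domain 2

end PreInterp

/-- Interpretations `(Γ, k) : T → T'`. -/
structure Interp (T T' : CohTheory.{u}) : Type u extends PreInterp T T' where
  isInterp : toPreInterp.IsInterp

namespace Interp

variable {T T' : CohTheory.{u}}

/-- The action of an interpretation on formulas modulo `T`. -/
def onLind (Γ : Interp T T') {n : ℕ} (c : T.Lind n) : T'.Lind (n * Γ.arity) :=
  Quotient.lift (s := T.setoid n) Γ.onFormula
    (fun φ ψ h => le_antisymm (Γ.isInterp.entails φ ψ h.1) (Γ.isInterp.entails ψ φ h.2)) c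

/-- Strong interpretations: of arity one, and interpreting equality as equality. -/
def IsStrong (Γ : Interp T T') : Prop :=
  Γ.arity = 1 ∧ ∀ j : Fin Γ.arity,
    Γ.eqv = Lind.mk (.eq (finProdFinEquiv (0, j)) (finProdFinEquiv (1, j)))

/-- The conditions for a formula `θ(x̄, ȳ)`, with `x̄` of length `k` and `ȳ` of length `k'`, to be a
morphism of interpretations `(Γ, k) → (Γ', k')`.  The tuples `x, x', y, y'` are arbitrary tuples
of variables. -/
structure IsMor (Γ Γ' : Interp T T') (θ : T'.Lind (Γ.arity + Γ'.arity)) : Prop where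
  total : Γ.eqAt id id ≤ Lind.exs Γ'.arity θ
  le_domain : θ ≤ Γ.eqAt (Fin.castAdd Γ'.arity) (Fin.castAdd Γ'.arity) ⊓
    Γ'.eqAt (Fin.natAdd Γ.arity) (Fin.natAdd Γ.arity)
  congr_left : ∀ {m : ℕ} (x x' : Fin Γ.arity → Fin m) (y : Fin Γ'.arity → Fin m),
    θ.subst (Fin.append x y) ⊓ Γ.eqAt x x' ≤ θ.subst (Fin.append x' y)
  congr_right : ∀ {m : ℕ} (x : Fin Γ.arity → Fin m) (y y' : Fin Γ'.arity → Fin m),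
    θ.subst (Fin.append x y) ⊓ Γ'.eqAt y y' ≤ θ.subst (Fin.append x y')
  preserves : ∀ {n m : ℕ} (φ : CohFormula T.lang n)
    (x : Fin n → Fin Γ.arity → Fin m) (y : Fin n → Fin Γ'.arity → Fin m),
    (Γ.onFormula φ).subst (concat x) ⊓
      (Finset.univ.inf fun i : Fin n => θ.subst (Fin.append (x i) (y i))) ≤
    (Γ'.onFormula φ).subst (concat y)

/-- Morphisms of interpretations; they are equal when they are equivalent formulas modulo `T'`. -/
structure Mor (Γ Γ' : Interp T T') : Type u where
  formula : T'.Lind (Γ.arity + Γ'.arity)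
  isMor : IsMor Γ Γ' formula

/-! ### Identities and compositions -/

/-- The identity interpretation. -/
def preId (T : CohTheory.{u}) : PreInterp T T where
  arity := 1
  arity_pos := le_rfl
  eqv := Lind.mk (.eq (finProdFinEquiv (0, 0)) (finProdFinEquiv (1, 0)))
  rel R := Lind.mk (.rel R fun i => finProdFinEquiv (i, 0))

/-- The composite `T → T' → T''`, which sends `R` to `Δ(Γ(R))`. -/
def preComp {T'' : CohTheory.{u}} (Γ : Interp T T') (Δ : Interp T' T'') : PreInterp T T'' where
  arity := Γ.arity * Δ.arity
  arity_pos := Nat.mul_pos Γ.arity_pos Δ.arity_pos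
  eqv := (Δ.onLind Γ.eqv).subst (Fin.cast (Nat.mul_assoc _ _ _))
  rel R := (Δ.onLind (Γ.rel R)).subst (Fin.cast (Nat.mul_assoc _ _ _))

/-- The identity morphism on `Γ` is the formula `Γ(x = y)(x̄, ȳ)`. -/
def preId₂ (Γ : Interp T T') : T'.Lind (Γ.arity + Γ.arity) :=
  Γ.eqAt (Fin.castAdd Γ.arity) (Fin.natAdd Γ.arity)

/-- Vertical composition: `∃ ȳ (θ(x̄, ȳ) ∧ η(ȳ, z̄))`. -/
def preVcomp {Γ Γ' Γ'' : Interp T T'} (θ : Mor Γ Γ') (η : Mor Γ' Γ'') :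
    T'.Lind (Γ.arity + Γ''.arity) :=
  let N := Γ.arity + Γ''.arity
  let x : Fin Γ.arity → Fin (N + Γ'.arity) :=
    fun i => Fin.castAdd Γ'.arity (Fin.castAdd Γ''.arity i)
  let z : Fin Γ''.arity → Fin (N + Γ'.arity) :=
    fun i => Fin.castAdd Γ'.arity (Fin.natAdd Γ.arity i)
  let y : Fin Γ'.arity → Fin (N + Γ'.arity) := Fin.natAdd N
  Lind.exs Γ'.arity (θ.formula.subst (Fin.append x y) ⊓ η.formula.subst (Fin.append y z))

/-- Horizontal composition: the closure of
`∃ ȳ_0 … ȳ_{k'-1} (Δ(θ)(x̄_0, …, x̄_{k-1}, ȳ_0, …, ȳ_{k'-1}) ∧ ⋀ i, η(ȳ_i, w̄_i))`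
in the variables `w̄_i` under the equivalence relation `Δ'(Γ'(x = y))`, that is, the formula
`∃ ȳ w̄ (Δ(θ)(x̄, ȳ) ∧ (⋀ i, η(ȳ_i, w̄_i)) ∧ Δ'(Γ'(x = y))(w̄, z̄))`. -/
def preHcomp {T'' : CohTheory.{u}} {Γ Γ' : Interp T T'} {Δ Δ' : Interp T' T''}
    (θ : Mor Γ Γ') (η : Mor Δ Δ') :
    T''.Lind (Γ.arity * Δ.arity + Γ'.arity * Δ'.arity) :=
  let N := Γ.arity * Δ.arity + Γ'.arity * Δ'.arity
  let K := Γ'.arity * Δ.arity + Γ'.arity * Δ'.arity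
  let x : Fin Γ.arity → Fin Δ.arity → Fin (N + K) :=
    blocks fun i => Fin.castAdd K (Fin.castAdd _ i)
  let z : Fin Γ'.arity → Fin Δ'.arity → Fin (N + K) :=
    blocks fun i => Fin.castAdd K (Fin.natAdd _ i)
  let y : Fin Γ'.arity → Fin Δ.arity → Fin (N + K) :=
    blocks fun i => Fin.natAdd N (Fin.castAdd _ i)
  let w : Fin Γ'.arity → Fin Δ'.arity → Fin (N + K) :=
    blocks fun i => Fin.natAdd N (Fin.natAdd _ i)
  Lind.exs K
    ((Δ.onLind θ.formula).subst (concat (Fin.append x y)) ⊓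
      (Finset.univ.inf fun i : Fin Γ'.arity => η.formula.subst (Fin.append (y i) (w i))) ⊓
      (Δ'.onLind Γ'.eqv).subst (concat (concat ![w, z])))

end Interp

/-- The identities and composites of interpretations and of their morphisms are again such. -/
structure OpsClosed : Prop where
  id₁ : ∀ T : CohTheory.{u}, (Interp.preId T).IsInterp
  comp₁ : ∀ {T T' T'' : CohTheory.{u}} (Γ : Interp T T') (Δ : Interp T' T''),
    (Interp.preComp Γ Δ).IsInterp
  id₂ : ∀ {T T' : CohTheory.{u}} (Γ : Interp T T'), Interp.IsMor Γ Γ (Interp.preId₂ Γ)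
  vcomp : ∀ {T T' : CohTheory.{u}} {Γ Γ' Γ'' : Interp T T'}
    (θ : Interp.Mor Γ Γ') (η : Interp.Mor Γ' Γ''), Interp.IsMor Γ Γ'' (Interp.preVcomp θ η)
  hcomp : ∀ {T T' T'' : CohTheory.{u}} {Γ Γ' : Interp T T'} {Δ Δ' : Interp T' T''}
    (θ : Interp.Mor Γ Γ') (η : Interp.Mor Δ Δ'),
    Interp.IsMor ⟨Interp.preComp Γ Δ, comp₁ Γ Δ⟩ ⟨Interp.preComp Γ' Δ', comp₁ Γ' Δ'⟩
      (Interp.preHcomp θ η)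

/-- The 2-category of theories, interpretations and morphisms of interpretations. -/
def twoCat (h : OpsClosed.{u}) : TwoCatData.{u + 1, u} CohTheory.{u} where
  Hom T T' := Interp T T'
  Hom₂ Γ Γ' := Interp.Mor Γ Γ'
  id₁ T := ⟨Interp.preId T, h.id₁ T⟩
  comp₁ Γ Δ := ⟨Interp.preComp Γ Δ, h.comp₁ Γ Δ⟩
  id₂ Γ := ⟨Interp.preId₂ Γ, h.id₂ Γ⟩
  vcomp θ η := ⟨Interp.preVcomp θ η, h.vcomp θ η⟩
  hcomp θ η := ⟨Interp.preHcomp θ η, h.hcomp θ η⟩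

/-- Strong interpretations are closed under identities and composition. -/
structure StrongClosed (h : OpsClosed.{u}) : Prop where
  id : ∀ T : CohTheory.{u}, Interp.IsStrong ((twoCat h).id₁ T)
  comp : ∀ {T T' T'' : CohTheory.{u}} (Γ : Interp T T') (Δ : Interp T' T''),
    Γ.IsStrong → Δ.IsStrong → Interp.IsStrong ((twoCat h).comp₁ Γ Δ)

/-- The objects of the category of theories and strong interpretations. -/
def StrongCat (h : OpsClosed.{u}) (_ : (twoCat h).IsStrictTwoCategory) (_ : StrongClosed h) :
    Type (u + 1) := CohTheory.{u}

/-- The category of theories and strong interpretations. -/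
instance (h : OpsClosed.{u}) (h' : (twoCat h).IsStrictTwoCategory) (h'' : StrongClosed h) :
    Category (StrongCat h h' h'') where
  Hom T T' := { Γ : Interp T T' // Γ.IsStrong }
  id T := ⟨(twoCat h).id₁ T, h''.id T⟩
  comp Γ Δ := ⟨(twoCat h).comp₁ Γ.1 Δ.1, h''.comp Γ.1 Δ.1 Γ.2 Δ.2⟩
  id_comp Γ := Subtype.ext (h'.id_comp₁ Γ.1)
  comp_id Γ := Subtype.ext (h'.comp₁_id Γ.1)
  assoc Γ Δ Ξ := Subtype.ext (h'.assoc₁ Γ.1 Δ.1 Ξ.1)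

end CohTheory

/-! ## Type space functors -/

/-- The square of functions `h : d → b`, `k : d → c`, `f : b → a`, `g : c → a` is a pushout in the
category of finite sets, identified with its skeleton. -/
def IsFinPushout {a b c d : ℕ} (h : Fin d → Fin b) (k : Fin d → Fin c) (f : Fin b → Fin a)
    (g : Fin c → Fin a) : Prop :=
  f ∘ h = g ∘ k ∧ ∀ (p : ℕ) (s : Fin b → Fin p) (t : Fin c → Fin p), s ∘ h = t ∘ k →
    ∃! r : Fin a → Fin p, r ∘ f = s ∧ r ∘ g = t

/-- Type space functors: contravariant functors from (the skeleton of) finite sets to spectral spaces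
and spectral maps, with open maps in the image, such that the image of every pushout satisfies
the Beck-Chevalley condition. -/
structure TypeSpaceFunctor : Type (u + 1) where
  obj : ℕ → Type u
  [topology : ∀ n, TopologicalSpace (obj n)]
  [spectral : ∀ n, SpectralSpace (obj n)]
  map : ∀ {n m : ℕ}, (Fin n → Fin m) → SpectralMap (obj m) (obj n)
  map_id : ∀ n : ℕ, map (id : Fin n → Fin n) = SpectralMap.id (obj n)
  map_comp : ∀ {n m p : ℕ} (f : Fin n → Fin m) (g : Fin m → Fin p),
    map (g ∘ f) = (map f).comp (map g)
  isOpenMap : ∀ {n m : ℕ} (f : Fin n → Fin m), IsOpenMap (map f)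
  beckChevalley : ∀ {a b c d : ℕ} (h : Fin d → Fin b) (k : Fin d → Fin c) (f : Fin b → Fin a)
    (g : Fin c → Fin a), IsFinPushout h k f g → ∀ U : CompactOpens (obj b),
    map g '' (map f ⁻¹' (U : Set (obj b))) = map k ⁻¹' (map h '' (U : Set (obj b)))

attribute [instance] TypeSpaceFunctor.topology TypeSpaceFunctor.spectral

namespace TypeSpaceFunctor

/-- The preimage of a compact open set under `F_f`. -/
def preimage (F : TypeSpaceFunctor.{u}) {n m : ℕ} (f : Fin n → Fin m)
    (U : CompactOpens (F.obj n)) : CompactOpens (F.obj m) where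
  carrier := F.map f ⁻¹' U
  isCompact' := U.isCompact.preimage_of_isOpen (F.map f).spectral' U.isOpen
  isOpen' := U.isOpen.preimage (F.map f).spectral'.continuous

/-- The direct image of a compact open set under `F_f`. -/
def image (F : TypeSpaceFunctor.{u}) {n m : ℕ} (f : Fin n → Fin m)
    (U : CompactOpens (F.obj m)) : CompactOpens (F.obj n) :=
  U.map (F.map f) (F.map f).spectral'.continuous (F.isOpenMap f)

/-- The signature `L(F)`: an `n`-ary relation symbol `R_U` for every compact open `U ⊆ F_n`. -/
abbrev lang (F : TypeSpaceFunctor.{u}) : FirstOrder.Language.{0, u} :=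
  ⟨fun _ => Empty, fun n => CompactOpens (F.obj n)⟩

/-- The internal logic of `F`: the compact open set `⟦φ⟧ ⊆ F_n` of an `n`-ary formula of `L(F)`. -/
def interp (F : TypeSpaceFunctor.{u}) : ∀ {n : ℕ}, CohFormula F.lang n → CompactOpens (F.obj n)
  | _, .top => ⊤
  | _, .bot => ⊥
  | _, .eq i j => F.image (Function.update id i j) ⊤
  | _, .rel U f => F.preimage f U
  | _, .and φ ψ => F.interp φ ⊓ F.interp ψ
  | _, .or φ ψ => F.interp φ ⊔ F.interp ψ
  | _, .ex φ => F.image Fin.castSucc (F.interp φ)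

/-- The theory of `F`. -/
def Th (F : TypeSpaceFunctor.{u}) : CohTheory.{u} where
  lang := F.lang
  relational := fun _ => inferInstanceAs (IsEmpty Empty)
  sentences := { s | F.interp s.prem ≤ F.interp s.concl }

/-- The atomic formula `R_U(x̄)` of `L(F)`. -/
abbrev atom (F : TypeSpaceFunctor.{u}) {n m : ℕ} (U : CompactOpens (F.obj n))
    (x : Fin n → Fin m) : CohFormula F.lang m := .rel (L := F.lang) U x

/-! ### Partial natural transformations -/

/-- A partial spectral map: a spectral map defined on a compact open subset. -/
structure IsPartialSpectral {X Y : Type u} [TopologicalSpace X] [TopologicalSpace Y]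
    (f : X →. Y) : Prop where
  isOpen_dom : IsOpen f.Dom
  isCompact_dom : IsCompact f.Dom
  isSpectralMap : IsSpectralMap f.asSubtype

theorem preimage_eq_image {X Y : Type u} (f : X →. Y) (V : Set Y) :
    f.preimage V = (Subtype.val : f.Dom → X) '' (f.asSubtype ⁻¹' V) := by
  ext x
  constructor
  · rintro ⟨y, hy, h, rfl⟩
    exact ⟨⟨x, h⟩, hy, rfl⟩
  · rintro ⟨⟨x, h⟩, hy, rfl⟩
    exact ⟨_, hy, h, rfl⟩

/-- The preimage of a compact open set under a partial spectral map. -/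
def IsPartialSpectral.pre {X Y : Type u} [TopologicalSpace X] [TopologicalSpace Y]
    {f : X →. Y} (hf : IsPartialSpectral f) (V : CompactOpens Y) : CompactOpens X where
  carrier := f.preimage V
  isCompact' := by
    rw [preimage_eq_image]
    exact (V.isCompact.preimage_of_isOpen hf.isSpectralMap V.isOpen).image continuous_subtype_val
  isOpen' := by
    rw [preimage_eq_image]
    exact hf.isOpen_dom.isOpenMap_subtype_val _
      (V.isOpen.preimage hf.isSpectralMap.continuous)

/-- The data of a partial natural transformation of arity `k`: partial maps `F_{nk} ⇀ F'_n`. -/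
structure PreTrans (F F' : TypeSpaceFunctor.{u}) : Type u where
  arity : ℕ
  arity_pos : 1 ≤ arity
  app : ∀ n : ℕ, F.obj (n * arity) →. F'.obj n

namespace PreTrans

variable {F F' : TypeSpaceFunctor.{u}} (β : PreTrans F F')

/-- Partial natural transformations: the domains form a cartesian family, and the naturality squares
commute on the domain of the upper side. -/
structure IsPartialNatTrans : Prop where
  isPartialSpectral : ∀ n : ℕ, IsPartialSpectral (β.app n)
  cartesian : ∀ n : ℕ, (β.app n).Dom =
    ⋂ i : Fin n, F.map (times (fun _ : Fin 1 => i) β.arity) ⁻¹' (β.app 1).Dom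
  natural : ∀ {n m : ℕ} (f : Fin n → Fin m) (p : F.obj (m * β.arity)) (q : F'.obj m),
    q ∈ β.app m p → F'.map f q ∈ β.app n (F.map (times f β.arity) p)

/-- The weak Beck-Chevalley condition
`β_n⁻¹ (F'_f(V)) ∩ F_{f^{×k}}(F_{mk}) = F_{f^{×k}}(β_m⁻¹(V))`, where the intersection is omitted
in the case `n = 0`. -/
def WeakBeckChevalley : Prop :=
  ∀ {n m : ℕ} (f : Fin n → Fin m) (V : CompactOpens (F'.obj m)),
    ((β.app n).preimage (F'.map f '' (V : Set (F'.obj m))) ∩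
      Set.range (F.map (times f β.arity)) =
      F.map (times f β.arity) '' (β.app m).preimage V) ∧
    (n = 0 → (β.app n).preimage (F'.map f '' (V : Set (F'.obj m))) =
      F.map (times f β.arity) '' (β.app m).preimage V)

/-- The conditions on the 1-cells `F ⇀ F'` of the 2-category of type space functors. -/
structure IsCell : Prop extends β.IsPartialNatTrans where
  weakBeckChevalley : β.WeakBeckChevalley

end PreTrans

/-- Partial natural transformations that satisfy the weak Beck-Chevalley condition. -/
structure Trans (F F' : TypeSpaceFunctor.{u}) : Type u extends PreTrans F F' where
  isCell : toPreTrans.IsCell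

namespace Trans

variable {F F' : TypeSpaceFunctor.{u}}

/-- The compact open set `β_n⁻¹(U)`. -/
def pre (β : Trans F F') {n : ℕ} (U : CompactOpens (F'.obj n)) :
    CompactOpens (F.obj (n * β.arity)) :=
  (β.isCell.isPartialSpectral n).pre U

/-- The compact open set `β_2⁻¹(⟦x = y⟧)`. -/
def eqv (β : Trans F F') : CompactOpens (F.obj (2 * β.arity)) := β.pre (F'.interp (.eq 0 1))

/-- The formula `R_E(x̄, ȳ)` of `L(F)` with `E = β_2⁻¹(⟦x = y⟧)`. -/
def eqAt (β : Trans F F') {m : ℕ} (x y : Fin β.arity → Fin m) : CohFormula F.lang m :=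
  F.atom β.eqv (concat ![x, y])

/-- The conditions on a morphism of interpretations, in the internal logic of `F`, for a compact open
set `Θ ⊆ F_{k+k'}` to be a morphism of partial natural transformations `(β, k) → (β', k')`. -/
structure IsMor (β β' : Trans F F') (Θ : CompactOpens (F.obj (β.arity + β'.arity))) : Prop where
  total : F.interp (β.eqAt id id) ≤ F.interp (.exs β'.arity (F.atom Θ id))
  le_domain : F.interp (F.atom Θ id) ≤
    F.interp (.and (β.eqAt (Fin.castAdd β'.arity) (Fin.castAdd β'.arity))
      (β'.eqAt (Fin.natAdd β.arity) (Fin.natAdd β.arity)))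
  congr_left : ∀ {m : ℕ} (x x' : Fin β.arity → Fin m) (y : Fin β'.arity → Fin m),
    F.interp (.and (F.atom Θ (Fin.append x y)) (β.eqAt x x')) ≤
      F.interp (F.atom Θ (Fin.append x' y))
  congr_right : ∀ {m : ℕ} (x : Fin β.arity → Fin m) (y y' : Fin β'.arity → Fin m),
    F.interp (.and (F.atom Θ (Fin.append x y)) (β'.eqAt y y')) ≤
      F.interp (F.atom Θ (Fin.append x y'))
  preserves : ∀ {n m : ℕ} (U : CompactOpens (F'.obj n))
    (x : Fin n → Fin β.arity → Fin m) (y : Fin n → Fin β'.arity → Fin m),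
    F.interp (.and (F.atom (β.pre U) (concat x))
      (.conj fun i : Fin n => F.atom Θ (Fin.append (x i) (y i)))) ≤
    F.interp (F.atom (β'.pre U) (concat y))

/-- Morphisms of partial natural transformations. -/
structure Mor (β β' : Trans F F') : Type u where
  set : CompactOpens (F.obj (β.arity + β'.arity))
  isMor : IsMor β β' set

/-! ### Identities and compositions -/

/-- The identity, of arity one; `F_{n·1}` is identified with `F_n`. -/
def preId (F : TypeSpaceFunctor.{u}) : PreTrans F F where
  arity := 1
  arity_pos := le_rfl
  app n := fun p => Part.some (F.map (fun i : Fin n => finProdFinEquiv (i, (0 : Fin 1))) p)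

/-- The composite `F ⇀ F' ⇀ F''` of `(β, k)` and `(γ, l)` has arity `lk` and consists of the composites
`F_{nlk} ⇀ F'_{nl} ⇀ F''_n`. -/
def preComp {F'' : TypeSpaceFunctor.{u}} (β : Trans F F') (γ : Trans F' F'') :
    PreTrans F F'' where
  arity := γ.arity * β.arity
  arity_pos := Nat.mul_pos γ.arity_pos β.arity_pos
  app n := fun p =>
    (β.app (n * γ.arity) (F.map (Fin.cast (Nat.mul_assoc n γ.arity β.arity)) p)).bind (γ.app n)

/-- The identity morphism: `⟦R_E(x̄, ȳ)⟧` with `E = β_2⁻¹(⟦x = y⟧)`. -/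
def preId₂ (β : Trans F F') : CompactOpens (F.obj (β.arity + β.arity)) :=
  F.interp (β.eqAt (Fin.castAdd β.arity) (Fin.natAdd β.arity))

/-- Vertical composition: `⟦∃ ȳ (R_Θ(x̄, ȳ) ∧ R_H(ȳ, z̄))⟧`. -/
def preVcomp {β β' β'' : Trans F F'} (Θ : Mor β β') (H : Mor β' β'') :
    CompactOpens (F.obj (β.arity + β''.arity)) :=
  let N := β.arity + β''.arity
  let x : Fin β.arity → Fin (N + β'.arity) :=
    fun i => Fin.castAdd β'.arity (Fin.castAdd β''.arity i)
  let z : Fin β''.arity → Fin (N + β'.arity) :=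
    fun i => Fin.castAdd β'.arity (Fin.natAdd β.arity i)
  let y : Fin β'.arity → Fin (N + β'.arity) := Fin.natAdd N
  F.interp (.exs β'.arity
    (.and (F.atom Θ.set (Fin.append x y)) (F.atom H.set (Fin.append y z))))

/-- Horizontal composition, in the internal logic of `F`: the formula for morphisms of interpretations,
with `R_Θ` in the role of `η`, `R_H` in the role of `θ`, and preimages under `β`, `β'` in the
role of the actions of `Δ`, `Δ'` on formulas. -/
def preHcomp {F'' : TypeSpaceFunctor.{u}} {β β' : Trans F F'} {γ γ' : Trans F' F''}
    (Θ : Mor β β') (H : Mor γ γ') :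
    CompactOpens (F.obj (γ.arity * β.arity + γ'.arity * β'.arity)) :=
  let N := γ.arity * β.arity + γ'.arity * β'.arity
  let K := γ'.arity * β.arity + γ'.arity * β'.arity
  let x : Fin γ.arity → Fin β.arity → Fin (N + K) :=
    blocks fun i => Fin.castAdd K (Fin.castAdd _ i)
  let z : Fin γ'.arity → Fin β'.arity → Fin (N + K) :=
    blocks fun i => Fin.castAdd K (Fin.natAdd _ i)
  let y : Fin γ'.arity → Fin β.arity → Fin (N + K) :=
    blocks fun i => Fin.natAdd N (Fin.castAdd _ i)
  let w : Fin γ'.arity → Fin β'.arity → Fin (N + K) :=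
    blocks fun i => Fin.natAdd N (Fin.natAdd _ i)
  F.interp (.exs K
    (.and (.and (F.atom (β.pre H.set) (concat (Fin.append x y)))
      (.conj fun i : Fin γ'.arity => F.atom Θ.set (Fin.append (y i) (w i))))
      (F.atom (β'.pre γ'.eqv) (concat (concat ![w, z])))))

end Trans

/-- The identities and composites of 1-cells and 2-cells are again such. -/
structure OpsClosed : Prop where
  id₁ : ∀ F : TypeSpaceFunctor.{u}, (Trans.preId F).IsCell
  comp₁ : ∀ {F F' F'' : TypeSpaceFunctor.{u}} (β : Trans F F') (γ : Trans F' F''),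
    (Trans.preComp β γ).IsCell
  id₂ : ∀ {F F' : TypeSpaceFunctor.{u}} (β : Trans F F'), Trans.IsMor β β (Trans.preId₂ β)
  vcomp : ∀ {F F' : TypeSpaceFunctor.{u}} {β β' β'' : Trans F F'}
    (Θ : Trans.Mor β β') (H : Trans.Mor β' β''), Trans.IsMor β β'' (Trans.preVcomp Θ H)
  hcomp : ∀ {F F' F'' : TypeSpaceFunctor.{u}} {β β' : Trans F F'} {γ γ' : Trans F' F''}
    (Θ : Trans.Mor β β') (H : Trans.Mor γ γ'),
    Trans.IsMor ⟨Trans.preComp β γ, comp₁ β γ⟩ ⟨Trans.preComp β' γ', comp₁ β' γ'⟩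
      (Trans.preHcomp Θ H)

/-- The 2-category of type space functors, partial natural transformations that satisfy the weak
Beck-Chevalley condition, and their morphisms. -/
def twoCat (h : OpsClosed.{u}) : TwoCatData.{u + 1, u} TypeSpaceFunctor.{u} where
  Hom F F' := Trans F F'
  Hom₂ β β' := Trans.Mor β β'
  id₁ F := ⟨Trans.preId F, h.id₁ F⟩
  comp₁ β γ := ⟨Trans.preComp β γ, h.comp₁ β γ⟩
  id₂ β := ⟨Trans.preId₂ β, h.id₂ β⟩
  vcomp Θ H := ⟨Trans.preVcomp Θ H, h.vcomp Θ H⟩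
  hcomp Θ H := ⟨Trans.preHcomp Θ H, h.hcomp Θ H⟩

/-! ### Natural transformations that satisfy the Beck-Chevalley condition -/

/-- Natural transformations `F → F'` that satisfy the Beck-Chevalley condition. -/
@[ext]
structure BCNatTrans (F F' : TypeSpaceFunctor.{u}) : Type u where
  app : ∀ n : ℕ, SpectralMap (F.obj n) (F'.obj n)
  natural : ∀ {n m : ℕ} (f : Fin n → Fin m) (p : F.obj m),
    F'.map f (app m p) = app n (F.map f p)
  beckChevalley : ∀ {n m : ℕ} (f : Fin n → Fin m) (V : CompactOpens (F'.obj m)),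
    app n ⁻¹' (F'.map f '' (V : Set (F'.obj m))) = F.map f '' (app m ⁻¹' (V : Set (F'.obj m)))

/-- The category of type space functors and natural transformations that satisfy the Beck-Chevalley
condition. -/
instance : Category TypeSpaceFunctor.{u} where
  Hom F F' := BCNatTrans F F'
  id F :=
    { app := fun n => SpectralMap.id (F.obj n)
      natural := fun _ _ => rfl
      beckChevalley := fun _ _ => rfl }
  comp {F F' F''} β γ :=
    { app := fun n => (γ.app n).comp (β.app n)
      natural := fun f p => by
        simp only [SpectralMap.comp_apply]
        rw [γ.natural, β.natural]
      beckChevalley := fun {n m} f V => by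
        let W : CompactOpens (F'.obj m) :=
          ⟨⟨γ.app m ⁻¹' V, V.isCompact.preimage_of_isOpen (γ.app m).spectral' V.isOpen⟩,
            V.isOpen.preimage (γ.app m).spectral'.continuous⟩
        have h₁ := γ.beckChevalley f V
        have h₂ := β.beckChevalley f W
        rw [SpectralMap.coe_comp, SpectralMap.coe_comp, Set.preimage_comp, Set.preimage_comp, h₁]
        exact h₂ }
  id_comp _ := rfl
  comp_id _ := rfl
  assoc _ _ _ := rfl

/-- A natural transformation as (the data of) a partial natural transformation of arity one. -/
def BCNatTrans.toPreTrans {F F' : TypeSpaceFunctor.{u}} (β : BCNatTrans F F') : PreTrans F F' where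
  arity := 1
  arity_pos := le_rfl
  app n := fun p =>
    Part.some (β.app n (F.map (fun i : Fin n => finProdFinEquiv (i, (0 : Fin 1))) p))

/-- Natural transformations that satisfy the Beck-Chevalley condition are 1-cells of the 2-category of
type space functors, compatibly with identities and composition. -/
structure BCClosed (h : OpsClosed.{u}) : Prop where
  isCell : ∀ {F F' : TypeSpaceFunctor.{u}} (β : F ⟶ F'), (BCNatTrans.toPreTrans β).IsCell
  id : ∀ F : TypeSpaceFunctor.{u},
    (⟨BCNatTrans.toPreTrans (𝟙 F), isCell (𝟙 F)⟩ : Trans F F) = (twoCat h).id₁ F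
  comp : ∀ {F F' F'' : TypeSpaceFunctor.{u}} (β : F ⟶ F') (γ : F' ⟶ F''),
    (⟨BCNatTrans.toPreTrans (β ≫ γ), isCell (β ≫ γ)⟩ : Trans F F'') =
      (twoCat h).comp₁ (⟨BCNatTrans.toPreTrans β, isCell β⟩ : Trans F F')
        (⟨BCNatTrans.toPreTrans γ, isCell γ⟩ : Trans F' F'')

/-! ### The theory of a type space functor, on 1-cells and 2-cells -/

/-- `Th(β, k) : Th(F') → Th(F)` sends `R_U` to `R_{β_n⁻¹(U)}` and `x = y` to `R_{β_2⁻¹(⟦x = y⟧)}`. -/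
def thMap {F F' : TypeSpaceFunctor.{u}} (β : Trans F F') :
    CohTheory.PreInterp F'.Th F.Th where
  arity := β.arity
  arity_pos := β.arity_pos
  eqv := CohTheory.Lind.mk (F.atom β.eqv id)
  rel U := CohTheory.Lind.mk (F.atom (β.pre U) id)

/-- `Th(Θ)` is the formula `R_Θ`. -/
def thMap₂ {F F' : TypeSpaceFunctor.{u}} {β β' : Trans F F'} (Θ : Trans.Mor β β') :
    F.Th.Lind (β.arity + β'.arity) :=
  CohTheory.Lind.mk (F.atom Θ.set id)

/-- Partial natural transformations give interpretations, and their morphisms give morphisms of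
interpretations. -/
structure ThClosed : Prop where
  isInterp : ∀ {F F' : TypeSpaceFunctor.{u}} (β : Trans F F'), (thMap β).IsInterp
  isMor : ∀ {F F' : TypeSpaceFunctor.{u}} {β β' : Trans F F'} (Θ : Trans.Mor β β'),
    CohTheory.Interp.IsMor ⟨thMap β, isInterp β⟩ ⟨thMap β', isInterp β'⟩ (thMap₂ Θ)

end TypeSpaceFunctor

end PosLogic

open PosLogic

/-! On the side of theories everything is checked in models. Entailment is semantic by definition,
so two classes of formulas are equal as soon as they are realised by the same tuples of every model.
An interpretation `(Γ, k)` of `T` in `T'` amounts to this: every model `M` of `T'` presents a model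
`N` of `T`, with elements of `N` represented by `k`-tuples of `M` (`PreInterp.Presentation`,
`Interp.exists_presentation`, `isInterp_of_presentations`). Here `N` is the quotient of the tuples
satisfying `Γ(x = x)` by the congruence `Γ(x = y)`. A morphism of interpretations is a formula that
defines, in every `M`, the graph of a map between the two presented structures preserving coherent
formulas (`IsMor.exists_map`, `isMor_of_maps`).

Composite interpretations correspond to presentations in two steps, vertical composition to
composition of maps, and horizontal composition to one map followed by another pushed forward to a
second model (`represents_preHcomp`). The axioms of a strict 2-category thus become identities
between functions; interchange is the naturality square of a morphism (`Represents.naturality`).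

For a type space functor `F`, inclusions of values are the axioms of `Th F`, and every formula is
equivalent to an atomic one. A 1-cell `β` gives an interpretation because preimages under `β`
respect the operations of the internal logic. Naturality and the cartesian condition handle
substitution, and the weak Beck–Chevalley condition handles the quantifier
(`Trans.pre_image_castSucc`, `exists_thMap_presentation`).

The other main ingredient is completeness, `mkTh_le_iff`: entailment in `Th F` implies inclusion of
values. By a Henkin construction, every point of `F_n` is the type of a tuple in a model.
Beck–Chevalley for the pushouts adjoining a variable supplies witnesses at finite stages, and
ultrafilter limits in the constructible topology glue the stages. By completeness `Th` is injective
on 2-cells and reflects the property of being a 2-cell, so the laws for 2-cells of type space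
functors follow from those for theories. The laws for 1-cells are verified directly on points. -/

namespace PosLogic

/-! ## Tuples -/

section Tuples

variable {α β : Type*} {n m k : ℕ}

@[simp] theorem concat_blocks (x : Fin (n * k) → α) : concat (blocks x) = x := by
  funext p
  exact congrArg x (finProdFinEquiv.apply_symm_apply p)

@[simp] theorem blocks_concat (x : Fin n → Fin k → α) : blocks (concat x) = x := by
  funext i j
  simp [concat, blocks]

@[simp] theorem concat_apply (x : Fin n → Fin k → α) (i : Fin n) (j : Fin k) :
    concat x (finProdFinEquiv (i, j)) = x i j := by
  simp [concat]

theorem concat_comp_finProd (x : Fin n → Fin k → α) (i : Fin n) :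
    (concat x ∘ fun j => finProdFinEquiv (i, j)) = x i :=
  funext fun j => concat_apply x i j

theorem exists_concat (a : Fin (n * k) → α) : ∃ x : Fin n → Fin k → α, a = concat x :=
  ⟨blocks a, (concat_blocks a).symm⟩

theorem exists_append (a : Fin (n + k) → α) :
    ∃ (x : Fin n → α) (y : Fin k → α), a = Fin.append x y :=
  ⟨fun i => a (Fin.castAdd k i), fun i => a (Fin.natAdd n i), Fin.append_castAdd_natAdd.symm⟩

theorem exists_pair (a : Fin 2 → α) : ∃ x y : α, a = ![x, y] :=
  ⟨a 0, a 1, by funext i; fin_cases i <;> rfl⟩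

theorem comp_concat (f : α → β) (x : Fin n → Fin k → α) :
    f ∘ concat x = concat fun i j => f (x i j) := rfl

theorem comp_blocks (f : α → β) (x : Fin (n * k) → α) (i : Fin n) :
    f ∘ blocks x i = fun j => f (x (finProdFinEquiv (i, j))) := rfl

theorem comp_append (f : α → β) (x : Fin n → α) (y : Fin m → α) :
    f ∘ Fin.append x y = Fin.append (f ∘ x) (f ∘ y) := by
  funext i
  refine Fin.addCases (fun i => ?_) (fun i => ?_) i <;> simp

theorem append_comp_castAdd (x : Fin n → α) (y : Fin m → α) :
    Fin.append x y ∘ Fin.castAdd m = x := by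
  funext i
  simp

theorem append_comp_natAdd (x : Fin n → α) (y : Fin m → α) :
    Fin.append x y ∘ Fin.natAdd n = y := by
  funext i
  simp

theorem append_comp_castAdd' {ι : Type*} (x : Fin n → α) (y : Fin m → α) (f : ι → Fin n) :
    (Fin.append x y ∘ fun i => Fin.castAdd m (f i)) = x ∘ f := by
  funext i
  simp

theorem append_comp_natAdd' {ι : Type*} (x : Fin n → α) (y : Fin m → α) (f : ι → Fin m) :
    (Fin.append x y ∘ fun i => Fin.natAdd n (f i)) = y ∘ f := by
  funext i
  simp

theorem comp_concat_append (f : α → β) (x : Fin n → Fin k → α) (y : Fin m → Fin k → α) :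
    f ∘ concat (Fin.append x y) =
      concat (Fin.append (fun i j => f (x i j)) fun i j => f (y i j)) := by
  rw [comp_concat]
  congr 1
  funext i
  refine Fin.addCases (fun i => ?_) (fun i => ?_) i <;> simp

theorem comp_concat_concat_pair (f : α → β) (x y : Fin n → Fin k → α) :
    f ∘ concat (concat ![x, y]) =
      concat (concat ![fun i j => f (x i j), fun i j => f (y i j)]) := by
  funext p
  obtain ⟨⟨q, l⟩, rfl⟩ := finProdFinEquiv.surjective p
  obtain ⟨⟨i, j⟩, rfl⟩ := finProdFinEquiv.surjective q
  rw [Function.comp_apply]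
  simp only [concat_apply]
  fin_cases i <;> rfl

theorem exists_append_concat {l : ℕ} {p : (Fin (n * k + m * l) → α) → Prop} :
    (∃ b, p b) ↔ ∃ (y : Fin n → Fin k → α) (w : Fin m → Fin l → α),
      p (Fin.append (concat y) (concat w)) := by
  constructor
  · rintro ⟨b, hb⟩
    obtain ⟨y, w, rfl⟩ := exists_append b
    exact ⟨blocks y, blocks w, by simpa using hb⟩
  · rintro ⟨y, w, h⟩
    exact ⟨_, h⟩

theorem comp_pair (f : α → β) (x y : α) : f ∘ ![x, y] = ![f x, f y] := by
  funext i
  fin_cases i <;> rfl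

theorem concat_comp_times (x : Fin m → Fin k → α) (f : Fin n → Fin m) :
    concat x ∘ times f k = concat (x ∘ f) := by
  funext p
  simp [concat, times]

/-- Since the `j`-th member of block `i` sits at position `k * i + j`, the last of `n + 1` blocks
occupies the last `k` places. This is the regrouping used in the existential clause of `onFormula`.
-/
theorem append_concat_comp_cast (x : Fin n → Fin k → α) (y : Fin k → α) :
    Fin.append (concat x) y ∘ Fin.cast (Nat.succ_mul n k) =
      concat (Fin.snoc x y : Fin (n + 1) → Fin k → α) := by
  funext p
  obtain ⟨⟨i, j⟩, rfl⟩ := finProdFinEquiv.surjective p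
  rw [concat_apply]
  refine Fin.lastCases ?_ (fun i => ?_) i
  · have e : Fin.cast (Nat.succ_mul n k) (finProdFinEquiv (Fin.last n, j)) = Fin.natAdd _ j := by
      ext
      simp [finProdFinEquiv]
      ring
    simp [e]
  · have e : Fin.cast (Nat.succ_mul n k) (finProdFinEquiv (i.castSucc, j)) =
        Fin.castAdd k (finProdFinEquiv (i, j)) := by
      ext
      simp [finProdFinEquiv]
    simp [e]

/-- Regrouping of blocks of blocks. -/
theorem concat_concat (x : Fin n → Fin m → Fin k → α) :
    concat (fun i => concat (x i)) ∘ Fin.cast (Nat.mul_assoc n m k) = concat (concat x) := by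
  funext p
  obtain ⟨⟨q, l⟩, rfl⟩ := finProdFinEquiv.surjective p
  obtain ⟨⟨i, j⟩, rfl⟩ := finProdFinEquiv.surjective q
  have e : Fin.cast (Nat.mul_assoc n m k) (finProdFinEquiv (finProdFinEquiv (i, j), l)) =
      finProdFinEquiv (i, finProdFinEquiv (j, l)) := by
    ext
    simp [finProdFinEquiv]
    ring
  simp only [Function.comp_apply, e, concat_apply]

theorem concat_comp_pair (f : α → β) (x y : Fin k → α) :
    concat ![f ∘ x, f ∘ y] = concat fun (i : Fin 2) j => f ((![x, y] : Fin 2 → _) i j) := by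
  congr 1
  funext i
  fin_cases i <;> rfl

end Tuples

/-! ### Coherent formulas and their classes evaluated in models. -/

namespace CohFormula

variable {L : FirstOrder.Language.{0, u}}

theorem realize_conj {M : Type w} [L.Structure M] {n m : ℕ} (φ : Fin m → CohFormula L n)
    (a : Fin n → M) : (conj φ).Realize a ↔ ∀ i, (φ i).Realize a := by
  induction m with
  | zero => simp [conj, Realize]
  | succ m ih => simp [conj, Realize, ih, Fin.forall_fin_succ]

/-- A map that preserves the relations preserves all coherent formulas. -/
def Preserves (L : FirstOrder.Language.{0, u}) {M N : Type w} [L.Structure M] [L.Structure N]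
    (h : M → N) : Prop :=
  ∀ ⦃n : ℕ⦄ (φ : CohFormula L n) (a : Fin n → M), φ.Realize a → φ.Realize (h ∘ a)

theorem Preserves.id (M : Type w) [L.Structure M] : Preserves L (_root_.id : M → M) :=
  fun _ _ _ h => h

theorem Preserves.comp {M N P : Type w} [L.Structure M] [L.Structure N] [L.Structure P]
    {g : N → P} {f : M → N} (hg : Preserves L g) (hf : Preserves L f) : Preserves L (g ∘ f) :=
  fun _ φ a h => hg φ (f ∘ a) (hf φ a h)

end CohFormula

namespace CohTheory

/-- The models of a theory. -/
structure Model (T : CohTheory.{u}) : Type (u + 1) where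
  carrier : Type u
  [str : T.lang.Structure carrier]
  isModel : T.IsModel carrier

instance (T : CohTheory.{u}) : CoeSort T.Model (Type u) := ⟨Model.carrier⟩

instance {T : CohTheory.{u}} (M : T.Model) : T.lang.Structure M := M.str

namespace Lind

variable {T : CohTheory.{u}} {n m : ℕ}

/-- Satisfaction of a class of formulas in a model. -/
def Realize (c : T.Lind n) (M : T.Model) (a : Fin n → M) : Prop :=
  Quotient.lift (s := T.setoid n) (fun φ => φ.Realize a)
    (fun _ _ h => propext ⟨h.1 M M.isModel a, h.2 M M.isModel a⟩) c

variable {M : T.Model}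

@[simp] theorem realize_mk (φ : CohFormula T.lang n) (a : Fin n → M) :
    (mk φ).Realize M a ↔ φ.Realize a := Iff.rfl

theorem exists_mk (c : T.Lind n) : ∃ φ, c = mk φ := by
  obtain ⟨φ, rfl⟩ := Quotient.exists_rep c
  exact ⟨φ, rfl⟩

/-- The order on classes is semantic by definition, so no proof calculus intervenes: inequalities,
and by antisymmetry equalities, are tested on tuples of models. -/
theorem le_iff {c d : T.Lind n} :
    c ≤ d ↔ ∀ (M : T.Model) (a : Fin n → M), c.Realize M a → d.Realize M a := by
  obtain ⟨φ, rfl⟩ := exists_mk c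
  obtain ⟨ψ, rfl⟩ := exists_mk d
  exact ⟨fun h M a x => h M M.isModel a x, fun h M _ hM a x => h ⟨M, hM⟩ a x⟩

theorem ext_realize {c d : T.Lind n}
    (h : ∀ (M : T.Model) (a : Fin n → M), c.Realize M a ↔ d.Realize M a) : c = d :=
  le_antisymm (le_iff.2 fun M a => (h M a).1) (le_iff.2 fun M a => (h M a).2)

@[simp] theorem realize_subst (c : T.Lind n) (f : Fin n → Fin m) (a : Fin m → M) :
    (c.subst f).Realize M a ↔ c.Realize M (a ∘ f) := by
  obtain ⟨φ, rfl⟩ := exists_mk c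
  exact CohFormula.realize_subst φ f a

@[simp] theorem realize_exs (k : ℕ) (c : T.Lind (n + k)) (a : Fin n → M) :
    (exs k c).Realize M a ↔ ∃ b : Fin k → M, c.Realize M (Fin.append a b) := by
  obtain ⟨φ, rfl⟩ := exists_mk c
  exact CohFormula.realize_exs k φ a

@[simp] theorem realize_inf (c d : T.Lind n) (a : Fin n → M) :
    (c ⊓ d).Realize M a ↔ c.Realize M a ∧ d.Realize M a := by
  obtain ⟨φ, rfl⟩ := exists_mk c
  obtain ⟨ψ, rfl⟩ := exists_mk d
  exact Iff.rfl

@[simp] theorem realize_sup (c d : T.Lind n) (a : Fin n → M) :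
    (c ⊔ d).Realize M a ↔ c.Realize M a ∨ d.Realize M a := by
  obtain ⟨φ, rfl⟩ := exists_mk c
  obtain ⟨ψ, rfl⟩ := exists_mk d
  exact Iff.rfl

@[simp] theorem realize_top (a : Fin n → M) : (⊤ : T.Lind n).Realize M a ↔ True := Iff.rfl

@[simp] theorem realize_bot (a : Fin n → M) : (⊥ : T.Lind n).Realize M a ↔ False := Iff.rfl

@[simp] theorem realize_finset_inf {ι : Type*} (s : Finset ι) (c : ι → T.Lind n)
    (a : Fin n → M) : (s.inf c).Realize M a ↔ ∀ i ∈ s, (c i).Realize M a := by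
  classical
  induction s using Finset.induction_on with
  | empty => simp
  | insert i s _ ih => simp [Finset.inf_insert, ih]

end Lind

/-! ## Presentations -/

namespace PreInterp

variable {T T' : CohTheory.{u}} (Γ : PreInterp T T')

/-- A presentation of a `T`-structure `N` as the structure interpreted by `Γ` in the model `M`: tuples
of elements of `M` represent elements of `N`. -/
structure Presentation (M : T'.Model) (N : Type u) [T.lang.Structure N] where
  Rep : (Fin Γ.arity → M) → N → Prop
  surj : ∀ c, ∃ x, Rep x c
  unique : ∀ {x c d}, Rep x c → Rep x d → c = d
  eqv_iff : ∀ x y, Γ.eqv.Realize M (concat ![x, y]) ↔ ∃ c, Rep x c ∧ Rep y c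
  rel_iff : ∀ {n : ℕ} (R : T.lang.Relations n) (a : Fin n → Fin Γ.arity → M),
    (Γ.rel R).Realize M (concat a) ↔
      ∃ c : Fin n → N, (∀ i, Rep (a i) (c i)) ∧ FirstOrder.Language.Structure.RelMap R c

@[simp] theorem realize_eqAt {M : T'.Model} {m : ℕ} (x y : Fin Γ.arity → Fin m) (a : Fin m → M) :
    (Γ.eqAt x y).Realize M a ↔ Γ.eqv.Realize M (concat ![a ∘ x, a ∘ y]) := by
  have e : a ∘ concat ![x, y] = concat ![a ∘ x, a ∘ y] := by
    rw [comp_concat]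
    congr 1
    funext i
    fin_cases i <;> rfl
  rw [eqAt, Lind.realize_subst, e]

theorem realize_domain {M : T'.Model} {n : ℕ} (a : Fin n → Fin Γ.arity → M) :
    (Γ.domain n).Realize M (concat a) ↔ ∀ i, Γ.eqv.Realize M (concat ![a i, a i]) := by
  have e : ∀ i : Fin n, (concat a ∘ fun j => finProdFinEquiv (i, j)) = a i := by
    intro i
    funext j
    simp
  simp [domain, e]

variable {Γ}

namespace Presentation

variable {M : T'.Model} {N : Type u} [T.lang.Structure N] (A : Γ.Presentation M N)

theorem exists_rep_iff (x : Fin Γ.arity → M) :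
    Γ.eqv.Realize M (concat ![x, x]) ↔ ∃ c, A.Rep x c := by
  rw [A.eqv_iff]
  exact ⟨fun ⟨c, h, _⟩ => ⟨c, h⟩, fun ⟨c, h⟩ => ⟨c, h, h⟩⟩

theorem realize_domain {n : ℕ} (a : Fin n → Fin Γ.arity → M) :
    (Γ.domain n).Realize M (concat a) ↔ ∃ c : Fin n → N, ∀ i, A.Rep (a i) (c i) := by
  simp only [PreInterp.realize_domain, A.exists_rep_iff]
  exact Classical.skolem

theorem unique_tuple {n : ℕ} {a : Fin n → Fin Γ.arity → M} {c d : Fin n → N}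
    (h : ∀ i, A.Rep (a i) (c i)) (h' : ∀ i, A.Rep (a i) (d i)) : c = d :=
  funext fun i => A.unique (h i) (h' i)

theorem exists_tuple {n : ℕ} (c : Fin n → N) :
    ∃ a : Fin n → Fin Γ.arity → M, ∀ i, A.Rep (a i) (c i) :=
  Classical.skolem.1 fun i => A.surj (c i)

/-- A formula, translated along `Γ`, holds for tuples of `M` when they represent elements of `N` for
which the formula holds. -/
theorem realize_onFormula {n : ℕ} (φ : CohFormula T.lang n) (a : Fin n → Fin Γ.arity → M) :
    (Γ.onFormula φ).Realize M (concat a) ↔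
      ∃ c : Fin n → N, (∀ i, A.Rep (a i) (c i)) ∧ φ.Realize c := by
  induction φ with
  | top => simp [onFormula, CohFormula.Realize, A.realize_domain]
  | bot => simp [onFormula, CohFormula.Realize]
  | @eq n i j =>
    have e : a ∘ ![i, j] = ![a i, a j] := comp_pair a i j
    simp only [onFormula, Lind.realize_inf, A.realize_domain, Lind.realize_subst,
      concat_comp_times, e, A.eqv_iff, CohFormula.Realize]
    constructor
    · rintro ⟨⟨c, h⟩, d, h₁, h₂⟩
      exact ⟨c, h, (A.unique (h i) h₁).trans (A.unique (h j) h₂).symm⟩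
    · rintro ⟨c, h, h'⟩
      exact ⟨⟨c, h⟩, c i, h i, h' ▸ h j⟩
  | @rel n m R x =>
    simp only [onFormula, Lind.realize_inf, A.realize_domain, Lind.realize_subst,
      concat_comp_times, A.rel_iff, CohFormula.Realize]
    constructor
    · rintro ⟨⟨c, h⟩, d, h₁, h₂⟩
      have e : d = fun i => c (x i) := A.unique_tuple h₁ fun i => h (x i)
      exact ⟨c, h, e ▸ h₂⟩
    · rintro ⟨c, h, h'⟩
      exact ⟨⟨c, h⟩, _, fun i => h (x i), h'⟩
  | and φ ψ ih₁ ih₂ =>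
    simp only [onFormula, Lind.realize_inf, ih₁, ih₂, CohFormula.Realize]
    constructor
    · rintro ⟨⟨c, h, h₁⟩, d, h', h₂⟩
      exact ⟨c, h, h₁, A.unique_tuple h' h ▸ h₂⟩
    · rintro ⟨c, h, h₁, h₂⟩
      exact ⟨⟨c, h, h₁⟩, c, h, h₂⟩
  | or φ ψ ih₁ ih₂ =>
    simp only [onFormula, Lind.realize_sup, ih₁, ih₂, CohFormula.Realize]
    constructor
    · rintro (⟨c, h, h₁⟩ | ⟨c, h, h₁⟩)
      exacts [⟨c, h, Or.inl h₁⟩, ⟨c, h, Or.inr h₁⟩]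
    · rintro ⟨c, h, h₁ | h₁⟩
      exacts [Or.inl ⟨c, h, h₁⟩, Or.inr ⟨c, h, h₁⟩]
  | @ex n φ ih =>
    simp only [onFormula, Lind.realize_exs, Lind.realize_subst, append_concat_comp_cast, ih,
      CohFormula.Realize]
    -- Downwards, the induction hypothesis already supplies a represented element for the last
    -- block, because the translation is relativised to the domain. Upwards, surjectivity of `Rep`
    -- lifts the witness to a tuple.
    constructor
    · rintro ⟨b, c, h, h₁⟩
      refine ⟨Fin.init c, fun i => ?_, c (Fin.last n), ?_⟩
      · simpa [Fin.init] using h i.castSucc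
      · rwa [Fin.snoc_init_self]
    · rintro ⟨c, h, d, h₁⟩
      obtain ⟨b, hb⟩ := A.surj d
      refine ⟨b, _, fun i => ?_, h₁⟩
      refine Fin.lastCases ?_ (fun i => ?_) i
      · simpa using hb
      · simpa using h i

end Presentation

/-- A translated formula holds of exactly those tuples that represent a tuple satisfying it in the
presented model, so consequences of `T` pull back. The domain conditions hold because `Γ.rel` and
`Γ.eqv` are realised by representing tuples only. -/
theorem isInterp_of_presentations
    (h : ∀ M : T'.Model, ∃ N : T.Model, Nonempty (Γ.Presentation M N)) : Γ.IsInterp where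
  entails {n} φ ψ H := Lind.le_iff.2 fun M a => by
    obtain ⟨N, ⟨A⟩⟩ := h M
    obtain ⟨a, rfl⟩ := exists_concat a
    rw [A.realize_onFormula, A.realize_onFormula]
    rintro ⟨c, h, h'⟩
    exact ⟨c, h, H N N.isModel c h'⟩
  rel_le R := Lind.le_iff.2 fun M a => by
    obtain ⟨N, ⟨A⟩⟩ := h M
    obtain ⟨a, rfl⟩ := exists_concat a
    rw [A.rel_iff, A.realize_domain]
    rintro ⟨c, h, _⟩
    exact ⟨c, h⟩
  eqv_le := Lind.le_iff.2 fun M a => by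
    obtain ⟨N, ⟨A⟩⟩ := h M
    obtain ⟨a, rfl⟩ := exists_concat a
    obtain ⟨x, y, rfl⟩ := exists_pair a
    rw [A.eqv_iff, A.realize_domain]
    rintro ⟨c, hx, hy⟩
    exact ⟨![c, c], Fin.forall_fin_two.2 ⟨hx, hy⟩⟩

/-- The structure interpreted in `M` is the quotient of the set of tuples in the domain by the
interpretation of equality, provided that this is a congruence. -/
theorem exists_presentation_of_congruence (M : T'.Model)
    (symm : ∀ x y : Fin Γ.arity → M,
      Γ.eqv.Realize M (concat ![x, y]) → Γ.eqv.Realize M (concat ![y, x]))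
    (trans : ∀ x y z : Fin Γ.arity → M, Γ.eqv.Realize M (concat ![x, y]) →
      Γ.eqv.Realize M (concat ![y, z]) → Γ.eqv.Realize M (concat ![x, z]))
    (rel_dom : ∀ {n : ℕ} (R : T.lang.Relations n) (a : Fin n → Fin Γ.arity → M),
      (Γ.rel R).Realize M (concat a) → ∀ i, Γ.eqv.Realize M (concat ![a i, a i]))
    (rel_congr : ∀ {n : ℕ} (R : T.lang.Relations n) (a b : Fin n → Fin Γ.arity → M),
      (∀ i, Γ.eqv.Realize M (concat ![a i, b i])) → (Γ.rel R).Realize M (concat a) →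
        (Γ.rel R).Realize M (concat b)) :
    ∃ (N : Type u) (_ : T.lang.Structure N), Nonempty (Γ.Presentation M N) := by
  let D := { x : Fin Γ.arity → M // Γ.eqv.Realize M (concat ![x, x]) }
  let s : Setoid D :=
    { r := fun x y => Γ.eqv.Realize M (concat ![x.1, y.1])
      iseqv := ⟨fun x => x.2, fun h => symm _ _ h, fun h h' => trans _ _ _ h h'⟩ }
  -- The relations are read off at chosen representatives; `rel_congr` makes the choice immaterial.
  let str : T.lang.Structure (Quotient s) :=
    { funMap := fun {n} f => ((T.relational n).false f).elim
      RelMap := fun {n} R c => (Γ.rel R).Realize M (concat fun i => (c i).out.1) }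
  refine ⟨Quotient s, str, ⟨⟨fun x c => ∃ h, c = Quotient.mk s ⟨x, h⟩, ?_, ?_, ?_, ?_⟩⟩⟩
  · intro c
    obtain ⟨x, rfl⟩ := Quotient.exists_rep c
    exact ⟨x.1, x.2, rfl⟩
  · rintro x c d ⟨_, rfl⟩ ⟨_, rfl⟩
    rfl
  · intro x y
    constructor
    · intro h
      -- Reflexivity is not assumed. It holds for any tuple that is related to something.
      have hx := trans _ _ _ h (symm _ _ h)
      have hy := trans _ _ _ (symm _ _ h) h
      exact ⟨_, ⟨hx, rfl⟩, hy, Quotient.sound h⟩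
    · rintro ⟨c, ⟨hx, rfl⟩, hy, h⟩
      exact Quotient.exact h
  · intro n R a
    constructor
    · intro h
      refine ⟨fun i => Quotient.mk s ⟨a i, rel_dom R a h i⟩, fun i => ⟨_, rfl⟩, ?_⟩
      refine rel_congr R a _ (fun i => ?_) h
      exact symm _ _ (Quotient.mk_out (s := s) ⟨a i, rel_dom R a h i⟩)
    · rintro ⟨c, h, h'⟩
      refine rel_congr R _ a (fun i => ?_) h'
      obtain ⟨hi, e⟩ := h i
      rw [e]
      exact Quotient.mk_out (s := s) ⟨a i, hi⟩

end PreInterp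

namespace Interp

variable {T T' : CohTheory.{u}}

theorem realize_onLind {Γ : Interp T T'} {M : T'.Model} {N : T.Model}
    (A : Γ.Presentation M N) {n : ℕ} (c : T.Lind n) (a : Fin n → Fin Γ.arity → M) :
    (Γ.onLind c).Realize M (concat a) ↔
      ∃ d : Fin n → N, (∀ i, A.Rep (a i) (d i)) ∧ c.Realize N d := by
  obtain ⟨φ, rfl⟩ := Lind.exists_mk c
  exact A.realize_onFormula φ a

/-- Symmetry and transitivity of equality and its compatibility with each relation are consequences
of every theory, so their translations make `Γ(x = y)` a congruence on its domain. The quotient is a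
model of `T` because each axiom of `T` is itself entailed by `T`. -/
theorem exists_presentation (Γ : Interp T T') (M : T'.Model) :
    ∃ N : T.Model, Nonempty (Γ.Presentation M N) := by
  have eqv_dom : ∀ x y : Fin Γ.arity → M, Γ.eqv.Realize M (concat ![x, y]) →
      ∀ i : Fin 2, Γ.eqv.Realize M (concat ![(![x, y] : Fin 2 → _) i, (![x, y] : Fin 2 → _) i]) :=
    fun x y h => (Γ.realize_domain _).1 (Lind.le_iff.1 Γ.isInterp.eqv_le M _ h)
  have key : ∀ {n : ℕ} (φ ψ : CohFormula T.lang n), T.Entails φ ψ →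
      ∀ a : Fin n → Fin Γ.arity → M, (Γ.onFormula φ).Realize M (concat a) →
        (Γ.onFormula ψ).Realize M (concat a) :=
    fun φ ψ h a => Lind.le_iff.1 (Γ.isInterp.entails φ ψ h) M _
  have heq : ∀ {n : ℕ} (i j : Fin n) (a : Fin n → Fin Γ.arity → M),
      (Γ.onFormula (.eq i j)).Realize M (concat a) ↔
        (∀ i, Γ.eqv.Realize M (concat ![a i, a i])) ∧ Γ.eqv.Realize M (concat ![a i, a j]) := by
    intro n i j a
    rw [PreInterp.onFormula, Lind.realize_inf, Γ.realize_domain, Lind.realize_subst,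
      concat_comp_times, comp_pair]
  have hrel : ∀ {n m : ℕ} (R : T.lang.Relations m) (x : Fin m → Fin n)
      (a : Fin n → Fin Γ.arity → M),
      (Γ.onFormula (.rel R x)).Realize M (concat a) ↔
        (∀ i, Γ.eqv.Realize M (concat ![a i, a i])) ∧ (Γ.rel R).Realize M (concat (a ∘ x)) := by
    intro n m R x a
    rw [PreInterp.onFormula, Lind.realize_inf, Γ.realize_domain, Lind.realize_subst,
      concat_comp_times]
  have hconj : ∀ {n m : ℕ} (φ : Fin m → CohFormula T.lang n) (a : Fin n → Fin Γ.arity → M),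
      (∀ i, Γ.eqv.Realize M (concat ![a i, a i])) →
      (∀ i, (Γ.onFormula (φ i)).Realize M (concat a)) →
        (Γ.onFormula (.conj φ)).Realize M (concat a) := by
    intro n m φ a hd h
    induction m with
    | zero => exact (Γ.realize_domain a).2 hd
    | succ m ih => exact (Lind.realize_inf _ _ _).2 ⟨h 0, ih _ fun i => h i.succ⟩
  have symm : ∀ x y : Fin Γ.arity → M,
      Γ.eqv.Realize M (concat ![x, y]) → Γ.eqv.Realize M (concat ![y, x]) := by
    intro x y h
    have := key (n := 2) (.eq 0 1) (.eq 1 0) (fun _ _ _ _ h => h.symm) ![x, y]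
      ((heq _ _ _).2 ⟨eqv_dom x y h, h⟩)
    exact ((heq _ _ _).1 this).2
  have dom : ∀ x y : Fin Γ.arity → M,
      Γ.eqv.Realize M (concat ![x, y]) → Γ.eqv.Realize M (concat ![x, x]) :=
    fun x y h => eqv_dom x y h 0
  obtain ⟨N, str, ⟨A⟩⟩ := Γ.exists_presentation_of_congruence M symm
    (fun x y z h h' => by
      have := key (n := 3) (.and (.eq 0 1) (.eq 1 2)) (.eq 0 2)
        (fun _ _ _ _ h => h.1.trans h.2) ![x, y, z]
      -- Only the clause for conjunctions is unfolded, so that the equalities keep the form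
      -- described by `heq`.
      simp only [PreInterp.onFormula.eq_5, Lind.realize_inf, heq] at this
      have d : ∀ i, Γ.eqv.Realize M
          (concat ![(![x, y, z] : Fin 3 → _) i, (![x, y, z] : Fin 3 → _) i]) := by
        intro i
        fin_cases i
        exacts [dom _ _ h, dom _ _ h', dom _ _ (symm _ _ h')]
      exact (this ⟨⟨d, h⟩, d, h'⟩).2)
    (fun R a h => (Γ.realize_domain _).1 (Lind.le_iff.1 (Γ.isInterp.rel_le R) M _ h))
    (fun {n} R a b h h' => by
      have d : ∀ i, Γ.eqv.Realize M (concat ![Fin.append a b i, Fin.append a b i]) := by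
        intro i
        refine Fin.addCases (fun i => ?_) (fun i => ?_) i
        · simpa using dom _ _ (h i)
        · rw [Fin.append_right]
          exact dom _ _ (symm _ _ (h i))
      -- Compatibility of `R` with equality is the entailment `R(x̄) ∧ ⋀ x_i = y_i → R(ȳ)` in `2n`
      -- variables.
      have := key (n := n + n)
        (.and (.rel R (Fin.castAdd n)) (.conj fun i : Fin n => .eq (Fin.castAdd n i) (Fin.natAdd n i)))
        (.rel R (Fin.natAdd n)) ?_ (Fin.append a b) ?_
      · have := ((hrel _ _ _).1 this).2
        rwa [append_comp_natAdd] at this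
      · rintro M _ _ c ⟨h₁, h₂⟩
        rw [CohFormula.realize_conj] at h₂
        have e : (fun i => c (Fin.castAdd n i)) = fun i => c (Fin.natAdd n i) := funext h₂
        simp only [CohFormula.Realize, e] at h₁
        exact h₁
      · refine (Lind.realize_inf _ _ _).2 ⟨(hrel _ _ _).2 ⟨d, ?_⟩, hconj _ _ d fun i =>
          (heq _ _ _).2 ⟨d, ?_⟩⟩
        · rwa [append_comp_castAdd]
        · rw [Fin.append_left, Fin.append_right]
          exact h i)
  refine ⟨⟨N, fun s hs c hc => ?_⟩, ⟨A⟩⟩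
  obtain ⟨a, ha⟩ := A.exists_tuple c
  obtain ⟨c', h, h'⟩ := (A.realize_onFormula s.concl a).1
    (key s.prem s.concl (fun M _ hM => hM s hs) a ((A.realize_onFormula s.prem a).2 ⟨c, ha, hc⟩))
  rwa [A.unique_tuple ha h]

end Interp

end CohTheory

end PosLogic

/-! ### Identity and composite interpretations, and morphisms between interpretations. -/

namespace PosLogic

namespace CohTheory

namespace PreInterp

namespace Presentation

/-- A model interprets itself. -/
def self {T : CohTheory.{u}} (M : T.Model) : (Interp.preId T).Presentation M M where
  Rep x c := x (0 : Fin 1) = c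
  surj c := ⟨fun _ => c, rfl⟩
  unique h h' := h.symm.trans h'
  eqv_iff x y := by
    simp only [Interp.preId, Lind.realize_mk, CohFormula.Realize]
    rw [concat_apply, concat_apply]
    exact ⟨fun h => ⟨_, rfl, h.symm⟩, fun ⟨c, h, h'⟩ => h.trans h'.symm⟩
  rel_iff {n} R a := by
    have e : ∀ i : Fin n, concat (k := 1) a (finProdFinEquiv (i, (0 : Fin 1))) = a i (0 : Fin 1) :=
      fun i => concat_apply (k := 1) a i 0
    simp only [Interp.preId, Lind.realize_mk, CohFormula.Realize]
    erw [funext e]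
    constructor
    · exact fun h => ⟨_, fun _ => rfl, h⟩
    · rintro ⟨c, h, h'⟩
      rwa [funext h]

/-- The structure interpreted by a composite is obtained in two steps. -/
def trans {T T' T'' : CohTheory.{u}} {Γ : Interp T T'} {Δ : Interp T' T''} {M : T''.Model}
    {P : T'.Model} {N : Type u} [T.lang.Structure N] (A : Γ.Presentation P N)
    (D : Δ.Presentation M P) : (Interp.preComp Γ Δ).Presentation M N where
  Rep x c := ∃ d : Fin Γ.arity → P, (∀ i, D.Rep (blocks x i) (d i)) ∧ A.Rep d c
  surj c := by
    obtain ⟨d, hd⟩ := A.surj c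
    obtain ⟨x, hx⟩ := D.exists_tuple d
    exact ⟨concat x, d, by simpa using hx, hd⟩
  unique := by
    rintro x c c' ⟨d, h, hd⟩ ⟨d', h', hd'⟩
    exact A.unique hd (D.unique_tuple h' h ▸ hd')
  eqv_iff x y := by
    obtain ⟨x, rfl⟩ := exists_concat x
    obtain ⟨y, rfl⟩ := exists_concat y
    have e : concat ![concat x, concat y] ∘ Fin.cast (Nat.mul_assoc _ _ _) =
        concat (concat ![x, y]) := by
      rw [← concat_concat]
      congr 2
      funext i
      fin_cases i <;> rfl
    simp only [Interp.preComp, Lind.realize_subst]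
    rw [e, Interp.realize_onLind D]
    simp only [blocks_concat]
    constructor
    · rintro ⟨d, h, h'⟩
      obtain ⟨d, rfl⟩ := exists_concat d
      obtain ⟨d₁, d₂, rfl⟩ := exists_pair d
      obtain ⟨c, hc₁, hc₂⟩ := (A.eqv_iff _ _).1 h'
      refine ⟨c, ⟨d₁, fun i => ?_, hc₁⟩, d₂, fun i => ?_, hc₂⟩
      · simpa using h (finProdFinEquiv (0, i))
      · simpa using h (finProdFinEquiv (1, i))
    · rintro ⟨c, ⟨d₁, h₁, hc₁⟩, d₂, h₂, hc₂⟩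
      refine ⟨concat ![d₁, d₂], fun p => ?_, (A.eqv_iff _ _).2 ⟨c, hc₁, hc₂⟩⟩
      obtain ⟨⟨i, j⟩, rfl⟩ := finProdFinEquiv.surjective p
      simp only [concat_apply]
      fin_cases i
      exacts [h₁ j, h₂ j]
  rel_iff {n} R a := by
    obtain ⟨a, rfl⟩ : ∃ a', a = fun i => concat (a' i) :=
      ⟨fun i => blocks (a i), funext fun i => (concat_blocks _).symm⟩
    simp only [Interp.preComp, Lind.realize_subst]
    rw [concat_concat, Interp.realize_onLind D]
    simp only [blocks_concat]
    constructor
    · rintro ⟨d, h, h'⟩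
      obtain ⟨d, rfl⟩ := exists_concat d
      obtain ⟨c, hc, hR⟩ := (A.rel_iff _ _).1 h'
      refine ⟨c, fun i => ⟨d i, fun j => ?_, hc i⟩, hR⟩
      simpa using h (finProdFinEquiv (i, j))
    · rintro ⟨c, h, hR⟩
      choose d hd hc using h
      refine ⟨concat d, fun p => ?_, (A.rel_iff _ _).2 ⟨c, hc, hR⟩⟩
      obtain ⟨⟨i, j⟩, rfl⟩ := finProdFinEquiv.surjective p
      simpa using hd i j

end Presentation

end PreInterp

namespace Interp

open PreInterp

variable {T T' T'' : CohTheory.{u}}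

theorem preId_isInterp (T : CohTheory.{u}) : (preId T).IsInterp :=
  isInterp_of_presentations fun M => ⟨M, ⟨.self M⟩⟩

/-- A model of `T''` presents a model of `T'`, which presents a model of `T`; chaining the two
presentations is enough. -/
theorem preComp_isInterp (Γ : Interp T T') (Δ : Interp T' T'') : (preComp Γ Δ).IsInterp :=
  isInterp_of_presentations fun M => by
    obtain ⟨P, ⟨D⟩⟩ := Δ.exists_presentation M
    obtain ⟨N, ⟨A⟩⟩ := Γ.exists_presentation P
    exact ⟨N, ⟨A.trans D⟩⟩

/-! ### Morphisms as natural families of homomorphisms -/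

section Represents

variable {Γ Γ' Γ'' : PreInterp T T'} {M : T'.Model} {N N' N'' : T.Model}

/-- The formula `θ` defines the graph of the map `h` in terms of the tuples that represent the elements
of two interpreted structures. -/
def Represents (A : Γ.Presentation M N) (B : Γ'.Presentation M N')
    (θ : T'.Lind (Γ.arity + Γ'.arity)) (h : N → N') : Prop :=
  ∀ x y, θ.Realize M (Fin.append x y) ↔ ∃ c, A.Rep x c ∧ B.Rep y (h c)

theorem Represents.rep {A : Γ.Presentation M N} {B : Γ'.Presentation M N'}
    {θ : T'.Lind (Γ.arity + Γ'.arity)} {h : N → N'} (H : Represents A B θ h)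
    {x : Fin Γ.arity → M} {y : Fin Γ'.arity → M} {c : N}
    (hθ : θ.Realize M (Fin.append x y)) (hx : A.Rep x c) : B.Rep y (h c) := by
  obtain ⟨c', hx', hy⟩ := (H x y).1 hθ
  rwa [A.unique hx hx']

end Represents

/-- Totality gives every element an image, and preservation of the formula `x = y` makes the image
unique. Preservation of the remaining formulas carries over to the map, and the two congruence
clauses ensure that `θ` contains all pairs of representatives of the graph. -/
theorem IsMor.exists_map {Γ Γ' : Interp T T'} {M : T'.Model} {N N' : T.Model}
    {θ : T'.Lind (Γ.arity + Γ'.arity)} (hθ : IsMor Γ Γ' θ)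
    (A : Γ.Presentation M N) (B : Γ'.Presentation M N') :
    ∃ h : N → N', CohFormula.Preserves T.lang h ∧ Represents A B θ h := by
  have dom : ∀ x y, θ.Realize M (Fin.append x y) → (∃ c, A.Rep x c) ∧ ∃ d, B.Rep y d := by
    intro x y h
    have := Lind.le_iff.1 hθ.le_domain M _ h
    rwa [Lind.realize_inf, realize_eqAt, realize_eqAt, append_comp_castAdd, append_comp_natAdd,
      A.exists_rep_iff, B.exists_rep_iff] at this
  have pres : ∀ {n : ℕ} (φ : CohFormula T.lang n) (a : Fin n → Fin Γ.arity → M)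
      (b : Fin n → Fin Γ'.arity → M) (c : Fin n → N) (d : Fin n → N'),
      (∀ i, A.Rep (a i) (c i)) → (∀ i, B.Rep (b i) (d i)) →
      (∀ i, θ.Realize M (Fin.append (a i) (b i))) → φ.Realize c → φ.Realize d := by
    intro n φ a b c d hc hd hθ' hφ
    have := Lind.le_iff.1 (hθ.preserves φ
      (fun i j => Fin.castAdd _ (finProdFinEquiv (i, j)))
      (fun i j => Fin.natAdd _ (finProdFinEquiv (i, j)))) M (Fin.append (concat a) (concat b))
    simp only [Lind.realize_inf, Lind.realize_subst, Lind.realize_finset_inf, comp_concat,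
      comp_append, Fin.append_left, Fin.append_right, concat_apply, Finset.mem_univ,
      true_implies, append_comp_castAdd', append_comp_natAdd', concat_comp_finProd] at this
    obtain ⟨d', hd', h'⟩ := (B.realize_onFormula φ b).1
      (this ⟨(A.realize_onFormula φ a).2 ⟨c, hc, hφ⟩, hθ'⟩)
    rwa [B.unique_tuple hd hd']
  have tot : ∀ c, ∃ x y d, A.Rep x c ∧ B.Rep y d ∧ θ.Realize M (Fin.append x y) := by
    intro c
    obtain ⟨x, hx⟩ := A.surj c
    have := Lind.le_iff.1 hθ.total M x
      ((realize_eqAt _ _ _ _).2 ((A.eqv_iff _ _).2 ⟨c, hx, hx⟩))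
    obtain ⟨y, hy⟩ := (Lind.realize_exs _ _ _).1 this
    obtain ⟨d, hd⟩ := (dom _ _ hy).2
    exact ⟨x, y, d, hx, hd, hy⟩
  choose x y h hx hy hxy using tot
  refine ⟨h, fun n φ c hφ => pres φ _ _ c _ (fun i => hx (c i)) (fun i => hy (c i))
    (fun i => hxy (c i)) hφ, fun x' y' => ⟨fun h' => ?_, ?_⟩⟩
  · obtain ⟨⟨c, hc⟩, d, hd⟩ := dom _ _ h'
    refine ⟨c, hc, ?_⟩
    have e : ∀ i : Fin 2, θ.Realize M
        (Fin.append ((![x c, x'] : Fin 2 → _) i) ((![y c, y'] : Fin 2 → _) i)) :=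
      Fin.forall_fin_two.2 ⟨hxy c, h'⟩
    -- Single-valuedness: two pairs in `θ` whose left members represent the same `c` are compared by
    -- preservation of equality.
    have : h c = d := pres (n := 2) (.eq 0 1) ![x c, x'] ![y c, y'] ![c, c] ![h c, d]
      (Fin.forall_fin_two.2 ⟨hx c, hc⟩) (Fin.forall_fin_two.2 ⟨hy c, hd⟩) e rfl
    rwa [this]
  · rintro ⟨c, hc, hd⟩
    -- The chosen pair `(x c, y c)` is moved to `(x', y')` one side at a time.
    have h₁ : θ.Realize M (Fin.append x' (y c)) := by
      have := Lind.le_iff.1 (hθ.congr_left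
        (fun i => Fin.castAdd _ (Fin.castAdd _ i)) (fun i => Fin.castAdd _ (Fin.natAdd _ i))
        (Fin.natAdd _)) M (Fin.append (Fin.append (x c) x') (y c))
      simp only [Lind.realize_inf, Lind.realize_subst, realize_eqAt, comp_append,
        append_comp_castAdd', append_comp_castAdd, append_comp_natAdd] at this
      exact this ⟨hxy c, (A.eqv_iff _ _).2 ⟨c, hx c, hc⟩⟩
    have := Lind.le_iff.1 (hθ.congr_right (Fin.castAdd _)
      (fun i => Fin.natAdd _ (Fin.castAdd _ i)) (fun i => Fin.natAdd _ (Fin.natAdd _ i))) M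
      (Fin.append x' (Fin.append (y c) y'))
    simp only [Lind.realize_inf, Lind.realize_subst, realize_eqAt, comp_append,
      append_comp_natAdd', append_comp_castAdd, append_comp_natAdd] at this
    exact this ⟨h₁, (B.eqv_iff _ _).2 ⟨_, hy c, hd⟩⟩

/-- Each clause is an entailment and can be tested in a model, where it becomes a property of the
graph of a function, pulled back to representatives. Together with `IsMor.exists_map` this replaces
manipulations of formulas by composition of functions. -/
theorem isMor_of_maps {Γ Γ' : Interp T T'} {θ : T'.Lind (Γ.arity + Γ'.arity)}
    (H : ∀ M : T'.Model, ∃ (N N' : T.Model) (A : Γ.Presentation M N) (B : Γ'.Presentation M N')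
      (h : N → N'), CohFormula.Preserves T.lang h ∧ Represents A B θ h) : IsMor Γ Γ' θ where
  total := Lind.le_iff.2 fun M x => by
    obtain ⟨N, N', A, B, h, -, hr⟩ := H M
    rw [realize_eqAt, Lind.realize_exs, Function.comp_id, A.exists_rep_iff]
    rintro ⟨c, hc⟩
    obtain ⟨y, hy⟩ := B.surj (h c)
    exact ⟨y, (hr _ _).2 ⟨c, hc, hy⟩⟩
  le_domain := Lind.le_iff.2 fun M a => by
    obtain ⟨N, N', A, B, h, -, hr⟩ := H M
    obtain ⟨x, y, rfl⟩ := exists_append a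
    rw [Lind.realize_inf, realize_eqAt, realize_eqAt, append_comp_castAdd, append_comp_natAdd,
      A.exists_rep_iff, B.exists_rep_iff, hr x y]
    exact fun ⟨c, h₁, h₂⟩ => ⟨⟨_, h₁⟩, _, h₂⟩
  congr_left x x' y := Lind.le_iff.2 fun M a => by
    obtain ⟨N, N', A, B, h, -, hr⟩ := H M
    rw [Lind.realize_inf, Lind.realize_subst, Lind.realize_subst, realize_eqAt, comp_append,
      comp_append, hr, hr, A.eqv_iff]
    rintro ⟨⟨c, h₁, h₂⟩, d, h₃, h₄⟩
    exact ⟨d, h₄, A.unique h₁ h₃ ▸ h₂⟩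
  congr_right x y y' := Lind.le_iff.2 fun M a => by
    obtain ⟨N, N', A, B, h, -, hr⟩ := H M
    rw [Lind.realize_inf, Lind.realize_subst, Lind.realize_subst, realize_eqAt, comp_append,
      comp_append, hr, hr, B.eqv_iff]
    rintro ⟨⟨c, h₁, h₂⟩, d, h₃, h₄⟩
    exact ⟨c, h₁, B.unique h₂ h₃ ▸ h₄⟩
  preserves φ x y := Lind.le_iff.2 fun M a => by
    obtain ⟨N, N', A, B, h, hp, hr⟩ := H M
    simp only [Lind.realize_inf, Lind.realize_subst, Lind.realize_finset_inf, Finset.mem_univ,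
      true_implies, comp_concat, comp_append]
    have e := A.realize_onFormula φ fun i j => a (x i j)
    have e' := B.realize_onFormula φ fun i j => a (y i j)
    rw [e, e']
    rintro ⟨⟨c, hc, hφ⟩, h'⟩
    exact ⟨h ∘ c, fun i => hr.rep (h' i) (hc i), hp φ c hφ⟩

/-! ### The operations on morphisms -/

section Operations

variable {Γ Γ' Γ'' : Interp T T'} {M : T'.Model} {N N' N'' : T.Model}

theorem represents_preId₂ (A : Γ.Presentation M N) : Represents A A (preId₂ Γ) id := by
  intro x y
  rw [preId₂, realize_eqAt, append_comp_castAdd, append_comp_natAdd, A.eqv_iff]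
  rfl

/-- The middle tuple `ȳ` necessarily represents `h c`, and any representative of `h c` will do, so
composing the relations composes the functions. -/
theorem represents_preVcomp {A : Γ.Presentation M N} {B : Γ'.Presentation M N'}
    {C : Γ''.Presentation M N''} {θ : Mor Γ Γ'} {η : Mor Γ' Γ''} {h : N → N'} {h' : N' → N''}
    (H : Represents A B θ.formula h) (H' : Represents B C η.formula h') :
    Represents A C (preVcomp θ η) (h' ∘ h) := by
  intro x z
  have e : (preVcomp θ η).Realize M (Fin.append x z) ↔
      ∃ y, θ.formula.Realize M (Fin.append x y) ∧ η.formula.Realize M (Fin.append y z) := by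
    simp only [preVcomp, Lind.realize_exs, Lind.realize_inf, Lind.realize_subst, comp_append,
      append_comp_castAdd', append_comp_castAdd, append_comp_natAdd]
  rw [e]
  constructor
  · rintro ⟨y, h₁, h₂⟩
    obtain ⟨c, hx, hy⟩ := (H x y).1 h₁
    exact ⟨c, hx, H'.rep h₂ hy⟩
  · rintro ⟨c, hx, hz⟩
    obtain ⟨y, hy⟩ := B.surj (h c)
    exact ⟨y, (H _ _).2 ⟨c, hx, hy⟩, (H' _ _).2 ⟨_, hy, hz⟩⟩

end Operations

/-! ### Functoriality of the presented structure in the model. -/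

section Pushforward

variable {Γ Γ' : Interp T T'} {P P' : T'.Model} {N N' K K' : T.Model}

/-- The map `g'` between interpreted structures is induced by the map `g`. -/
def Pushes (B : Γ.Presentation P N) (B' : Γ.Presentation P' N') (g : P → P') (g' : N → N') :
    Prop := ∀ d c, B.Rep d c → B'.Rep (g ∘ d) (g' c)

/-- Being a class of formulas of `T'`, `Γ(x = y)` is preserved by `g`, so `g` maps the domain to the
domain and descends to the quotients. The induced map preserves formulas because `g` preserves their
translations. -/
theorem exists_pushes (B : Γ.Presentation P N) (B' : Γ.Presentation P' N') {g : P → P'}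
    (hg : CohFormula.Preserves T'.lang g) : ∃ g', CohFormula.Preserves T.lang g' ∧ Pushes B B' g g' := by
  have pres : ∀ {n : ℕ} (c : T'.Lind n) (a : Fin n → P), c.Realize P a → c.Realize P' (g ∘ a) := by
    intro n c a
    obtain ⟨φ, rfl⟩ := Lind.exists_mk c
    exact hg φ a
  have ex : ∀ c, ∃ d c', B.Rep d c ∧ B'.Rep (g ∘ d) c' := by
    intro c
    obtain ⟨d, hd⟩ := B.surj c
    have := pres _ _ ((B.exists_rep_iff d).2 ⟨c, hd⟩)
    rw [comp_concat, ← concat_comp_pair, B'.exists_rep_iff] at this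
    obtain ⟨c', hc'⟩ := this
    exact ⟨d, c', hd, hc'⟩
  choose d g' hd hg' using ex
  refine ⟨g', fun n φ c hφ => ?_, fun e c he => ?_⟩
  · have := pres _ _ ((B.realize_onFormula φ fun i => d (c i)).2 ⟨c, fun i => hd (c i), hφ⟩)
    obtain ⟨c', hc', h⟩ := (B'.realize_onFormula φ fun i => g ∘ d (c i)).1 this
    rwa [B'.unique_tuple hc' fun i => hg' (c i)] at h
  · have := pres _ _ ((B.eqv_iff e (d c)).2 ⟨c, he, hd c⟩)
    rw [comp_concat, ← concat_comp_pair, B'.eqv_iff] at this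
    obtain ⟨c', h₁, h₂⟩ := this
    rwa [← B'.unique h₂ (hg' c)]

theorem Pushes.id (B : Γ.Presentation P N) : Pushes B B id id := fun _ _ h => h

theorem Pushes.comp {P'' : T'.Model} {N'' : T.Model} {B : Γ.Presentation P N}
    {B' : Γ.Presentation P' N'} {B'' : Γ.Presentation P'' N''} {g : P → P'} {g' : N → N'}
    {h : P' → P''} {h' : N' → N''} (H' : Pushes B' B'' h h') (H : Pushes B B' g g') :
    Pushes B B'' (h ∘ g) (h' ∘ g') :=
  fun _ _ hc => H' _ _ (H _ _ hc)

/-- Morphisms of interpretations are natural. -/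
theorem Represents.naturality {A : Γ.Presentation P N} {B : Γ'.Presentation P K}
    {A' : Γ.Presentation P' N'} {B' : Γ'.Presentation P' K'} {θ : T'.Lind (Γ.arity + Γ'.arity)}
    {h : N → K} {h' : N' → K'} (H : Represents A B θ h) (H' : Represents A' B' θ h')
    {g : P → P'} (hg : CohFormula.Preserves T'.lang g) {a : N → N'} {b : K → K'} (ha : Pushes A A' g a)
    (hb : Pushes B B' g b) : h' ∘ a = b ∘ h := by
  funext c
  obtain ⟨x, hx⟩ := A.surj c
  obtain ⟨y, hy⟩ := B.surj (h c)
  -- Since `θ` is given by a coherent formula of `T'`, it is preserved by `g`. Hence `g ∘ y`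
  -- represents the values of both composites at `c`.
  obtain ⟨φ, rfl⟩ := Lind.exists_mk θ
  have h₁ := hg φ _ ((H x y).2 ⟨c, hx, hy⟩)
  rw [comp_append] at h₁
  exact B'.unique (H'.rep (θ := Lind.mk φ) h₁ (ha _ _ hx)) (hb _ _ hy)

theorem Pushes.trans {Δ : Interp T' T''} {M M' : T''.Model} {D : Δ.Presentation M P}
    {D' : Δ.Presentation M' P'} {A : Γ.Presentation P N} {A' : Γ.Presentation P' N'}
    {q : M → M'} {g : P → P'} {g' : N → N'} (H : Pushes D D' q g) (H' : Pushes A A' g g') :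
    Pushes (Γ := ⟨preComp Γ Δ, preComp_isInterp Γ Δ⟩) (A.trans D) (A'.trans D') q g' := by
  rintro x c ⟨d, hd, hc⟩
  exact ⟨g ∘ d, fun i => H _ _ (hd i), H' _ _ hc⟩

end Pushforward

/-- The blocks `ȳ` represent a tuple of `P` that represents `h n`, and `η` moves this tuple along
`g` to the one represented by `w̄`, which represents `b (h n)`. The last conjunct replaces `w̄` by
arbitrary representatives `z̄`: a tuple of `P'` representing `b (h n)` need not be the image under
`g` of a tuple of `P`. -/
theorem represents_preHcomp {Γ Γ' : Interp T T'} {Δ Δ' : Interp T' T''} {M : T''.Model}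
    {P P' : T'.Model} {N K K' : T.Model} {D : Δ.Presentation M P} {D' : Δ'.Presentation M P'}
    {A : Γ.Presentation P N} {B : Γ'.Presentation P K} {B' : Γ'.Presentation P' K'}
    {θ : Mor Γ Γ'} {η : Mor Δ Δ'} {h : N → K} {g : P → P'} {b : K → K'}
    (H : Represents A B θ.formula h) (G : Represents D D' η.formula g) (hb : Pushes B B' g b) :
    Represents (A.trans D) (B'.trans D') (preHcomp θ η) (b ∘ h) := by
  intro X Z
  obtain ⟨x, rfl⟩ := exists_concat X
  obtain ⟨z, rfl⟩ := exists_concat Z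
  have e : (preHcomp θ η).Realize M (Fin.append (concat x) (concat z)) ↔
      ∃ (y : Fin Γ'.arity → Fin Δ.arity → M) (w : Fin Γ'.arity → Fin Δ'.arity → M),
        (Δ.onLind θ.formula).Realize M (concat (Fin.append x y)) ∧
        (∀ i, η.formula.Realize M (Fin.append (y i) (w i))) ∧
        (Δ'.onLind Γ'.eqv).Realize M (concat (concat ![w, z])) := by
    simp only [preHcomp, Lind.realize_exs, Lind.realize_inf, Lind.realize_subst,
      Lind.realize_finset_inf, Finset.mem_univ, true_implies, and_assoc]
    rw [exists_append_concat]
    simp only [comp_concat_append, comp_concat_concat_pair, comp_append, comp_blocks,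
      Fin.append_left, Fin.append_right, concat_apply]
    simp only [blocks, Fin.append_left, Fin.append_right, concat_apply]
  refine e.trans ?_
  simp only [realize_onLind D, realize_onLind D']
  constructor
  · rintro ⟨y, w, ⟨c, hc, hθ⟩, hη, e, he, hE⟩
    obtain ⟨c₁, c₂, rfl⟩ := exists_append c
    obtain ⟨e, rfl⟩ := exists_concat e
    obtain ⟨e₁, e₂, rfl⟩ := exists_pair e
    obtain ⟨n, hn₁, hn₂⟩ := (H c₁ c₂).1 hθ
    have hx : ∀ i, D.Rep (x i) (c₁ i) := fun i => by simpa using hc (Fin.castAdd _ i)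
    have hy : ∀ i, D.Rep (y i) (c₂ i) := fun i => by simpa using hc (Fin.natAdd _ i)
    have hw : ∀ i, D'.Rep (w i) (e₁ i) := fun i => by simpa using he (finProdFinEquiv (0, i))
    have hz : ∀ i, D'.Rep (z i) (e₂ i) := fun i => by simpa using he (finProdFinEquiv (1, i))
    obtain rfl : e₁ = g ∘ c₂ := D'.unique_tuple hw fun i => G.rep (hη i) (hy i)
    obtain ⟨m, hm₁, hm₂⟩ := (B'.eqv_iff _ _).1 hE
    obtain rfl := B'.unique hm₁ (hb _ _ hn₂)
    exact ⟨n, ⟨c₁, by simpa using hx, hn₁⟩, e₂, by simpa using hz, hm₂⟩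
  · rintro ⟨n, ⟨c₁, hx, hn⟩, e₂, hz, hm⟩
    rw [blocks_concat] at hx hz
    obtain ⟨c₂, hc₂⟩ := B.surj (h n)
    obtain ⟨y, hy⟩ := D.exists_tuple c₂
    obtain ⟨w, hw⟩ := D'.exists_tuple (g ∘ c₂)
    refine ⟨y, w, ⟨Fin.append c₁ c₂, fun i => ?_, (H _ _).2 ⟨n, hn, hc₂⟩⟩,
      fun i => (G _ _).2 ⟨_, hy i, hw i⟩, concat ![g ∘ c₂, e₂], fun p => ?_,
      (B'.eqv_iff _ _).2 ⟨_, hb _ _ hc₂, hm⟩⟩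
    · refine Fin.addCases (fun i => ?_) (fun i => ?_) i
      · simpa using hx i
      · simpa using hy i
    · obtain ⟨⟨i, j⟩, rfl⟩ := finProdFinEquiv.surjective p
      simp only [concat_apply]
      fin_cases i
      exacts [hw j, hz j]

end Interp

end CohTheory

end PosLogic

/-! ### The laws of the 2-category of theories. -/

namespace PosLogic

section Tuples

variable {α : Type*} {n m k : ℕ}

theorem concat_concat_symm (x : Fin n → Fin m → Fin k → α) :
    concat (concat x) ∘ Fin.cast (Nat.mul_assoc n m k).symm = concat fun i => concat (x i) := by
  rw [← concat_concat]
  rfl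

theorem blocks_one (x : Fin (1 * k) → α) (i : Fin 1) :
    blocks x i = x ∘ Fin.cast (Nat.one_mul k).symm := by
  funext j
  refine congrArg x (Fin.ext ?_)
  simp [finProdFinEquiv]

theorem blocks_apply_zero (x : Fin (n * 1) → α) :
    (fun i => blocks x i 0) = x ∘ Fin.cast (Nat.mul_one n).symm := by
  funext j
  refine congrArg x (Fin.ext ?_)
  simp [finProdFinEquiv]

end Tuples

namespace CohTheory

open PreInterp

/-- Interpretations are equal if tuples represent the same elements of interpreted structures. -/
theorem PreInterp.eq_of_presentations {T T' : CohTheory.{u}} {Γ₁ Γ₂ : PreInterp T T'}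
    (e : Γ₁.arity = Γ₂.arity)
    (H : ∀ M : T'.Model, ∃ (N : T.Model) (A₁ : Γ₁.Presentation M N) (A₂ : Γ₂.Presentation M N),
      ∀ x c, A₁.Rep x c ↔ A₂.Rep (x ∘ Fin.cast e.symm) c) : Γ₁ = Γ₂ := by
  obtain ⟨k, hk, E₁, R₁⟩ := Γ₁
  obtain ⟨k, hk, E₂, R₂⟩ := Γ₂
  obtain rfl : _ = k := e
  congr 1
  · refine Lind.ext_realize fun M a => ?_
    obtain ⟨N, A₁, A₂, h⟩ := H M
    obtain ⟨a, rfl⟩ := exists_concat a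
    obtain ⟨x, y, rfl⟩ := exists_pair a
    refine (A₁.eqv_iff x y).trans (Iff.trans ?_ (A₂.eqv_iff x y).symm)
    simp only [h]
    rfl
  · funext n R
    refine Lind.ext_realize fun M a => ?_
    obtain ⟨N, A₁, A₂, h⟩ := H M
    obtain ⟨a, rfl⟩ := exists_concat a
    refine (A₁.rel_iff R a).trans (Iff.trans ?_ (A₂.rel_iff R a).symm)
    simp only [h]
    rfl

namespace Interp

variable {T T' T'' T₃ : CohTheory.{u}}

theorem ext_pre {Γ₁ Γ₂ : Interp T T'} (h : Γ₁.toPreInterp = Γ₂.toPreInterp) : Γ₁ = Γ₂ := by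
  cases Γ₁
  cases Γ₂
  cases h
  rfl

theorem Mor.ext_formula {Γ Γ' : Interp T T'} {θ η : Mor Γ Γ'} (h : θ.formula = η.formula) :
    θ = η := by
  cases θ
  cases η
  cases h
  rfl

/-- A representing formula is realised exactly by the pairs of representatives of the graph, so the
function and the two presentations determine it modulo `T'`. -/
theorem Mor.eq_of_represents {Γ Γ' : Interp T T'} {θ η : Mor Γ Γ'}
    (H : ∀ M : T'.Model, ∃ (N N' : T.Model) (A : Γ.Presentation M N) (B : Γ'.Presentation M N')
      (h : N → N'), Represents A B θ.formula h ∧ Represents A B η.formula h) : θ = η := by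
  refine Mor.ext_formula (Lind.ext_realize fun M a => ?_)
  obtain ⟨N, N', A, B, h, h₁, h₂⟩ := H M
  obtain ⟨x, y, rfl⟩ := exists_append a
  rw [h₁, h₂]

/-- An interpretation does not determine its presentations, so equality of the 1-cells is not
enough: the tuples representing each element must also be compared, up to the cast between the
arities. -/
theorem Mor.heq_of_represents {Γ₁ Γ₁' Γ₂ Γ₂' : Interp T T'} (e : Γ₁ = Γ₂) (e' : Γ₁' = Γ₂')
    {θ₁ : Mor Γ₁ Γ₁'} {θ₂ : Mor Γ₂ Γ₂'} (ha : Γ₁.arity = Γ₂.arity) (ha' : Γ₁'.arity = Γ₂'.arity)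
    (H : ∀ M : T'.Model, ∃ (N N' : T.Model) (A₁ : Γ₁.Presentation M N)
      (B₁ : Γ₁'.Presentation M N') (A₂ : Γ₂.Presentation M N) (B₂ : Γ₂'.Presentation M N')
      (h : N → N'), Represents A₁ B₁ θ₁.formula h ∧ Represents A₂ B₂ θ₂.formula h ∧
        (∀ x c, A₁.Rep x c ↔ A₂.Rep (x ∘ Fin.cast ha.symm) c) ∧
        ∀ x c, B₁.Rep x c ↔ B₂.Rep (x ∘ Fin.cast ha'.symm) c) : HEq θ₁ θ₂ := by
  subst e
  subst e'
  refine heq_of_eq (Mor.ext_formula (Lind.ext_realize fun M a => ?_))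
  obtain ⟨N, N', A₁, B₁, A₂, B₂, h, h₁, h₂, hA, hB⟩ := H M
  obtain ⟨x, y, rfl⟩ := exists_append a
  rw [h₁, h₂]
  simp only [hA, hB]
  rfl

/-- The tuples that represent an element do not depend on the bracketing of a composite. -/
theorem trans_trans_rep {Γ : Interp T T'} {Δ : Interp T' T''} {Ξ : Interp T'' T₃}
    {M : T₃.Model} {Q : T''.Model} {P : T'.Model} {N : T.Model} (A : Γ.Presentation P N)
    (D : Δ.Presentation Q P) (E : Ξ.Presentation M Q)
    (x : Fin (Γ.arity * Δ.arity * Ξ.arity) → M) (c : N) :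
    (Presentation.trans (Γ := ⟨preComp Γ Δ, preComp_isInterp Γ Δ⟩) (A.trans D) E).Rep x c ↔
      (Presentation.trans (Δ := ⟨preComp Δ Ξ, preComp_isInterp Δ Ξ⟩) A (D.trans E)).Rep
        (x ∘ Fin.cast (Nat.mul_assoc _ _ _).symm) c := by
  obtain ⟨x, rfl⟩ := exists_concat x
  obtain ⟨x, rfl⟩ := exists_concat x
  change (∃ d : Fin (Γ.arity * Δ.arity) → Q, (∀ i, E.Rep (blocks (concat (concat x)) i) (d i)) ∧
      ∃ e, (∀ i, D.Rep (blocks d i) (e i)) ∧ A.Rep e c) ↔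
    ∃ d, (∀ i, ∃ e, (∀ j, E.Rep
      (blocks (blocks (concat (concat x) ∘ Fin.cast (Nat.mul_assoc _ _ _).symm) i) j) (e j)) ∧
        D.Rep e (d i)) ∧ A.Rep d c
  rw [concat_concat_symm]
  simp only [blocks_concat]
  constructor
  · rintro ⟨d, hd, e, he, hc⟩
    obtain ⟨d, rfl⟩ := exists_concat d
    rw [blocks_concat] at he
    refine ⟨e, fun i => ⟨d i, fun j => ?_, he i⟩, hc⟩
    simpa using hd (finProdFinEquiv (i, j))
  · rintro ⟨e, he, hc⟩
    choose d hd he using he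
    refine ⟨concat d, fun p => ?_, e, ?_, hc⟩
    · obtain ⟨⟨i, j⟩, rfl⟩ := finProdFinEquiv.surjective p
      simpa using hd i j
    · rwa [blocks_concat]

theorem self_trans_rep {Γ : Interp T T'} {M : T'.Model} {N : T.Model} (A : Γ.Presentation M N)
    (x : Fin (1 * Γ.arity) → M) (c : N) :
    (Presentation.trans (Γ := ⟨preId T, preId_isInterp T⟩) (.self N) A).Rep x c ↔
      A.Rep (x ∘ Fin.cast (Nat.one_mul _).symm) c := by
  change (∃ d : Fin 1 → N, (∀ i, A.Rep (blocks x i) (d i)) ∧ d 0 = c) ↔ _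
  simp only [blocks_one]
  exact ⟨fun ⟨d, hd, h⟩ => h ▸ hd 0, fun h => ⟨fun _ => c, fun _ => h, rfl⟩⟩

theorem trans_self_rep {Γ : Interp T T'} {M : T'.Model} {N : T.Model} (A : Γ.Presentation M N)
    (x : Fin (Γ.arity * 1) → M) (c : N) :
    (Presentation.trans (Δ := ⟨preId T', preId_isInterp T'⟩) A (.self M)).Rep x c ↔
      A.Rep (x ∘ Fin.cast (Nat.mul_one _).symm) c := by
  rw [← blocks_apply_zero]
  constructor
  · rintro ⟨d, hd, hc⟩
    obtain rfl := funext hd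
    exact hc
  · exact fun h => ⟨_, fun _ => rfl, h⟩

end Interp

open Interp

theorem opsClosed : OpsClosed.{u} where
  id₁ := preId_isInterp
  comp₁ := preComp_isInterp
  id₂ Γ := isMor_of_maps fun M => by
    obtain ⟨N, ⟨A⟩⟩ := Γ.exists_presentation M
    exact ⟨N, N, A, A, id, CohFormula.Preserves.id N, represents_preId₂ A⟩
  vcomp {_ _ Γ Γ' Γ''} θ η := isMor_of_maps fun M => by
    obtain ⟨N, ⟨A⟩⟩ := Γ.exists_presentation M
    obtain ⟨N', ⟨B⟩⟩ := Γ'.exists_presentation M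
    obtain ⟨N'', ⟨C⟩⟩ := Γ''.exists_presentation M
    obtain ⟨h, hp, hr⟩ := θ.isMor.exists_map A B
    obtain ⟨h', hp', hr'⟩ := η.isMor.exists_map B C
    exact ⟨N, N'', A, C, _, hp'.comp hp, represents_preVcomp hr hr'⟩
  hcomp {_ _ _ Γ Γ' Δ Δ'} θ η := isMor_of_maps fun M => by
    obtain ⟨P, ⟨D⟩⟩ := Δ.exists_presentation M
    obtain ⟨P', ⟨D'⟩⟩ := Δ'.exists_presentation M
    obtain ⟨N, ⟨A⟩⟩ := Γ.exists_presentation P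
    obtain ⟨K, ⟨B⟩⟩ := Γ'.exists_presentation P
    -- The target `Γ'` is evaluated both in `P` and in `P'`, so that the map induced by `η` can be
    -- pushed forward from `K` to `K'`.
    obtain ⟨K', ⟨B'⟩⟩ := Γ'.exists_presentation P'
    obtain ⟨h, hp, hr⟩ := θ.isMor.exists_map A B
    obtain ⟨g, gp, gr⟩ := η.isMor.exists_map D D'
    obtain ⟨b, bp, hb⟩ := exists_pushes B B' gp
    exact ⟨N, K', A.trans D, B'.trans D', _, bp.comp hp, represents_preHcomp hr gr hb⟩

/-- In each model the two sides of a law for 2-cells represent the same function. For most laws the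
functions agree by the unit and associativity laws of composition; only interchange needs a square
to commute. -/
theorem isStrictTwoCategory : (twoCat opsClosed.{u}).IsStrictTwoCategory := by
  have id_comp₁ : ∀ {a b : CohTheory.{u}} (f : (twoCat opsClosed).Hom a b),
      (twoCat opsClosed).comp₁ ((twoCat opsClosed).id₁ a) f = f := fun {a b} (Γ : Interp a b) => by
    refine ext_pre (PreInterp.eq_of_presentations (Nat.one_mul _) fun M => ?_)
    obtain ⟨N, ⟨A⟩⟩ := Γ.exists_presentation M
    exact ⟨N, _, A, self_trans_rep A⟩
  have comp₁_id : ∀ {a b : CohTheory.{u}} (f : (twoCat opsClosed).Hom a b),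
      (twoCat opsClosed).comp₁ f ((twoCat opsClosed).id₁ b) = f := fun {a b} (Γ : Interp a b) => by
    refine ext_pre (PreInterp.eq_of_presentations (Nat.mul_one _) fun M => ?_)
    obtain ⟨N, ⟨A⟩⟩ := Γ.exists_presentation M
    exact ⟨N, _, A, trans_self_rep A⟩
  have assoc₁ : ∀ {a b c d : CohTheory.{u}} (f : (twoCat opsClosed).Hom a b)
      (g : (twoCat opsClosed).Hom b c) (h : (twoCat opsClosed).Hom c d),
      (twoCat opsClosed).comp₁ ((twoCat opsClosed).comp₁ f g) h =
        (twoCat opsClosed).comp₁ f ((twoCat opsClosed).comp₁ g h) :=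
    fun {a b c d} (Γ : Interp a b) (Δ : Interp b c) (Ξ : Interp c d) => by
    refine ext_pre (PreInterp.eq_of_presentations (Nat.mul_assoc _ _ _) fun M => ?_)
    obtain ⟨Q, ⟨E⟩⟩ := Ξ.exists_presentation M
    obtain ⟨P, ⟨D⟩⟩ := Δ.exists_presentation Q
    obtain ⟨N, ⟨A⟩⟩ := Γ.exists_presentation P
    exact ⟨N, _, _, trans_trans_rep A D E⟩
  refine ⟨id_comp₁, comp₁_id, assoc₁, ?_, ?_, ?_, ?_, ?_, ?_, ?_, ?_⟩
  · intro a b (Γ : Interp a b) (Γ' : Interp a b) (θ : Mor Γ Γ')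
    refine Mor.eq_of_represents fun M => ?_
    obtain ⟨N, ⟨A⟩⟩ := Γ.exists_presentation M
    obtain ⟨N', ⟨B⟩⟩ := Γ'.exists_presentation M
    obtain ⟨h, -, hr⟩ := θ.isMor.exists_map A B
    exact ⟨N, N', A, B, h, represents_preVcomp (represents_preId₂ A) hr, hr⟩
  · intro a b (Γ : Interp a b) (Γ' : Interp a b) (θ : Mor Γ Γ')
    refine Mor.eq_of_represents fun M => ?_
    obtain ⟨N, ⟨A⟩⟩ := Γ.exists_presentation M
    obtain ⟨N', ⟨B⟩⟩ := Γ'.exists_presentation M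
    obtain ⟨h, -, hr⟩ := θ.isMor.exists_map A B
    exact ⟨N, N', A, B, h, represents_preVcomp
      (η := ⟨preId₂ Γ', opsClosed.id₂ Γ'⟩) (h := h) (h' := id) hr (represents_preId₂ B), hr⟩
  · intro a b (Γ₁ : Interp a b) (Γ₂ : Interp a b) (Γ₃ : Interp a b) (Γ₄ : Interp a b)
      (α : Mor Γ₁ Γ₂) (β : Mor Γ₂ Γ₃) (γ : Mor Γ₃ Γ₄)
    refine Mor.eq_of_represents fun M => ?_
    obtain ⟨N₁, ⟨A₁⟩⟩ := Γ₁.exists_presentation M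
    obtain ⟨N₂, ⟨A₂⟩⟩ := Γ₂.exists_presentation M
    obtain ⟨N₃, ⟨A₃⟩⟩ := Γ₃.exists_presentation M
    obtain ⟨N₄, ⟨A₄⟩⟩ := Γ₄.exists_presentation M
    obtain ⟨f, -, hf⟩ := α.isMor.exists_map A₁ A₂
    obtain ⟨g, -, hg⟩ := β.isMor.exists_map A₂ A₃
    obtain ⟨h, -, hh⟩ := γ.isMor.exists_map A₃ A₄
    refine ⟨N₁, N₄, A₁, A₄, h ∘ g ∘ f, ?_, ?_⟩
    · exact represents_preVcomp (θ := ⟨preVcomp α β, opsClosed.vcomp α β⟩) (h := g ∘ f) (h' := h)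
        (represents_preVcomp hf hg) hh
    · exact represents_preVcomp (η := ⟨preVcomp β γ, opsClosed.vcomp β γ⟩) (h := f)
        (h' := h ∘ g) hf (represents_preVcomp hg hh)
  · intro a b c (Γ : Interp a b) (Δ : Interp b c)
    refine Mor.eq_of_represents fun M => ?_
    obtain ⟨P, ⟨D⟩⟩ := Δ.exists_presentation M
    obtain ⟨N, ⟨A⟩⟩ := Γ.exists_presentation P
    refine ⟨N, N, A.trans D, A.trans D, id, ?_, ?_⟩
    · exact represents_preHcomp (θ := ⟨preId₂ Γ, opsClosed.id₂ Γ⟩)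
        (η := ⟨preId₂ Δ, opsClosed.id₂ Δ⟩) (represents_preId₂ A) (represents_preId₂ D)
        (Pushes.id A)
    · exact represents_preId₂ (Γ := ⟨preComp Γ Δ, preComp_isInterp Γ Δ⟩) (A.trans D)
  · intro a b c (Γ : Interp a b) (Γ' : Interp a b) (Γ'' : Interp a b) (Δ : Interp b c)
      (Δ' : Interp b c) (Δ'' : Interp b c) (α : Mor Γ Γ') (α' : Mor Γ' Γ'') (β : Mor Δ Δ')
      (β' : Mor Δ' Δ'')
    refine Mor.eq_of_represents fun M => ?_
    obtain ⟨P, ⟨D⟩⟩ := Δ.exists_presentation M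
    obtain ⟨P', ⟨D'⟩⟩ := Δ'.exists_presentation M
    obtain ⟨P'', ⟨D''⟩⟩ := Δ''.exists_presentation M
    obtain ⟨g, gp, hg⟩ := β.isMor.exists_map D D'
    obtain ⟨g', gp', hg'⟩ := β'.isMor.exists_map D' D''
    obtain ⟨N, ⟨A⟩⟩ := Γ.exists_presentation P
    obtain ⟨N', ⟨A'⟩⟩ := Γ'.exists_presentation P
    obtain ⟨N'', ⟨A''⟩⟩ := Γ''.exists_presentation P
    obtain ⟨K', ⟨B'⟩⟩ := Γ'.exists_presentation P'
    obtain ⟨K'', ⟨B''⟩⟩ := Γ''.exists_presentation P'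
    obtain ⟨L, ⟨C⟩⟩ := Γ''.exists_presentation P''
    obtain ⟨h, -, hh⟩ := α.isMor.exists_map A A'
    obtain ⟨h', -, hh'⟩ := α'.isMor.exists_map A' A''
    obtain ⟨k, -, hk⟩ := α'.isMor.exists_map B' B''
    obtain ⟨r, -, hr⟩ := exists_pushes A' B' gp
    obtain ⟨s, -, hs⟩ := exists_pushes A'' B'' gp
    obtain ⟨t, -, ht⟩ := exists_pushes B'' C gp'
    refine ⟨N, L, A.trans D, C.trans D'', (t ∘ s) ∘ (h' ∘ h), ?_, ?_⟩
    · exact represents_preHcomp (θ := ⟨preVcomp α α', opsClosed.vcomp α α'⟩)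
        (η := ⟨preVcomp β β', opsClosed.vcomp β β'⟩) (represents_preVcomp hh hh')
        (represents_preVcomp hg hg') (ht.comp hs)
    -- Here naturality enters: `α'`, read in `P` as `h'` and in `P'` as `k`, commutes with the
    -- pushforwards `r` and `s` along `g`.
    · have e : (t ∘ s) ∘ h' ∘ h = (t ∘ k) ∘ (r ∘ h) := by
        have := hh'.naturality hk gp hr hs
        calc (t ∘ s) ∘ h' ∘ h = t ∘ (s ∘ h') ∘ h := rfl
          _ = t ∘ (k ∘ r) ∘ h := by rw [this]
          _ = (t ∘ k) ∘ (r ∘ h) := rfl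
      rw [e]
      exact represents_preVcomp (Γ := ⟨preComp Γ Δ, preComp_isInterp Γ Δ⟩)
        (Γ' := ⟨preComp Γ' Δ', preComp_isInterp Γ' Δ'⟩)
        (Γ'' := ⟨preComp Γ'' Δ'', preComp_isInterp Γ'' Δ''⟩)
        (θ := ⟨preHcomp α β, opsClosed.hcomp α β⟩) (η := ⟨preHcomp α' β', opsClosed.hcomp α' β'⟩)
        (represents_preHcomp hh hg hr) (represents_preHcomp hk hg' ht)
  · intro a b (Γ : Interp a b) (Γ' : Interp a b) (θ : Mor Γ Γ')
    refine Mor.heq_of_represents (id_comp₁ Γ) (id_comp₁ Γ') (Nat.one_mul _) (Nat.one_mul _)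
      fun M => ?_
    obtain ⟨N, ⟨A⟩⟩ := Γ.exists_presentation M
    obtain ⟨N', ⟨B⟩⟩ := Γ'.exists_presentation M
    obtain ⟨h, -, hr⟩ := θ.isMor.exists_map A B
    let I : Interp a a := ⟨preId a, preId_isInterp a⟩
    refine ⟨N, N', Presentation.trans (Γ := I) (.self N) A,
      Presentation.trans (Γ := I) (.self N') B, A, B, h, ?_, hr, self_trans_rep A,
      self_trans_rep B⟩
    refine represents_preHcomp (Γ := I) (Γ' := I) (θ := ⟨preId₂ I, opsClosed.id₂ I⟩) (h := id)
      (b := h) (represents_preId₂ (Γ := I) (.self N)) hr ?_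
    -- For the identity interpretation a one-element tuple represents its entry, so the map pushed
    -- forward along `h` is `h` itself.
    rintro d c rfl
    rfl
  · intro a b (Γ : Interp a b) (Γ' : Interp a b) (θ : Mor Γ Γ')
    refine Mor.heq_of_represents (comp₁_id Γ) (comp₁_id Γ') (Nat.mul_one _) (Nat.mul_one _)
      fun M => ?_
    obtain ⟨N, ⟨A⟩⟩ := Γ.exists_presentation M
    obtain ⟨N', ⟨B⟩⟩ := Γ'.exists_presentation M
    obtain ⟨h, -, hr⟩ := θ.isMor.exists_map A B
    let I : Interp b b := ⟨preId b, preId_isInterp b⟩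
    refine ⟨N, N', Presentation.trans (Δ := I) A (.self M),
      Presentation.trans (Δ := I) B (.self M), A, B, h, ?_, hr, trans_self_rep A,
      trans_self_rep B⟩
    exact represents_preHcomp (Δ := I) (Δ' := I) (η := ⟨preId₂ I, opsClosed.id₂ I⟩) (g := id)
      (b := id) hr (represents_preId₂ (Γ := I) (.self M)) (Pushes.id B)
  · intro a b c d (Γ : Interp a b) (Γ' : Interp a b) (Δ : Interp b c) (Δ' : Interp b c)
      (Ξ : Interp c d) (Ξ' : Interp c d) (α : Mor Γ Γ') (β : Mor Δ Δ') (γ : Mor Ξ Ξ')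
    refine Mor.heq_of_represents (assoc₁ Γ Δ Ξ) (assoc₁ Γ' Δ' Ξ') (Nat.mul_assoc _ _ _)
      (Nat.mul_assoc _ _ _) fun M => ?_
    obtain ⟨Q, ⟨E⟩⟩ := Ξ.exists_presentation M
    obtain ⟨Q', ⟨E'⟩⟩ := Ξ'.exists_presentation M
    obtain ⟨q, qp, hq⟩ := γ.isMor.exists_map E E'
    obtain ⟨P, ⟨D⟩⟩ := Δ.exists_presentation Q
    obtain ⟨P₁, ⟨D₁⟩⟩ := Δ'.exists_presentation Q
    obtain ⟨P', ⟨D'⟩⟩ := Δ'.exists_presentation Q'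
    obtain ⟨g, gp, hg⟩ := β.isMor.exists_map D D₁
    obtain ⟨p, pp, hp⟩ := exists_pushes D₁ D' qp
    obtain ⟨N, ⟨A⟩⟩ := Γ.exists_presentation P
    obtain ⟨N₁, ⟨A₁⟩⟩ := Γ'.exists_presentation P
    -- The pushforward along `p ∘ g` is factored through `P₁` from the start, so that both
    -- bracketings represent the same function `s ∘ r ∘ h`.
    obtain ⟨N₂, ⟨A₂⟩⟩ := Γ'.exists_presentation P₁
    obtain ⟨N', ⟨A'⟩⟩ := Γ'.exists_presentation P'
    obtain ⟨h, -, hh⟩ := α.isMor.exists_map A A₁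
    obtain ⟨r, -, hr⟩ := exists_pushes A₁ A₂ gp
    obtain ⟨s, -, hs⟩ := exists_pushes A₂ A' pp
    refine ⟨N, N',
      Presentation.trans (Γ := ⟨preComp Γ Δ, preComp_isInterp Γ Δ⟩) (A.trans D) E,
      Presentation.trans (Γ := ⟨preComp Γ' Δ', preComp_isInterp Γ' Δ'⟩) (A'.trans D') E',
      Presentation.trans (Δ := ⟨preComp Δ Ξ, preComp_isInterp Δ Ξ⟩) A (D.trans E),
      Presentation.trans (Δ := ⟨preComp Δ' Ξ', preComp_isInterp Δ' Ξ'⟩) A' (D'.trans E'),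
      s ∘ r ∘ h, ?_, ?_, trans_trans_rep A D E, trans_trans_rep A' D' E'⟩
    · exact represents_preHcomp (Γ := ⟨preComp Γ Δ, preComp_isInterp Γ Δ⟩)
        (Γ' := ⟨preComp Γ' Δ', preComp_isInterp Γ' Δ'⟩) (B := A₂.trans D₁) (B' := A'.trans D')
        (θ := ⟨preHcomp α β, opsClosed.hcomp α β⟩) (h := r ∘ h) (b := s)
        (represents_preHcomp hh hg hr) hq (hp.trans hs)
    · exact represents_preHcomp (Δ := ⟨preComp Δ Ξ, preComp_isInterp Δ Ξ⟩)
        (Δ' := ⟨preComp Δ' Ξ', preComp_isInterp Δ' Ξ'⟩) (B := A₁) (B' := A')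
        (η := ⟨preHcomp β γ, opsClosed.hcomp β γ⟩) (h := h) (g := p ∘ g) (b := s ∘ r)
        hh (represents_preHcomp hg hq hp) (hs.comp hr)

/-- In arity one all positions coincide, so equality at one position is equality of tuples. In this
form the condition makes representation injective on tuples, which visibly passes to composites. -/
theorem Interp.isStrong_iff {T T' : CohTheory.{u}} (Γ : Interp T T') :
    Γ.IsStrong ↔ Γ.arity = 1 ∧ ∀ (M : T'.Model) (x y : Fin Γ.arity → M),
      Γ.eqv.Realize M (concat ![x, y]) ↔ x = y := by
  refine and_congr_right fun h => ⟨fun H M x y => ?_, fun H j => Lind.ext_realize fun M a => ?_⟩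
  · have : Subsingleton (Fin Γ.arity) := h ▸ inferInstanceAs (Subsingleton (Fin 1))
    rw [H ⟨0, h ▸ one_pos⟩, Lind.realize_mk, CohFormula.Realize, concat_apply, concat_apply]
    refine ⟨fun h => funext fun i => ?_, fun h => congrFun h _⟩
    rw [Subsingleton.elim i]
    exact h
  · have : Subsingleton (Fin Γ.arity) := h ▸ inferInstanceAs (Subsingleton (Fin 1))
    obtain ⟨a, rfl⟩ := exists_concat a
    obtain ⟨x, y, rfl⟩ := exists_pair a
    rw [H, Lind.realize_mk, CohFormula.Realize, concat_apply, concat_apply]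
    refine ⟨fun h => congrFun h _, fun h => funext fun i => ?_⟩
    rw [Subsingleton.elim i j]
    exact h

theorem strongClosed : StrongClosed opsClosed.{u} where
  id T := ⟨rfl, fun (j : Fin 1) => by
    rw [Subsingleton.elim j 0]
    rfl⟩
  comp {T T' T''} Γ Δ hΓ hΔ := by
    rw [isStrong_iff] at hΓ hΔ
    refine (isStrong_iff ⟨preComp Γ Δ, preComp_isInterp Γ Δ⟩).2 ⟨by simp [preComp, hΓ.1, hΔ.1], fun M x y => ?_⟩
    obtain ⟨P, ⟨D⟩⟩ := Δ.exists_presentation M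
    obtain ⟨N, ⟨A⟩⟩ := Γ.exists_presentation P
    have hD : ∀ x y, (∃ c, D.Rep x c ∧ D.Rep y c) ↔ x = y := fun x y =>
      (D.eqv_iff x y).symm.trans (hΔ.2 M x y)
    have hA : ∀ x y, (∃ c, A.Rep x c ∧ A.Rep y c) ↔ x = y := fun x y =>
      (A.eqv_iff x y).symm.trans (hΓ.2 P x y)
    refine ((A.trans D).eqv_iff x y).trans ⟨?_, ?_⟩
    · rintro ⟨c, ⟨d, hd, hc⟩, d', hd', hc'⟩
      obtain rfl := (hA d d').1 ⟨c, hc, hc'⟩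
      rw [← concat_blocks (α := M) (n := Γ.arity) (k := Δ.arity) x,
        ← concat_blocks (α := M) (n := Γ.arity) (k := Δ.arity) y]
      exact congrArg concat (funext fun i => (hD _ _).1 ⟨d i, hd i, hd' i⟩)
    · rintro rfl
      choose d hd using fun i => (hD (blocks x i) (blocks x i)).2 rfl
      obtain ⟨c, hc, -⟩ := (hA d d).2 rfl
      exact ⟨c, ⟨d, fun i => (hd i).1, hc⟩, d, fun i => (hd i).1, hc⟩

end CohTheory

end PosLogic

namespace PosLogic

namespace TypeSpaceFunctor

variable (F : TypeSpaceFunctor.{u})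

/-! ### The internal logic -/

theorem map_map {n m p : ℕ} (f : Fin n → Fin m) (g : Fin m → Fin p) (q : F.obj p) :
    F.map f (F.map g q) = F.map (g ∘ f) q := by
  rw [F.map_comp]
  rfl

@[simp] theorem map_id_apply {n : ℕ} (q : F.obj n) : F.map id q = q := by
  rw [F.map_id]
  rfl

theorem map_surjective {n m : ℕ} {f : Fin n → Fin m} {g : Fin m → Fin n} (h : g ∘ f = id) :
    Function.Surjective (F.map f) := fun q => ⟨F.map g q, by rw [F.map_map, h, F.map_id_apply]⟩

variable {F}

@[simp] theorem mem_preimage {n m : ℕ} {f : Fin n → Fin m} {U : CompactOpens (F.obj n)}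
    {q : F.obj m} : q ∈ F.preimage f U ↔ F.map f q ∈ U := Iff.rfl

@[simp] theorem mem_image {n m : ℕ} {f : Fin n → Fin m} {U : CompactOpens (F.obj m)}
    {q : F.obj n} : q ∈ F.image f U ↔ ∃ r ∈ U, F.map f r = q := Iff.rfl

theorem mem_inf {n : ℕ} {U V : CompactOpens (F.obj n)} {q : F.obj n} :
    q ∈ U ⊓ V ↔ q ∈ U ∧ q ∈ V := Iff.rfl

theorem mem_top {n : ℕ} {q : F.obj n} : q ∈ (⊤ : CompactOpens (F.obj n)) := trivial

@[simp] theorem preimage_id {n : ℕ} (U : CompactOpens (F.obj n)) : F.preimage id U = U :=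
  SetLike.ext fun q => by rw [mem_preimage, map_id_apply]

theorem mem_interp_conj {n m : ℕ} {φ : Fin m → CohFormula F.lang n} {q : F.obj n} :
    q ∈ F.interp (.conj φ) ↔ ∀ i, q ∈ F.interp (φ i) := by
  induction m with
  | zero => simpa [CohFormula.conj, interp] using mem_top
  | succ m ih =>
    rw [CohFormula.conj, interp, mem_inf, ih]
    exact (Fin.forall_fin_succ (P := fun i => q ∈ F.interp (φ i))).symm

theorem mem_interp_exs {n : ℕ} (k : ℕ) {φ : CohFormula F.lang (n + k)} {q : F.obj n} :
    q ∈ F.interp (.exs k φ) ↔ ∃ r ∈ F.interp φ, F.map (Fin.castAdd k) r = q := by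
  induction k with
  | zero =>
    have e : (Fin.castAdd 0 : Fin n → Fin (n + 0)) = id := rfl
    simp [CohFormula.exs, e]
  | succ k ih =>
    simp only [CohFormula.exs, ih, interp, mem_image]
    constructor
    · rintro ⟨_, ⟨r, hr, rfl⟩, rfl⟩
      exact ⟨r, hr, (F.map_map (Fin.castAdd k) Fin.castSucc r).symm⟩
    · rintro ⟨r, hr, rfl⟩
      exact ⟨_, ⟨r, hr, rfl⟩, F.map_map (Fin.castAdd k) Fin.castSucc r⟩

/-- Compact open sets form a basis of a spectral space, and spectral spaces are `T₀`. -/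
theorem eq_of_forall_mem {n : ℕ} {p q : F.obj n}
    (h : ∀ U : CompactOpens (F.obj n), p ∈ U ↔ q ∈ U) : p = q := by
  refine (Inseparable.eq ?_ : p = q)
  refine (PrespectralSpace.isTopologicalBasis (X := F.obj n)).inseparable_iff.2 fun U hU => ?_
  exact h ⟨⟨U, hU.2⟩, hU.1⟩

/-! ### Adding a variable -/

/-- Adjoining a variable commutes with a change of variables. Beck–Chevalley for this square is the
extension property of types that drives the Henkin construction. -/
theorem isFinPushout_castSucc {n m : ℕ} (f : Fin n → Fin m) :
    IsFinPushout Fin.castSucc f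
      (Fin.snoc (fun i => (f i).castSucc) (Fin.last m) : Fin (n + 1) → Fin (m + 1))
      Fin.castSucc := by
  refine ⟨funext fun i => by simp, fun p s t h =>
    ⟨(Fin.snoc t (s (Fin.last n)) : Fin (m + 1) → Fin p), ⟨?_, ?_⟩, ?_⟩⟩
  · funext i
    refine Fin.lastCases ?_ (fun i => ?_) i
    · simp
    · simpa using (congrFun h i).symm
  · funext i
    simp
  · rintro r ⟨rfl, rfl⟩
    funext i
    refine Fin.lastCases ?_ (fun i => ?_) i <;> simp

/-- A type that has an extension after a change of variables has an extension itself. -/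
theorem exists_extension {n m : ℕ} (f : Fin n → Fin m) {q : F.obj m}
    {U : CompactOpens (F.obj (n + 1))} (h : F.map f q ∈ F.image Fin.castSucc U) :
    ∃ r : F.obj (m + 1), F.map Fin.castSucc r = q ∧
      F.map (Fin.snoc (fun i => (f i).castSucc) (Fin.last m) : Fin (n + 1) → Fin (m + 1)) r ∈ U := by
  have := F.beckChevalley _ _ _ _ (isFinPushout_castSucc f) U
  obtain ⟨r, hr, rfl⟩ := this.symm.subset h
  exact ⟨r, rfl, hr⟩

/-! ### Equality -/

variable (F) in
/-- The value of `x_0 = x_1`. -/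
abbrev diag : CompactOpens (F.obj 2) := F.interp (.eq 0 1)

theorem update_id_self {n : ℕ} (i : Fin n) : Function.update id i i = (id : Fin n → Fin n) :=
  Function.update_eq_self i id

theorem update_comp_update {n : ℕ} (i j : Fin n) :
    Function.update id i j ∘ Function.update id i j = Function.update (id : Fin n → Fin n) i j := by
  funext k
  by_cases hk : k = i <;> by_cases hj : j = i <;> simp [hk, hj]

/-- The substitution of `j` for `i` is idempotent, so the image of the map it induces is the set of
fixed points. -/
theorem mem_eq_iff {n : ℕ} {i j : Fin n} {q : F.obj n} :
    q ∈ F.interp (.eq i j) ↔ F.map (Function.update id i j) q = q := by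
  constructor
  · rintro ⟨r, -, rfl⟩
    rw [F.map_map, update_comp_update]
  · exact fun h => ⟨q, mem_top, h⟩

/-- The quotient identifying two variables is the pushout of `2 → 1` along the pair, realised by
omitting `i`. Through Beck–Chevalley it allows equality of two variables to be tested on their
two-variable type. -/
theorem isFinPushout_identify {n : ℕ} {i j : Fin (n + 1)} (h : j ≠ i) :
    IsFinPushout (fun _ : Fin 2 => (0 : Fin 1)) ![i, j]
      (fun _ => (finSuccAboveEquiv i).symm ⟨j, h⟩)
      (fun k => if hk : k = i then (finSuccAboveEquiv i).symm ⟨j, h⟩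
        else (finSuccAboveEquiv i).symm ⟨k, hk⟩) := by
  have e : ∀ k (hk : k ≠ i), i.succAbove ((finSuccAboveEquiv i).symm ⟨k, hk⟩) = k := fun k hk =>
    congrArg Subtype.val ((finSuccAboveEquiv i).apply_symm_apply ⟨k, hk⟩)
  refine ⟨?_, fun p s t hst => ⟨t ∘ i.succAbove, ⟨?_, ?_⟩, ?_⟩⟩
  · funext k
    fin_cases k <;> simp [h]
  · funext k
    rw [Subsingleton.elim k 0]
    simpa [e] using (congrFun hst 1).symm
  · funext k
    by_cases hk : k = i
    · subst hk
      have h₀ : s 0 = t k := congrFun hst 0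
      have h₁ : s 0 = t j := congrFun hst 1
      simp [e, ← h₀, ← h₁]
    · simp [e, hk]
  · rintro r ⟨-, rfl⟩
    funext k
    obtain ⟨⟨k', hk⟩, rfl⟩ := (finSuccAboveEquiv i).symm.surjective k
    simp [e, hk]

/-- If the type of the pair lies in the diagonal, Beck–Chevalley shows that `q` is induced along the
quotient identifying `i` with `j`. Precomposing this quotient with the substitution does not change
it, so `q` is fixed. -/
theorem map_pair_mem_diag_iff {n : ℕ} {i j : Fin n} {q : F.obj n} :
    F.map ![i, j] q ∈ F.diag ↔ F.map (Function.update id i j) q = q := by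
  constructor
  · rintro ⟨r, -, hr⟩
    by_cases h : j = i
    · subst h
      rw [update_id_self, F.map_id_apply]
    obtain _ | n := n
    · exact i.elim0
    have hE : F.map ![i, j] q ∈ F.map (fun _ : Fin 2 => (0 : Fin 1)) ''
        ((⊤ : CompactOpens (F.obj 1)) : Set (F.obj 1)) := by
      -- The substitution of `1` for `0` on two variables is constant and hence factors through one
      -- variable, namely the second.
      refine ⟨F.map (fun _ => 1) r, trivial, ?_⟩
      rw [← hr, F.map_map]
      congr 2
      funext k
      fin_cases k <;> rfl
    obtain ⟨s, -, rfl⟩ := (F.beckChevalley _ _ _ _ (isFinPushout_identify h) ⊤).symm.subset hE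
    rw [F.map_map]
    congr 2
    funext k
    by_cases hk : k = i
    · subst hk
      simp [h]
    · simp [hk]
  · intro h
    have e : Function.update id i j ∘ ![i, j] = ![j, j] := by
      funext k
      fin_cases k <;> by_cases hj : j = i <;> simp [hj]
    rw [mem_eq_iff, ← h, F.map_map (![i, j]), e, F.map_map]
    congr 2
    funext k
    fin_cases k <;> rfl

/-- Equal variables can be substituted for one another. -/
theorem map_eq_map {n m : ℕ} {s t : Fin m → Fin n} {q : F.obj n}
    (h : ∀ i, F.map ![s i, t i] q ∈ F.diag) : F.map s q = F.map t q := by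
  classical
  -- The variables are exchanged one at a time, `S` being the set already exchanged.
  have key : ∀ S : Finset (Fin m), F.map s q = F.map (fun i => if i ∈ S then t i else s i) q := by
    intro S
    induction S using Finset.induction_on with
    | empty => simp
    | insert i S hi ih =>
      let c : Fin m → Fin n := fun i => if i ∈ S then t i else s i
      -- With `t i` adjoined as a last coordinate, one exchange is the substitution of the last
      -- variable for the `i`-th, to which the fixed-point criterion applies.
      let d : Fin (m + 1) → Fin n := Fin.snoc c (t i)
      have h₁ : F.map (Function.update id i.castSucc (Fin.last m)) (F.map d q) = F.map d q := by
        rw [← map_pair_mem_diag_iff, F.map_map, comp_pair]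
        simpa [d, c, hi] using h i
      have h₂ := congrArg (F.map Fin.castSucc) h₁
      rw [F.map_map, F.map_map, F.map_map] at h₂
      have e₁ : d ∘ Fin.castSucc = c := by
        funext k
        simp [d]
      have e₂ : d ∘ Function.update id i.castSucc (Fin.last m) ∘ Fin.castSucc =
          fun k => if k ∈ insert i S then t k else s k := by
        funext k
        by_cases hk : k = i
        · subst hk
          simp [d]
        · have : k.castSucc ≠ i.castSucc := fun h => hk (Fin.castSucc_injective _ h)
          simp [d, c, hk, this]
      rw [ih, ← e₂, h₂, e₁]
  simpa using key Finset.univ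

theorem mem_diag_self {n : ℕ} (i : Fin n) (q : F.obj n) : F.map ![i, i] q ∈ F.diag := by
  rw [map_pair_mem_diag_iff, update_id_self, F.map_id_apply]

/-! ### The theory of a type space functor -/

open CohTheory

/-- The class of a formula. -/
def mkTh {n : ℕ} (φ : CohFormula F.lang n) : F.Th.Lind n := Lind.mk φ

/-- The class of the atomic formula `R_U`. -/
def cl {n : ℕ} (U : CompactOpens (F.obj n)) : F.Th.Lind n := mkTh (F.atom U id)

/-- Soundness is immediate because every inclusion of values is an axiom. The converse is the
completeness theorem `mkTh_le_iff`. -/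
theorem mkTh_mono {n : ℕ} {φ ψ : CohFormula F.lang n} (h : F.interp φ ≤ F.interp ψ) :
    mkTh φ ≤ mkTh ψ :=
  fun _ _ hM a => hM ⟨n, φ, ψ⟩ h a

theorem mkTh_congr {n : ℕ} {φ ψ : CohFormula F.lang n} (h : F.interp φ = F.interp ψ) :
    mkTh φ = mkTh ψ :=
  le_antisymm (mkTh_mono h.le) (mkTh_mono h.ge)

/-- An atomic formula in the identity tuple of variables has its own compact open set as value, so
modulo `Th F` every formula may be taken atomic. -/
theorem mkTh_eq_cl {n : ℕ} (φ : CohFormula F.lang n) : mkTh φ = cl (F.interp φ) :=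
  mkTh_congr (preimage_id _).symm

theorem cl_mono {n : ℕ} {U V : CompactOpens (F.obj n)} (h : U ≤ V) : cl U ≤ cl V :=
  mkTh_mono (by rwa [interp, interp, preimage_id, preimage_id])

theorem mkTh_atom {n m : ℕ} (U : CompactOpens (F.obj n)) (f : Fin n → Fin m) :
    mkTh (F.atom U f) = (cl U).subst f := rfl

theorem mkTh_and {n : ℕ} (φ ψ : CohFormula F.lang n) : mkTh (φ.and ψ) = mkTh φ ⊓ mkTh ψ := rfl

theorem mkTh_exs {n : ℕ} (k : ℕ) (φ : CohFormula F.lang (n + k)) :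
    mkTh (φ.exs k) = (mkTh φ).exs k := rfl

theorem realize_mkTh_eq {M : F.Th.Model} {n : ℕ} (i j : Fin n) (a : Fin n → M) :
    (mkTh (.eq i j)).Realize M a ↔ a i = a j := Iff.rfl

theorem mkTh_conj {n m : ℕ} (φ : Fin m → CohFormula F.lang n) :
    mkTh (.conj φ) = Finset.univ.inf fun i => mkTh (φ i) := by
  refine Lind.ext_realize fun M a => ?_
  simp only [Lind.realize_finset_inf, Finset.mem_univ, true_implies]
  exact CohFormula.realize_conj (L := F.Th.lang) φ a

theorem cl_subst {n m : ℕ} (U : CompactOpens (F.obj n)) (f : Fin n → Fin m) :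
    (cl U).subst f = cl (F.preimage f U) := by
  rw [← mkTh_atom, mkTh_eq_cl, interp]

theorem cl_inf {n : ℕ} (U V : CompactOpens (F.obj n)) : cl (U ⊓ V) = cl U ⊓ cl V := by
  have := mkTh_eq_cl (.and (F.atom U id) (F.atom V id))
  rw [interp, interp, interp, preimage_id, preimage_id] at this
  exact this.symm

theorem cl_sup {n : ℕ} (U V : CompactOpens (F.obj n)) : cl (U ⊔ V) = cl U ⊔ cl V := by
  have := mkTh_eq_cl (.or (F.atom U id) (F.atom V id))
  rw [interp, interp, interp, preimage_id, preimage_id] at this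
  exact this.symm

theorem cl_top {n : ℕ} : (cl ⊤ : F.Th.Lind n) = ⊤ := (mkTh_eq_cl .top).symm

theorem cl_bot {n : ℕ} : (cl ⊥ : F.Th.Lind n) = ⊥ := (mkTh_eq_cl .bot).symm

theorem cl_finset_inf {n : ℕ} {ι : Type*} (s : Finset ι) (U : ι → CompactOpens (F.obj n)) :
    cl (s.inf U) = s.inf fun i => cl (U i) := by
  classical
  induction s using Finset.induction_on with
  | empty => exact cl_top
  | insert i s _ ih => rw [Finset.inf_insert, Finset.inf_insert, cl_inf, ih]

/-- Direct images are existential quantifiers. -/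
theorem realize_cl_image {M : F.Th.Model} {n m : ℕ} (g : Fin n → Fin m)
    (V : CompactOpens (F.obj m)) (a : Fin n → M) :
    (cl (F.image g V)).Realize M a ↔ ∃ b, b ∘ g = a ∧ (cl V).Realize M b := by
  -- This is the formula `∃ ȳ (R_V(ȳ) ∧ ⋀ x_i = y_{g(i)})`.
  let φ : CohFormula F.lang n := .exs m (.and (F.atom V (Fin.natAdd n))
    (.conj fun i : Fin n => .eq (Fin.castAdd m i) (Fin.natAdd n (g i))))
  have e : F.interp φ = F.image g V := by
    refine SetLike.ext fun q => ?_
    rw [mem_interp_exs, mem_image]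
    simp only [interp.eq_5, mem_inf, mem_interp_conj]
    constructor
    · rintro ⟨r, ⟨hV, hr⟩, rfl⟩
      refine ⟨F.map (Fin.natAdd n) r, hV, ?_⟩
      rw [F.map_map]
      refine (map_eq_map fun i => ?_).symm
      rw [map_pair_mem_diag_iff]
      exact mem_eq_iff.1 (hr i)
    · rintro ⟨r, hr, rfl⟩
      have e₁ : (Fin.append g id : Fin (n + m) → Fin m) ∘ Fin.castAdd m = g :=
        append_comp_castAdd _ _
      have e₂ : (Fin.append g id : Fin (n + m) → Fin m) ∘ Fin.natAdd n = id :=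
        append_comp_natAdd _ _
      -- If `r` is the type of a tuple `ȳ`, the point chosen is the type of the tuple `(ȳ ∘ g, ȳ)`.
      refine ⟨F.map (Fin.append g id) r, ⟨?_, fun i => ?_⟩, ?_⟩
      · rw [interp, mem_preimage, F.map_map, e₂, F.map_id_apply]
        exact hr
      · rw [mem_eq_iff, ← map_pair_mem_diag_iff, F.map_map, comp_pair, Fin.append_left,
          Fin.append_right]
        exact mem_diag_self _ _
      · rw [F.map_map, e₁]
  rw [← e, ← mkTh_eq_cl, mkTh_exs, Lind.realize_exs]
  refine exists_congr fun b => ?_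
  rw [mkTh_and, mkTh_conj, mkTh_atom, Lind.realize_inf, Lind.realize_subst, append_comp_natAdd,
    Lind.realize_finset_inf, and_comm]
  simp only [Finset.mem_univ, true_implies, realize_mkTh_eq, Fin.append_left, Fin.append_right]
  exact and_congr_left fun _ => ⟨fun h => funext fun i => (h i).symm, fun h i => (congrFun h i).symm⟩

end TypeSpaceFunctor

end PosLogic

namespace PosLogic

namespace TypeSpaceFunctor

open CohTheory

variable {F F' : TypeSpaceFunctor.{u}}

/-! ### Preimages under partial natural transformations -/

namespace Trans

variable (β : Trans F F')

theorem mem_pre_iff {n : ℕ} {U : CompactOpens (F'.obj n)} {p : F.obj (n * β.arity)}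
    {q : F'.obj n} (hq : q ∈ β.app n p) : p ∈ β.pre U ↔ q ∈ U :=
  ⟨fun ⟨_, hU, h⟩ => Part.mem_unique hq h ▸ hU, fun h => ⟨q, h, hq⟩⟩

theorem mem_pre_top {n : ℕ} {p : F.obj (n * β.arity)} :
    p ∈ β.pre (⊤ : CompactOpens (F'.obj n)) ↔ ∃ q, q ∈ β.app n p :=
  ⟨fun ⟨q, _, h⟩ => ⟨q, h⟩, fun ⟨q, h⟩ => ⟨q, trivial, h⟩⟩

theorem pre_mono {n : ℕ} {U V : CompactOpens (F'.obj n)} (h : U ≤ V) : β.pre U ≤ β.pre V :=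
  fun _ ⟨q, hU, hq⟩ => ⟨q, h hU, hq⟩

theorem pre_inf {n : ℕ} (U V : CompactOpens (F'.obj n)) :
    β.pre (U ⊓ V) = β.pre U ⊓ β.pre V := by
  refine le_antisymm (le_inf (β.pre_mono inf_le_left) (β.pre_mono inf_le_right)) ?_
  rintro p ⟨⟨q, hU, hq⟩, h⟩
  exact ⟨q, ⟨hU, (β.mem_pre_iff hq).1 h⟩, hq⟩

theorem pre_sup {n : ℕ} (U V : CompactOpens (F'.obj n)) :
    β.pre (U ⊔ V) = β.pre U ⊔ β.pre V := by
  refine le_antisymm ?_ (sup_le (β.pre_mono le_sup_left) (β.pre_mono le_sup_right))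
  rintro p ⟨q, hU | hV, hq⟩
  exacts [Or.inl ⟨q, hU, hq⟩, Or.inr ⟨q, hV, hq⟩]

theorem pre_bot {n : ℕ} : β.pre (⊥ : CompactOpens (F'.obj n)) = ⊥ :=
  le_bot_iff.1 fun _ ⟨_, (h : False), _⟩ => h.elim

theorem pre_top (n : ℕ) : β.pre (⊤ : CompactOpens (F'.obj n)) =
    Finset.univ.inf fun i : Fin n => F.preimage (times (fun _ : Fin 1 => i) β.arity)
      (β.pre ⊤) := by
  refine SetLike.ext fun p => ?_
  have mem_finset_inf : ∀ (s : Finset (Fin n)) (U : Fin n → CompactOpens (F.obj (n * β.arity))),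
      p ∈ s.inf U ↔ ∀ i ∈ s, p ∈ U i := by
    intro s U
    classical
    induction s using Finset.induction_on with
    | empty => simpa using mem_top
    | insert i s _ ih => simp [Finset.inf_insert, mem_inf, ih]
  have := Set.ext_iff.1 (β.isCell.cartesian n) p
  rw [mem_finset_inf]
  simp only [mem_preimage, mem_pre_top, Finset.mem_univ, true_implies]
  simpa [Part.dom_iff_mem, PFun.mem_dom] using this

theorem mem_pre_preimage {n m : ℕ} (f : Fin n → Fin m) (U : CompactOpens (F'.obj n))
    {p : F.obj (m * β.arity)} (hp : p ∈ β.pre (⊤ : CompactOpens (F'.obj m))) :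
    p ∈ β.pre (F'.preimage f U) ↔ F.map (times f β.arity) p ∈ β.pre U := by
  obtain ⟨q, hq⟩ := β.mem_pre_top.1 hp
  rw [β.mem_pre_iff hq, β.mem_pre_iff (β.isCell.natural f p q hq), mem_preimage]

/-- Naturality is available only on the domain, so membership in the domain must be kept for all `m`
blocks, including those not in the image of `f`. This matches the relativisation in the atomic
clause of `onFormula`. -/
theorem pre_preimage {n m : ℕ} (f : Fin n → Fin m) (U : CompactOpens (F'.obj n)) :
    β.pre (F'.preimage f U) = β.pre ⊤ ⊓ F.preimage (times f β.arity) (β.pre U) :=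
  SetLike.ext fun _ => ⟨fun h => have h' := β.pre_mono le_top h
    ⟨h', (β.mem_pre_preimage f U h').1 h⟩, fun h => (β.mem_pre_preimage f U h.1).2 h.2⟩

theorem times_id (n k : ℕ) : times (id : Fin n → Fin n) k = id := by
  funext p
  obtain ⟨⟨i, j⟩, rfl⟩ := finProdFinEquiv.surjective p
  simp [times]

theorem times_comp {n m l : ℕ} (g : Fin m → Fin l) (f : Fin n → Fin m) (k : ℕ) :
    times g k ∘ times f k = times (g ∘ f) k := by
  rw [times, concat_comp_times]
  rfl

/-- For `n > 0` the inclusion has a retraction, so the map it induces is surjective and the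
intersection in the weak Beck–Chevalley condition disappears. For `n = 0` the condition is assumed
without the intersection. -/
theorem pre_image_castSucc {n : ℕ} (U : CompactOpens (F'.obj (n + 1))) :
    β.pre (F'.image Fin.castSucc U) = F.image (times Fin.castSucc β.arity) (β.pre U) := by
  obtain ⟨h₁, h₂⟩ := β.isCell.weakBeckChevalley (Fin.castSucc : Fin n → Fin (n + 1)) U
  refine SetLike.coe_injective ?_
  obtain _ | n := n
  · exact h₂ rfl
  · refine Eq.trans ?_ h₁
    have : Function.Surjective
        (F.map (times (Fin.castSucc : Fin (n + 1) → Fin (n + 2)) β.arity)) := by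
      refine map_surjective F (g := times (Fin.snoc id 0) β.arity) ?_
      have e : (Fin.snoc id 0 : Fin (n + 2) → Fin (n + 1)) ∘ Fin.castSucc = id := by
        funext i
        simp
      rw [times_comp, e, times_id]
    rw [this.range_eq, Set.inter_univ]
    rfl

end Trans

/-! ### Interpretations from partial natural transformations -/

section Holds

variable (β : Trans F F') (M : F.Th.Model)

/-- The compact open set `U` holds for tuples of elements of `M`. -/
def Holds {n : ℕ} (U : CompactOpens (F'.obj n)) (a : Fin n → Fin β.arity → M) : Prop :=
  (cl (β.pre U)).Realize M (concat a)

variable {β M} {n m : ℕ} {a : Fin n → Fin β.arity → M}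

theorem Holds.mono {U V : CompactOpens (F'.obj n)} (h : Holds β M U a) (hUV : U ≤ V) :
    Holds β M V a :=
  Lind.le_iff.1 (cl_mono (β.pre_mono hUV)) M _ h

theorem holds_inf {U V : CompactOpens (F'.obj n)} :
    Holds β M (U ⊓ V) a ↔ Holds β M U a ∧ Holds β M V a := by
  rw [Holds, β.pre_inf, cl_inf, Lind.realize_inf]
  rfl

theorem holds_sup {U V : CompactOpens (F'.obj n)} :
    Holds β M (U ⊔ V) a ↔ Holds β M U a ∨ Holds β M V a := by
  rw [Holds, β.pre_sup, cl_sup, Lind.realize_sup]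
  rfl

theorem holds_bot : Holds β M ⊥ a ↔ False := by
  rw [Holds, β.pre_bot, cl_bot, Lind.realize_bot]

theorem holds_top : Holds β M ⊤ a ↔ ∀ i, Holds β M ⊤ fun _ : Fin 1 => a i := by
  rw [Holds, β.pre_top, cl_finset_inf, Lind.realize_finset_inf]
  refine ⟨fun h i => ?_, fun h i _ => ?_⟩
  · have := h i (Finset.mem_univ i)
    rwa [← cl_subst, Lind.realize_subst, concat_comp_times] at this
  · have := h i
    rwa [← cl_subst, Lind.realize_subst, concat_comp_times]

theorem holds_preimage {f : Fin m → Fin n} {U : CompactOpens (F'.obj m)} :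
    Holds β M (F'.preimage f U) a ↔ Holds β M ⊤ a ∧ Holds β M U (a ∘ f) := by
  rw [Holds, β.pre_preimage, cl_inf, Lind.realize_inf, ← cl_subst, Lind.realize_subst,
    concat_comp_times]
  rfl

theorem holds_image_castSucc {U : CompactOpens (F'.obj (n + 1))} :
    Holds β M (F'.image Fin.castSucc U) a ↔
      ∃ b, Holds β M U (Fin.snoc a b : Fin (n + 1) → Fin β.arity → M) := by
  rw [Holds, β.pre_image_castSucc, realize_cl_image]
  constructor
  · rintro ⟨c, hc, h⟩
    obtain ⟨c, rfl⟩ := exists_concat c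
    rw [concat_comp_times] at hc
    have hc : c ∘ Fin.castSucc = a := by rw [← blocks_concat (c ∘ _), hc, blocks_concat]
    refine ⟨c (Fin.last n), ?_⟩
    have : (Fin.snoc a (c (Fin.last n)) : Fin (n + 1) → Fin β.arity → M) = c := by
      rw [← hc]
      exact Fin.snoc_init_self c
    rwa [this]
  · rintro ⟨b, h⟩
    refine ⟨_, ?_, h⟩
    rw [concat_comp_times]
    congr 1
    funext i
    simp

theorem holds_diag_self {x : Fin β.arity → M} :
    Holds β M F'.diag ![x, x] ↔ Holds β M ⊤ fun _ : Fin 1 => x := by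
  constructor
  · exact fun h => holds_top.1 (h.mono le_top) 0
  · intro h
    have : (⊤ : CompactOpens (F'.obj 1)) ≤ F'.preimage ![0, 0] F'.diag :=
      fun q _ => mem_diag_self 0 q
    have := (holds_preimage.1 (h.mono this)).2
    rwa [comp_pair] at this

theorem Holds.diag_self {U : CompactOpens (F'.obj n)} (h : Holds β M U a) (i : Fin n) :
    Holds β M F'.diag ![a i, a i] :=
  holds_diag_self.2 (holds_top.1 (h.mono le_top) i)

theorem holds_top_iff : Holds β M ⊤ a ↔ ∀ i, Holds β M F'.diag ![a i, a i] := by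
  simp only [holds_diag_self]
  exact holds_top

/-- Symmetry is an inclusion of compact open sets of `F'_2`, and `Holds` is monotone. Transitivity
and congruence are obtained likewise, after checking that the longer tuple lies in the domain. -/
theorem holds_diag_symm {x y : Fin β.arity → M} (h : Holds β M F'.diag ![x, y]) :
    Holds β M F'.diag ![y, x] := by
  have : F'.diag ≤ F'.preimage ![1, 0] F'.diag := by
    intro q hq
    have e : F'.map ![1, 0] q = F'.map ![1, 1] q := by
      refine map_eq_map (Fin.forall_fin_two.2 ⟨mem_diag_self 1 q, ?_⟩)
      have : (![0, 1] : Fin 2 → Fin 2) = id := by decide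
      simpa [this] using hq
    rw [mem_preimage, e]
    exact mem_diag_self 1 q
  have := (holds_preimage.1 (h.mono this)).2
  rwa [comp_pair] at this

theorem holds_diag_trans {x y z : Fin β.arity → M} (h : Holds β M F'.diag ![x, y])
    (h' : Holds β M F'.diag ![y, z]) : Holds β M F'.diag ![x, z] := by
  have le : F'.preimage ![(0 : Fin 3), 1] F'.diag ⊓ F'.preimage ![1, 2] F'.diag ≤
      F'.preimage ![0, 2] F'.diag := by
    rintro q ⟨h₁, h₂⟩
    have e : F'.map ![0, 2] q = F'.map ![1, 2] q :=
      map_eq_map (Fin.forall_fin_two.2 ⟨h₁, mem_diag_self 2 q⟩)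
    rw [mem_preimage, e]
    exact h₂
  have top : Holds β M ⊤ ![x, y, z] := by
    rw [holds_top_iff]
    intro i
    fin_cases i
    exacts [h.diag_self 0, h.diag_self 1, h'.diag_self 1]
  have := (holds_preimage.1 ((holds_inf.2 ⟨holds_preimage.2 ⟨top, ?_⟩,
    holds_preimage.2 ⟨top, ?_⟩⟩).mono le)).2
  · rwa [comp_pair] at this
  · rwa [comp_pair]
  · rwa [comp_pair]

/-- The inclusion that is transported is `U(x̄) ∧ ⋀ x_i = y_i → U(ȳ)` in `2n` variables; it holds in
`F'` since equal variables may be exchanged by `map_eq_map`. -/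
theorem Holds.congr {b : Fin n → Fin β.arity → M} {U : CompactOpens (F'.obj n)}
    (h : Holds β M U a) (hab : ∀ i, Holds β M F'.diag ![a i, b i]) : Holds β M U b := by
  let D : Fin n → CompactOpens (F'.obj (n + n)) := fun i =>
    F'.preimage ![Fin.castAdd n i, Fin.natAdd n i] F'.diag
  have le : ∀ q, (∀ i, q ∈ D i) → F'.map (Fin.castAdd n) q = F'.map (Fin.natAdd n) q :=
    fun q hq => map_eq_map hq
  have top : Holds β M ⊤ (Fin.append a b) := by
    rw [holds_top_iff]
    intro i
    refine Fin.addCases (fun i => ?_) (fun i => ?_) i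
    · rw [Fin.append_left]
      exact (hab i).diag_self 0
    · rw [Fin.append_right]
      exact (hab i).diag_self 1
  have hD : ∀ s : Finset (Fin n), Holds β M (s.inf D) (Fin.append a b) := by
    intro s
    classical
    induction s using Finset.induction_on with
    | empty => exact top
    | insert i s _ ih =>
      rw [Finset.inf_insert]
      refine holds_inf.2 ⟨holds_preimage.2 ⟨top, ?_⟩, ih⟩
      rw [comp_pair, Fin.append_left, Fin.append_right]
      exact hab i
  have h₁ : Holds β M (F'.preimage (Fin.castAdd n) U) (Fin.append a b) :=
    holds_preimage.2 ⟨top, by rwa [append_comp_castAdd]⟩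
  have h₂ : F'.preimage (Fin.castAdd n) U ⊓ Finset.univ.inf D ≤
      F'.preimage (Fin.natAdd n) U := by
    rintro q ⟨hU, hq⟩
    rw [mem_preimage, ← le q fun i => (Finset.inf_le (Finset.mem_univ i) :
      Finset.univ.inf D ≤ D i) hq]
    exact hU
  have := (holds_preimage.1 ((holds_inf.2 ⟨h₁, hD _⟩).mono h₂)).2
  rwa [append_comp_natAdd] at this

theorem interp_eq {n : ℕ} (i j : Fin n) : F.interp (.eq i j) = F.preimage ![i, j] F.diag :=
  SetLike.ext fun q => by rw [mem_eq_iff, mem_preimage, map_pair_mem_diag_iff]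

end Holds

/-- Equality pulled back along `β` is a congruence, so `M` presents a structure. By induction on
`φ`, truth of `φ` there agrees with `Holds` for `⟦φ⟧`, since preimages under `β` respect unions,
intersections, substitutions and projections. An axiom of `Th F'` is an inclusion of values, and
`Holds` is monotone. -/
theorem exists_thMap_presentation (β : Trans F F') (M : F.Th.Model) :
    ∃ N : F'.Th.Model, Nonempty ((thMap β).Presentation M N) := by
  obtain ⟨N, str, ⟨A⟩⟩ := PreInterp.exists_presentation_of_congruence (Γ := thMap β) M
    (fun _ _ => holds_diag_symm) (fun _ _ _ => holds_diag_trans)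
    (fun _ _ h => Holds.diag_self h) (fun _ _ _ h h' => Holds.congr h' h)
  have hE : ∀ x y : Fin β.arity → M, Holds β M F'.diag ![x, y] ↔ ∃ c, A.Rep x c ∧ A.Rep y c :=
    A.eqv_iff
  have hR : ∀ {n : ℕ} (U : CompactOpens (F'.obj n)) (a : Fin n → Fin β.arity → M),
      Holds β M U a ↔ ∃ c : Fin n → N, (∀ i, A.Rep (a i) (c i)) ∧
        FirstOrder.Language.Structure.RelMap (L := F'.Th.lang) U c := fun U a => A.rel_iff U a
  have hT : ∀ {n : ℕ} {a : Fin n → Fin β.arity → M} {c : Fin n → N},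
      (∀ i, A.Rep (a i) (c i)) → Holds β M ⊤ a :=
    fun h => holds_top_iff.2 fun i => (hE _ _).2 ⟨_, h i, h i⟩
  have key : ∀ {n : ℕ} (φ : CohFormula F'.lang n) (a : Fin n → Fin β.arity → M) (c : Fin n → N),
      (∀ i, A.Rep (a i) (c i)) →
        (Holds β M (F'.interp φ) a ↔ CohFormula.Realize (L := F'.Th.lang) φ c) := by
    intro n φ
    induction φ with
    | top => exact fun a c h => ⟨fun _ => trivial, fun _ => hT h⟩
    | bot => exact fun a c h => holds_bot
    | eq i j =>
      intro a c h
      rw [interp_eq, holds_preimage, comp_pair, hE]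
      constructor
      · rintro ⟨-, d, h₁, h₂⟩
        exact (A.unique (h i) h₁).trans (A.unique (h j) h₂).symm
      · intro (e : c i = c j)
        exact ⟨hT h, c i, h i, e ▸ h j⟩
    | rel U x =>
      intro a c h
      rw [interp, holds_preimage, hR U]
      constructor
      · rintro ⟨-, d, h₁, h₂⟩
        rw [A.unique_tuple h₁ fun i => h (x i)] at h₂
        exact h₂
      · exact fun h' => ⟨hT h, _, fun i => h (x i), h'⟩
    | and φ ψ ih₁ ih₂ =>
      intro a c h
      rw [interp, holds_inf, ih₁ a c h, ih₂ a c h]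
      rfl
    | or φ ψ ih₁ ih₂ =>
      intro a c h
      rw [interp, holds_sup, ih₁ a c h, ih₂ a c h]
      rfl
    | @ex n φ ih =>
      intro a c h
      rw [interp, holds_image_castSucc]
      have snoc : ∀ {b d}, A.Rep b d →
          ∀ i, A.Rep ((Fin.snoc a b : Fin (n + 1) → Fin β.arity → M) i)
            ((Fin.snoc c d : Fin (n + 1) → N) i) := by
        intro b d hb i
        refine Fin.lastCases ?_ (fun i => ?_) i
        · exact (congrArg₂ A.Rep (Fin.snoc_last (α := fun _ => Fin β.arity → M) b a)
            (Fin.snoc_last (α := fun _ => N) d c)).mpr hb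
        · exact (congrArg₂ A.Rep (Fin.snoc_castSucc (α := fun _ => Fin β.arity → M) b a i)
            (Fin.snoc_castSucc (α := fun _ => N) d c i)).mpr (h i)
      constructor
      · rintro ⟨b, hb⟩
        obtain ⟨d, hd, -⟩ := (hE b b).1 (by simpa using hb.diag_self (Fin.last n))
        exact ⟨d, (ih _ _ (snoc hd)).1 hb⟩
      · rintro ⟨d, hd⟩
        obtain ⟨b, hb⟩ := A.surj d
        exact ⟨b, (ih _ _ (snoc hb)).2 hd⟩
  refine ⟨⟨N, fun s hs c hc => ?_⟩, ⟨A⟩⟩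
  obtain ⟨a, ha⟩ := A.exists_tuple c
  exact (key s.concl a c ha).1 (((key s.prem a c ha).2 hc).mono hs)

theorem thMap_isInterp (β : Trans F F') : (thMap β).IsInterp :=
  PreInterp.isInterp_of_presentations (exists_thMap_presentation β)

/-- The interpretation of theories given by a partial natural transformation. -/
def thInterp (β : Trans F F') : Interp F'.Th F.Th := ⟨thMap β, thMap_isInterp β⟩

/-- Both sides are realised by the tuples representing a member of the relation `R_U`. Together with
`mkTh_eq_cl`, this describes the action of `Th(β)` on all formulas by preimages. -/
theorem onLind_cl (β : Trans F F') {n : ℕ} (U : CompactOpens (F'.obj n)) :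
    (thInterp β).onLind (cl U) = cl (β.pre U) := by
  refine Lind.ext_realize fun M a => ?_
  obtain ⟨N, ⟨A⟩⟩ := (thInterp β).exists_presentation M
  obtain ⟨a, rfl⟩ := exists_concat a
  exact (Interp.realize_onLind A (cl U) a).trans (A.rel_iff U a).symm

theorem onFormula_eq (β : Trans F F') {n : ℕ} (φ : CohFormula F'.lang n) :
    (thInterp β).onFormula φ = cl (β.pre (F'.interp φ)) := by
  rw [← onLind_cl, ← mkTh_eq_cl]
  rfl

/-- The clauses follow from the corresponding inclusions by soundness. Preservation is assumed for
the symbols `R_U` only, which suffices because a translated formula is the preimage of its value. -/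
theorem thMap₂_isMor {β β' : Trans F F'} (Θ : Trans.Mor β β') :
    Interp.IsMor (thInterp β) (thInterp β') (thMap₂ Θ) where
  total := mkTh_mono Θ.isMor.total
  le_domain := mkTh_mono Θ.isMor.le_domain
  congr_left x x' y := mkTh_mono (Θ.isMor.congr_left x x' y)
  congr_right x y y' := mkTh_mono (Θ.isMor.congr_right x y y')
  preserves φ x y := by
    have := mkTh_mono (Θ.isMor.preserves (F'.interp φ) x y)
    rw [mkTh_and, mkTh_conj] at this
    erw [onFormula_eq β φ, onFormula_eq β' φ]
    exact this

theorem thClosed : ThClosed.{u} where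
  isInterp := thMap_isInterp
  isMor := thMap₂_isMor

end TypeSpaceFunctor

end PosLogic

/-! ### Limits in the constructible topology and the Henkin construction. -/

namespace PosLogic

open Topology in
/-- Ultrafilters on a spectral space converge in the constructible topology. -/
theorem exists_ultrafilter_limit {X : Type u} [TopologicalSpace X] [SpectralSpace X]
    (𝒰 : Ultrafilter X) : ∃ x, ∀ U : CompactOpens X, x ∈ U ↔ (U : Set X) ∈ 𝒰 := by
  let ι : X → WithConstructibleTopology X := WithTopology.toTopology _
  obtain ⟨y, -, hy⟩ := (isCompact_univ (X := WithConstructibleTopology X)).ultrafilter_le_nhds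
    (𝒰.map ι) (by simp)
  obtain ⟨x, rfl⟩ := WithTopology.toTopology_surjective _ y
  have key : ∀ s : Set X, IsOpen[constructibleTopology X] s → x ∈ s → s ∈ 𝒰 := by
    intro s hs hx
    have e : ι ⁻¹' (ι '' s) = s :=
      Set.preimage_image_eq s (WithTopology.toTopology_injective _)
    have : ι '' s ∈ 𝒰.map ι :=
      hy ((WithConstructibleTopology.isOpen_iff.2 (by rwa [← e] at hs)).mem_nhds ⟨x, hx, rfl⟩)
    rwa [Ultrafilter.mem_map, e] at this
  -- Both `U` and its complement are open in the constructible topology, so convergence decides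
  -- membership in either direction.
  refine ⟨x, fun U => ⟨fun h => ?_, fun h => ?_⟩⟩
  · exact key _ (U.isCompact.isOpen_constructibleTopology_of_isOpen U.isOpen) h
  · by_contra h'
    have : ((U : Set X)ᶜ) ∈ 𝒰 := key _ (IsCompact.isOpen_constructibleTopology_of_isClosed
      (by simpa using U.isCompact) U.isOpen.isClosed_compl) h'
    exact Ultrafilter.compl_notMem_iff.2 h this

namespace TypeSpaceFunctor

open CohTheory

/-! ### The completeness theorem -/

/-- Henkin constants. -/
inductive Witness (F : TypeSpaceFunctor.{u}) (n : ℕ) : Type u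
  | base (i : Fin n) : Witness F n
  | wit {m : ℕ} (a : Fin m → Witness F n) (U : CompactOpens (F.obj (m + 1))) : Witness F n

namespace Witness

variable {F : TypeSpaceFunctor.{u}} {n : ℕ}

/-- The nesting depth of a Henkin constant. -/
def depth : Witness F n → ℕ
  | base _ => 0
  | wit a _ => (Finset.univ.sup fun i => depth (a i)) + 1

theorem depth_lt {m : ℕ} (a : Fin m → Witness F n) (U : CompactOpens (F.obj (m + 1)))
    (i : Fin m) : (a i).depth < (wit a U).depth := by
  rw [depth.eq_2]
  exact Nat.lt_succ_of_le (Finset.le_sup (f := fun i => (a i).depth) (Finset.mem_univ i))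

/-- Finitely many Henkin constants can be interpreted by the variables of a type. -/
theorem exists_stage (p : F.obj (n + 1)) (S : Finset (Witness F (n + 1))) :
    ∃ (s : ℕ) (g : Witness F (n + 1) → Fin s) (q : F.obj s), F.map (g ∘ base) q = p ∧
      ∀ {m : ℕ} (a : Fin m → Witness F (n + 1)) (U : CompactOpens (F.obj (m + 1))),
        wit a U ∈ S → (∀ i, a i ∈ S) → F.map (g ∘ a) q ∈ F.image Fin.castSucc U →
          F.map (Fin.snoc (g ∘ a) (g (wit a U)) : Fin (m + 1) → Fin s) q ∈ U := by
  classical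
  -- Constants are added in order of nondecreasing depth, so a new one is never an argument of
  -- itself or of one already treated.
  refine Finset.induction_on_max_value depth S ?_ fun x S hx hS ih => ?_
  · refine ⟨n + 1, fun w => match w with
      | base i => i
      | wit _ _ => 0, p, ?_, fun a U h => by simp at h⟩
    exact F.map_id_apply p
  · obtain ⟨s, g, q, hp, hq⟩ := ih
    have mem : ∀ {m : ℕ} (a : Fin m → Witness F (n + 1)) (U : CompactOpens (F.obj (m + 1))),
        wit a U ∈ insert x S → ∀ i, a i ∈ insert x S → a i ∈ S := by
      intro m a U h i hi
      refine (Finset.mem_insert.1 hi).resolve_left ?_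
      rintro rfl
      have := depth_lt a U i
      rcases Finset.mem_insert.1 h with h | h
      · rw [h] at this
        exact this.false
      · exact (this.trans_le (hS _ h)).false
    -- A fresh variable is introduced only if the current type of the arguments admits the requested
    -- witness. Otherwise `x` imposes no condition at this stage.
    by_cases H : ∃ (m : ℕ) (a : Fin m → Witness F (n + 1)) (U : CompactOpens (F.obj (m + 1))),
        x = wit a U ∧ (∀ i, a i ∈ S) ∧ F.map (g ∘ a) q ∈ F.image Fin.castSucc U
    · obtain ⟨m, a, U, rfl, ha, h⟩ := H
      obtain ⟨r, rfl, hr⟩ := exists_extension (g ∘ a) h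
      let g' : Witness F (n + 1) → Fin (s + 1) :=
        Function.update (fun w => (g w).castSucc) (wit a U) (Fin.last s)
      have hg : ∀ w, w ∈ S → g' w = (g w).castSucc := by
        intro w hw
        refine Function.update_of_ne ?_ _ _
        rintro rfl
        exact hx hw
      have hg' : ∀ {k : ℕ} (b : Fin k → Witness F (n + 1)), (∀ i, b i ∈ S) →
          F.map (g' ∘ b) r = F.map (g ∘ b) (F.map Fin.castSucc r) := by
        intro k b hb
        rw [F.map_map]
        congr 2
        funext i
        exact hg _ (hb i)
      refine ⟨s + 1, g', r, ?_, ?_⟩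
      · rw [← hp, F.map_map]
        congr 2
        funext i
        have : base i ≠ wit a U := fun h => by cases h
        exact Function.update_of_ne this (Fin.last s) fun w => (g w).castSucc
      · intro k b V hb hbS hV
        replace hbS := fun i => mem b V hb i (hbS i)
        rw [hg' b hbS] at hV
        rcases Finset.mem_insert.1 hb with h | h
        · cases h
          convert hr using 3
          funext i
          refine Fin.lastCases ?_ (fun i => ?_) i
          · simp [g']
          · simp [hg _ (hbS i)]
        · have := hq b V h hbS hV
          rw [F.map_map] at this
          convert this using 3
          funext i
          refine Fin.lastCases ?_ (fun i => ?_) i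
          · simp [hg _ h]
          · simp [hg _ (hbS i)]
    · refine ⟨s, g, q, hp, fun {m} a U hU ha h => ?_⟩
      replace ha := fun i => mem a U hU i (ha i)
      refine hq a U ((Finset.mem_insert.1 hU).resolve_left fun e => ?_) ha h
      exact H ⟨m, a, U, e.symm, ha, h⟩

end Witness

variable {F : TypeSpaceFunctor.{u}}

/-- A coherent assignment of types to the tuples of elements of a set, such that types that have
extensions are realised. -/
structure TypeAssignment (F : TypeSpaceFunctor.{u}) where
  carrier : Type u
  tp : ∀ {m : ℕ}, (Fin m → carrier) → F.obj m
  natural : ∀ {n m : ℕ} (f : Fin n → Fin m) (w : Fin m → carrier), F.map f (tp w) = tp (w ∘ f)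
  henkin : ∀ {m : ℕ} (w : Fin m → carrier) (U : CompactOpens (F.obj (m + 1))),
    tp w ∈ F.image Fin.castSucc U → ∃ b, tp (Fin.snoc w b : Fin (m + 1) → carrier) ∈ U

/-- An ultrafilter on finite sets of constants that refines `atTop` glues the finite stages: the
type of a tuple is the limit of its types at the stages. Such limits decide every compact open set
by what happens eventually, so naturality, the Henkin property and the prescribed type `p` all pass
to the limit. -/
theorem exists_typeAssignment_succ {n : ℕ} (p : F.obj (n + 1)) :
    ∃ (X : TypeAssignment F) (b : Fin (n + 1) → X.carrier), X.tp b = p := by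
  classical
  choose s g q hp hq using Witness.exists_stage p
  let 𝒰 : Ultrafilter (Finset (Witness F (n + 1))) := Ultrafilter.of Filter.atTop
  have h𝒰 : ∀ S, ∀ᶠ S' in (𝒰 : Filter (Finset (Witness F (n + 1)))), S ≤ S' := fun S =>
    Ultrafilter.of_le _ (Filter.eventually_ge_atTop S)
  choose tp htp using fun (m : ℕ) (w : Fin m → Witness F (n + 1)) =>
    exists_ultrafilter_limit (𝒰.map fun S => F.map (g S ∘ w) (q S))
  replace htp : ∀ {m : ℕ} (w : Fin m → Witness F (n + 1)) (U : CompactOpens (F.obj m)),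
      tp m w ∈ U ↔ ∀ᶠ S in (𝒰 : Filter (Finset (Witness F (n + 1)))), F.map (g S ∘ w) (q S) ∈ U := fun w U => htp _ w U
  refine ⟨⟨Witness F (n + 1), fun w => tp _ w, fun {k m} f w => ?_, fun {m} w U h => ?_⟩,
    Witness.base, ?_⟩
  · refine eq_of_forall_mem fun U => ?_
    rw [← mem_preimage, htp, htp]
    simp only [mem_preimage, F.map_map]
    exact Iff.rfl
  · refine ⟨Witness.wit w U, (htp _ _).2 ?_⟩
    filter_upwards [(htp _ _).1 h, h𝒰 (insert (Witness.wit w U) (Finset.univ.image w))]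
      with S hS hS'
    convert hq S w U (hS' (Finset.mem_insert_self _ _))
      (fun i => hS' (Finset.mem_insert_of_mem (Finset.mem_image_of_mem w (Finset.mem_univ i)))) hS
      using 3
    funext i
    refine Fin.lastCases ?_ (fun i => ?_) i <;> simp
  · refine eq_of_forall_mem fun U => ?_
    rw [htp]
    simp only [hp]
    exact Filter.eventually_const

theorem exists_typeAssignment {n : ℕ} (p : F.obj n) :
    ∃ (X : TypeAssignment F) (b : Fin n → X.carrier), X.tp b = p := by
  obtain _ | n := n
  · by_cases H : ∃ r, F.map (Fin.castSucc : Fin 0 → Fin 1) r = p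
    · obtain ⟨r, rfl⟩ := H
      obtain ⟨X, b, rfl⟩ := exists_typeAssignment_succ r
      exact ⟨X, b ∘ Fin.castSucc, (X.natural _ _).symm⟩
    -- A type in no variables that does not extend to one variable is realised by the empty
    -- structure, where the Henkin condition is vacuous.
    · let tp : ∀ {m : ℕ}, (Fin m → PEmpty.{u + 1}) → F.obj m := fun {m} w =>
        match m, w with
        | 0, _ => p
        | _ + 1, w => (w 0).elim
      refine ⟨⟨PEmpty, tp, fun {n m} f w => ?_, fun {m} w U h => ?_⟩, Fin.elim0, rfl⟩
      · obtain _ | m := m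
        · obtain _ | n := n
          · rw [Subsingleton.elim f id]
            exact F.map_id_apply p
          · exact (f 0).elim0
        · exact (w 0).elim
      · obtain _ | m := m
        · obtain ⟨r, -, hr⟩ := h
          exact (H ⟨r, hr⟩).elim
        · exact (w 0).elim
  · exact exists_typeAssignment_succ p

namespace TypeAssignment

variable (X : TypeAssignment F)

theorem diag_self (x : X.carrier) : X.tp ![x, x] ∈ F.diag := by
  have : ![x, x] = (fun _ : Fin 1 => x) ∘ ![0, 0] := 
    (comp_pair (fun _ : Fin 1 => x) 0 0).symm
  rw [this, ← X.natural]
  exact mem_diag_self 0 _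

theorem tp_congr {n : ℕ} {a b : Fin n → X.carrier} (h : ∀ i, X.tp ![a i, b i] ∈ F.diag) :
    X.tp a = X.tp b := by
  have := map_eq_map (F := F) (s := Fin.castAdd n) (t := Fin.natAdd n)
    (q := X.tp (Fin.append a b)) fun i => by
      rw [X.natural, comp_pair, Fin.append_left, Fin.append_right]
      exact h i
  rwa [X.natural, X.natural, append_comp_castAdd, append_comp_natAdd] at this

/-- Elements are identified when their type says that they are equal. -/
def setoid : Setoid X.carrier where
  r x y := X.tp ![x, y] ∈ F.diag
  iseqv := by
    refine ⟨X.diag_self, fun {x y} h => ?_, fun {x y z} h h' => ?_⟩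
    · rw [X.tp_congr (a := ![y, x]) (b := ![y, y]) (Fin.forall_fin_two.2 ⟨X.diag_self y, h⟩)]
      exact X.diag_self y
    · rw [X.tp_congr (a := ![x, z]) (b := ![y, z]) (Fin.forall_fin_two.2 ⟨h, X.diag_self z⟩)]
      exact h'

/-- The structure is the quotient by the equalities recorded in the types, and `tp_congr` makes its
relations independent of representatives. Truth agrees with membership of the type in the value by
induction; the Henkin condition supplies witnesses for the quantifier. Inclusions of values
therefore hold as axioms. -/
theorem exists_model : ∃ (M : F.Th.Model) (π : X.carrier → M),
    ∀ {n : ℕ} (U : CompactOpens (F.obj n)) (w : Fin n → X.carrier),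
      (cl U).Realize M (π ∘ w) ↔ X.tp w ∈ U := by
  let M := Quotient X.setoid
  let str : F.Th.lang.Structure M :=
    { funMap := fun f => Empty.elim f
      RelMap := fun {n} (U : CompactOpens (F.obj n)) c => X.tp (fun i => (c i).out) ∈ U }
  let π : X.carrier → M := Quotient.mk X.setoid
  have hrel : ∀ {n : ℕ} (U : CompactOpens (F.obj n)) (w : Fin n → X.carrier),
      str.RelMap U (π ∘ w) ↔ X.tp w ∈ U := by
    intro n U w
    change X.tp (fun i => (π (w i)).out) ∈ U ↔ _
    rw [X.tp_congr (b := w) fun i => Quotient.mk_out (s := X.setoid) (w i)]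
  have key : ∀ {n : ℕ} (φ : CohFormula F.lang n) (w : Fin n → X.carrier),
      CohFormula.Realize (L := F.Th.lang) φ (π ∘ w) ↔ X.tp w ∈ F.interp φ := by
    intro n φ
    induction φ with
    | top => exact fun w => ⟨fun _ => mem_top, fun _ => trivial⟩
    | bot => exact fun w => Iff.rfl
    | eq i j =>
      intro w
      rw [interp_eq, mem_preimage, X.natural, comp_pair]
      exact Quotient.eq
    | rel U x =>
      intro w
      rw [interp, mem_preimage, X.natural]
      exact hrel U (w ∘ x)
    | and φ ψ ih₁ ih₂ => exact fun w => and_congr (ih₁ w) (ih₂ w)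
    | or φ ψ ih₁ ih₂ => exact fun w => or_congr (ih₁ w) (ih₂ w)
    | @ex n φ ih =>
      intro w
      have snoc : ∀ b, (Fin.snoc (π ∘ w) (π b) : Fin (n + 1) → M) =
          π ∘ (Fin.snoc w b : Fin (n + 1) → X.carrier) := fun b => (Fin.comp_snoc π w b).symm
      constructor
      · rintro ⟨c, hc⟩
        obtain ⟨b, rfl⟩ := Quotient.exists_rep c
        erw [snoc b] at hc
        refine ⟨_, (ih _).1 hc, ?_⟩
        rw [X.natural]
        congr 1
        funext i
        simp
      · intro h
        obtain ⟨b, hb⟩ := X.henkin w _ h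
        refine ⟨π b, ?_⟩
        erw [snoc b]
        exact (ih _).2 hb
  refine ⟨@Model.mk F.Th M str fun s hs c hc => ?_, π, fun U w => hrel U w⟩
  obtain ⟨w, rfl⟩ : ∃ w, c = π ∘ w := ⟨fun i => (c i).out, funext fun i => ((c i).out_eq).symm⟩
  exact (key s.concl w).2 (hs ((key s.prem w).1 hc))

end TypeAssignment

/-- Each point `p` is the type of a tuple in some model of `Th F`, so an entailment evaluated at
that tuple decides membership of `p`. -/
theorem cl_le_cl_iff {n : ℕ} {U V : CompactOpens (F.obj n)} : cl U ≤ cl V ↔ U ≤ V := by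
  refine ⟨fun h p hp => ?_, cl_mono⟩
  obtain ⟨X, b, rfl⟩ := exists_typeAssignment p
  obtain ⟨M, π, H⟩ := X.exists_model
  exact (H V b).1 (Lind.le_iff.1 h M _ ((H U b).2 hp))

theorem cl_injective {n : ℕ} {U V : CompactOpens (F.obj n)} (h : cl U = cl V) : U = V :=
  le_antisymm (cl_le_cl_iff.1 h.le) (cl_le_cl_iff.1 h.ge)

/-- The completeness theorem: the inclusions in the internal logic are the consequences of the theory. -/
theorem mkTh_le_iff {n : ℕ} {φ ψ : CohFormula F.lang n} :
    mkTh φ ≤ mkTh ψ ↔ F.interp φ ≤ F.interp ψ := by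
  rw [mkTh_eq_cl, mkTh_eq_cl, cl_le_cl_iff]

end TypeSpaceFunctor

end PosLogic

/-! ### Composition of partial natural transformations. -/

namespace PosLogic

section Tuples

variable {n m : ℕ}

theorem times_apply (f : Fin n → Fin m) {k : ℕ} (i : Fin n) (j : Fin k) :
    times f k (finProdFinEquiv (i, j)) = finProdFinEquiv (f i, j) :=
  concat_apply _ i j

theorem times_cast (f : Fin n → Fin m) (l k : ℕ) :
    times f (l * k) ∘ Fin.cast (Nat.mul_assoc n l k) =
      Fin.cast (Nat.mul_assoc m l k) ∘ times (times f l) k := by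
  funext p
  obtain ⟨⟨q, j⟩, rfl⟩ := finProdFinEquiv.surjective p
  obtain ⟨⟨i, i'⟩, rfl⟩ := finProdFinEquiv.surjective q
  have e : ∀ {s : ℕ} (i : Fin s),
      Fin.cast (Nat.mul_assoc s l k) (finProdFinEquiv (finProdFinEquiv (i, i'), j)) =
        finProdFinEquiv (i, finProdFinEquiv (i', j)) := by
    intro s i
    ext
    simp [finProdFinEquiv]
    ring
  simp only [Function.comp_apply, e, times, concat_apply]

/-- The identification of `n` variables with `n` blocks of length one. -/
def single (n : ℕ) : Fin n → Fin (n * 1) := fun i => finProdFinEquiv (i, (0 : Fin 1))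

/-- The inverse of `single`. -/
def unsingle (n : ℕ) : Fin (n * 1) → Fin n := fun p => (finProdFinEquiv.symm p).1

theorem unsingle_comp_single (n : ℕ) : unsingle n ∘ single n = id := by
  funext i
  exact congrArg Prod.fst (finProdFinEquiv.symm_apply_apply (i, (0 : Fin 1)))

theorem single_comp_unsingle (n : ℕ) : single n ∘ unsingle n = id := by
  funext p
  obtain ⟨⟨i, j⟩, rfl⟩ := finProdFinEquiv.surjective p
  rw [Subsingleton.elim j 0]
  exact congrArg (single n) (congrFun (unsingle_comp_single n) i)

theorem times_one (f : Fin n → Fin m) : times f 1 ∘ single n = single m ∘ f := by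
  funext i
  simp [times, single]

end Tuples

namespace TypeSpaceFunctor

/-- A partial map is spectral if the preimages of compact open sets are compact open. -/
theorem isPartialSpectral_of_preimage {X Y : Type u} [TopologicalSpace X] [TopologicalSpace Y]
    [SpectralSpace Y] {f : X →. Y}
    (h : ∀ V : CompactOpens Y, ∃ U : CompactOpens X, f.preimage V = U) : IsPartialSpectral f := by
  have hd : ∃ U : CompactOpens X, f.Dom = U := by
    obtain ⟨U, hU⟩ := h ⊤
    exact ⟨U, (PFun.preimage_univ f).symm.trans hU⟩
  have e : ∀ V : Set Y, f.asSubtype ⁻¹' V = Subtype.val ⁻¹' f.preimage V := by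
    intro V
    rw [preimage_eq_image, Set.preimage_image_eq _ Subtype.val_injective]
  obtain ⟨D, hD⟩ := hd
  refine ⟨hD ▸ D.isOpen, hD ▸ D.isCompact,
    { toContinuous := ?_, isCompact_preimage_of_isOpen := fun V hV hV' => ?_ }⟩
  · refine (PrespectralSpace.isTopologicalBasis (X := Y)).continuous_iff.2 fun V hV => ?_
    obtain ⟨U, hU⟩ := h ⟨⟨V, hV.2⟩, hV.1⟩
    rw [e]
    exact (show IsOpen (f.preimage V) from hU ▸ U.isOpen).preimage continuous_subtype_val
  · obtain ⟨U, hU⟩ := h ⟨⟨V, hV'⟩, hV⟩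
    rw [Subtype.isCompact_iff, ← preimage_eq_image]
    exact (show f.preimage V = U from hU) ▸ U.isCompact

variable {F F' F'' F₃ : TypeSpaceFunctor.{u}}

namespace PreTrans

/-- The weak Beck-Chevalley condition, in terms of points. -/
theorem weakBeckChevalley_of_points {β : PreTrans F F'} (hβ : β.IsPartialNatTrans)
    (h : ∀ {n m : ℕ} (f : Fin n → Fin m) (V : CompactOpens (F'.obj m))
      (p : F.obj (n * β.arity)) (q : F'.obj n), q ∈ β.app n p → q ∈ F'.image f V →
      (n = 0 ∨ p ∈ Set.range (F.map (times f β.arity))) →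
      ∃ s, F.map (times f β.arity) s = p ∧ ∃ v ∈ V, v ∈ β.app m s) :
    β.WeakBeckChevalley := by
  -- This inclusion is a consequence of naturality; the hypothesis on points is needed for the
  -- opposite one only.
  have sub : ∀ {n m : ℕ} (f : Fin n → Fin m) (V : CompactOpens (F'.obj m)),
      F.map (times f β.arity) '' (β.app m).preimage V ⊆
        (β.app n).preimage (F'.map f '' (V : Set (F'.obj m))) := by
    rintro n m f V _ ⟨s, ⟨v, hv, hs⟩, rfl⟩
    exact ⟨_, ⟨v, hv, rfl⟩, hβ.natural f s v hs⟩
  have sup : ∀ {n m : ℕ} (f : Fin n → Fin m) (V : CompactOpens (F'.obj m))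
      (p : F.obj (n * β.arity)), p ∈ (β.app n).preimage (F'.map f '' (V : Set (F'.obj m))) →
      (n = 0 ∨ p ∈ Set.range (F.map (times f β.arity))) →
      p ∈ F.map (times f β.arity) '' (β.app m).preimage V := by
    rintro n m f V p ⟨q, hV, hq⟩ hp
    obtain ⟨s, hs, v, hv, hv'⟩ := h f V p q hq hV hp
    exact ⟨s, ⟨v, hv, hv'⟩, hs⟩
  refine fun {n m} f V => ⟨Set.Subset.antisymm ?_ ?_, fun hn => Set.Subset.antisymm ?_ ?_⟩
  · exact fun p hp => sup f V p hp.1 (Or.inr hp.2)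
  · exact Set.subset_inter (sub f V) (Set.image_subset_range _ _)
  · exact fun p hp => sup f V p hp (Or.inl hn)
  · exact sub f V

theorem dom_iff {β : PreTrans F F'} (hβ : β.IsPartialNatTrans) {n : ℕ}
    (p : F.obj (n * β.arity)) : (∃ q, q ∈ β.app n p) ↔
      ∀ i, ∃ q, q ∈ β.app 1 (F.map (times (fun _ : Fin 1 => i) β.arity) p) := by
  have := Set.ext_iff.1 (hβ.cartesian n) p
  simpa [Part.dom_iff_mem, PFun.mem_dom] using this

theorem cartesian_of_dom_iff {β : PreTrans F F'} {n : ℕ}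
    (h : ∀ p : F.obj (n * β.arity), (∃ q, q ∈ β.app n p) ↔
      ∀ i, ∃ q, q ∈ β.app 1 (F.map (times (fun _ : Fin 1 => i) β.arity) p)) :
    (β.app n).Dom = ⋂ i : Fin n, F.map (times (fun _ : Fin 1 => i) β.arity) ⁻¹' (β.app 1).Dom := by
  ext p
  simpa [Part.dom_iff_mem, PFun.mem_dom] using h p

theorem eq_of_app {β β' : PreTrans F F'} (e : β.arity = β'.arity)
    (h : ∀ (n : ℕ) (p : F.obj (n * β.arity)) (q : F'.obj n), q ∈ β.app n p ↔
      q ∈ β'.app n (F.map (Fin.cast (congrArg (n * ·) e.symm)) p)) : β = β' := by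
  obtain ⟨k, hk, a⟩ := β
  obtain ⟨k', hk', a'⟩ := β'
  obtain rfl : k = k' := e
  congr 1
  funext n p
  refine Part.ext fun q => (h n p q).trans ?_
  have : F.map (Fin.cast (congrArg (n * ·) (Eq.refl k).symm)) p = p := F.map_id_apply p
  exact Eq.to_iff (congrArg (fun p => q ∈ a' n p) this)

end PreTrans

namespace Trans

theorem ext_pre {β β' : Trans F F'} (h : β.toPreTrans = β'.toPreTrans) : β = β' := by
  cases β
  cases β'
  cases h
  rfl

theorem weakBeckChevalley_points (β : Trans F F') {n m : ℕ} (f : Fin n → Fin m)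
    (V : CompactOpens (F'.obj m)) {p : F.obj (n * β.arity)} {q : F'.obj n}
    (hq : q ∈ β.app n p) (hV : q ∈ F'.image f V)
    (hp : n = 0 ∨ p ∈ Set.range (F.map (times f β.arity))) :
    ∃ s, F.map (times f β.arity) s = p ∧ ∃ v ∈ V, v ∈ β.app m s := by
  obtain ⟨h₁, h₂⟩ := β.isCell.weakBeckChevalley f V
  have hmem : p ∈ (β.app n).preimage (F'.map f '' (V : Set (F'.obj m))) := ⟨q, hV, hq⟩
  have : p ∈ F.map (times f β.arity) '' (β.app m).preimage V := by
    rcases hp with hp | hp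
    · exact h₂ hp ▸ hmem
    · exact h₁ ▸ ⟨hmem, hp⟩
  obtain ⟨s, ⟨v, hv, hs⟩, rfl⟩ := this
  exact ⟨s, rfl, v, hv, hs⟩

/-- Naturality with respect to bijections. -/
theorem mem_app_map_iff (β : Trans F F') {n m : ℕ} {f : Fin n → Fin m} {g : Fin m → Fin n}
    (hfg : f ∘ g = id) (hgf : g ∘ f = id) (p : F.obj (m * β.arity)) (q : F'.obj n) :
    q ∈ β.app n (F.map (times f β.arity) p) ↔ ∃ r ∈ β.app m p, F'.map f r = q := by
  constructor
  · intro h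
    refine ⟨F'.map g q, ?_, ?_⟩
    · have := β.isCell.natural g _ _ h
      rwa [F.map_map, times_comp, hfg, times_id, F.map_id_apply] at this
    · rw [F'.map_map, hgf, F'.map_id_apply]
  · rintro ⟨r, hr, rfl⟩
    exact β.isCell.natural f p r hr

theorem mem_preComp {β : Trans F F'} {γ : Trans F' F''} {n : ℕ}
    {p : F.obj (n * (γ.arity * β.arity))} {q : F''.obj n} :
    q ∈ (preComp β γ).app n p ↔
      ∃ r ∈ β.app (n * γ.arity) (F.map (Fin.cast (Nat.mul_assoc n γ.arity β.arity)) p),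
        q ∈ γ.app n r :=
  Part.mem_bind_iff

/-- The right-hand side is visibly compact open, which yields spectrality of the composite. The same
formula identifies the interpretation attached to a composite. -/
theorem preComp_preimage (β : Trans F F') (γ : Trans F' F'') {n : ℕ}
    (V : CompactOpens (F''.obj n)) : ((preComp β γ).app n).preimage V =
      (SetLike.coe (F.preimage (Fin.cast (Nat.mul_assoc n γ.arity β.arity)) (β.pre (γ.pre V))) :
        Set (F.obj (n * (γ.arity * β.arity)))) := by
  ext p
  constructor
  · rintro ⟨q, hV, hq⟩
    obtain ⟨r, hr, hq⟩ := mem_preComp.1 hq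
    exact ⟨r, ⟨q, hV, hq⟩, hr⟩
  · rintro ⟨r, ⟨q, hV, hq⟩, hr⟩
    exact ⟨q, hV, mem_preComp.2 ⟨r, hr, hq⟩⟩

theorem map_times_cast (F : TypeSpaceFunctor.{u}) {n m : ℕ} (f : Fin n → Fin m) (l k : ℕ)
    (p : F.obj (m * (l * k))) :
    F.map (Fin.cast (Nat.mul_assoc n l k)) (F.map (times f (l * k)) p) =
      F.map (times (times f l) k) (F.map (Fin.cast (Nat.mul_assoc m l k)) p) := by
  rw [F.map_map, F.map_map, times_cast]

theorem preComp_natural (β : Trans F F') (γ : Trans F' F'') {n m : ℕ} (f : Fin n → Fin m)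
    (p : F.obj (m * (γ.arity * β.arity))) (q : F''.obj m) (h : q ∈ (preComp β γ).app m p) :
    F''.map f q ∈ (preComp β γ).app n (F.map (times f (γ.arity * β.arity)) p) := by
  obtain ⟨r, hr, hq⟩ := mem_preComp.1 h
  refine mem_preComp.2 ⟨F'.map (times f γ.arity) r, ?_, γ.isCell.natural f r q hq⟩
  rw [map_times_cast]
  exact β.isCell.natural (times f γ.arity) _ _ hr

/-- The domain of `β` can be tested on each pair of indices separately, hence inside the block
determined by the first index. Once `β` is defined at `p`, naturality identifies its value on a
block with the block of its value, so the domain of `γ` can be tested blockwise as well. -/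
theorem preComp_dom_iff (β : Trans F F') (γ : Trans F' F'') {n : ℕ}
    (p : F.obj (n * (γ.arity * β.arity))) :
    (∃ q, q ∈ (preComp β γ).app n p) ↔ ∀ i, ∃ q, q ∈ (preComp β γ).app 1
      (F.map (times (fun _ : Fin 1 => i) (γ.arity * β.arity)) p) := by
  simp only [mem_preComp, map_times_cast]
  constructor
  · rintro ⟨q, r, hr, hq⟩ i
    obtain ⟨q', hq'⟩ := (PreTrans.dom_iff γ.isCell.toIsPartialNatTrans r).1 ⟨q, hq⟩ i
    exact ⟨q', _, β.isCell.natural _ _ _ hr, hq'⟩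
  · intro h
    obtain ⟨r, hr⟩ : ∃ r, r ∈ β.app (n * γ.arity)
        (F.map (Fin.cast (Nat.mul_assoc n γ.arity β.arity)) p) := by
      rw [PreTrans.dom_iff β.isCell.toIsPartialNatTrans]
      intro j
      obtain ⟨⟨i, i'⟩, rfl⟩ := finProdFinEquiv.surjective j
      obtain ⟨q, r, hr, -⟩ := h i
      -- Within the single block extracted for `i`, the index `(i, i')` becomes `(0, i')`.
      obtain ⟨t, ht⟩ := (PreTrans.dom_iff β.isCell.toIsPartialNatTrans _).1 ⟨r, hr⟩
        (finProdFinEquiv (0, i'))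
      rw [F.map_map, times_comp] at ht
      refine ⟨t, ?_⟩
      convert ht using 4
      funext _
      simp [times]
    have hγ : ∃ q, q ∈ γ.app n r := by
      rw [PreTrans.dom_iff γ.isCell.toIsPartialNatTrans]
      intro i
      obtain ⟨q, r', hr', hq⟩ := h i
      rw [Part.mem_unique hr' (β.isCell.natural _ _ _ hr)] at hq
      exact ⟨q, hq⟩
    obtain ⟨q, hq⟩ := hγ
    exact ⟨q, r, hr, hq⟩

theorem preComp_isPartialNatTrans (β : Trans F F') (γ : Trans F' F'') :
    (preComp β γ).IsPartialNatTrans where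
  isPartialSpectral _ := isPartialSpectral_of_preimage fun V => ⟨_, preComp_preimage β γ V⟩
  cartesian _ := PreTrans.cartesian_of_dom_iff (preComp_dom_iff β γ)
  natural f p q h := preComp_natural β γ f p q h

theorem map_cast_cast (F : TypeSpaceFunctor.{u}) {a b : ℕ} (h : a = b) (h' : b = a)
    (p : F.obj a) : F.map (Fin.cast h) (F.map (Fin.cast h') p) = p := by
  subst h
  rw [F.map_map]
  exact F.map_id_apply p

/-- The condition is used for `γ` with `V` and then for `β` with `γ⁻¹(V)`. The delicate point is
that the intermediate value `r` must lie in the range of the map induced by `f` when `p` does. -/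
theorem preComp_weakBeckChevalley_points (β : Trans F F') (γ : Trans F' F'') {n m : ℕ}
    (f : Fin n → Fin m) (V : CompactOpens (F''.obj m)) (p : F.obj (n * (γ.arity * β.arity)))
    (q : F''.obj n) (hq : q ∈ (preComp β γ).app n p) (hV : q ∈ F''.image f V)
    (hp : n = 0 ∨ p ∈ Set.range (F.map (times f (γ.arity * β.arity)))) :
    ∃ s, F.map (times f (γ.arity * β.arity)) s = p ∧ ∃ v ∈ V, v ∈ (preComp β γ).app m s := by
  obtain ⟨r, hr, hq⟩ := mem_preComp.1 hq
  have hrange : n * γ.arity = 0 ∨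
      F.map (Fin.cast (Nat.mul_assoc n γ.arity β.arity)) p ∈
        Set.range (F.map (times (times f γ.arity) β.arity)) := by
    rcases hp with rfl | ⟨s, rfl⟩
    · exact Or.inl (Nat.zero_mul _)
    · exact Or.inr ⟨_, (map_times_cast F f γ.arity β.arity s).symm⟩
  have hr' : n = 0 ∨ r ∈ Set.range (F'.map (times f γ.arity)) := by
    rcases hp with hn | ⟨s, rfl⟩
    · exact Or.inl hn
    obtain _ | n := n
    · exact Or.inl rfl
    refine Or.inr ?_
    -- The nonempty source allows a `g` with `f ∘ g ∘ f = f`. Then `g ∘ f` fixes points in the range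
    -- of the map induced by `f`; by naturality it fixes `r`, which is therefore in the range.
    let g : Fin m → Fin (n + 1) := Function.invFun f
    have hg : f ∘ g ∘ f = f := funext fun x => Function.invFun_eq ⟨x, rfl⟩
    have h := β.isCell.natural (times (g ∘ f) γ.arity) _ _ hr
    rw [← map_times_cast, F.map_map (times (g ∘ f) _), times_comp, hg] at h
    refine ⟨F'.map (times g γ.arity) r, ?_⟩
    rw [F'.map_map, times_comp]
    exact Part.mem_unique h hr
  obtain ⟨t, ⟨v, hv, ht⟩, rfl⟩ :
      ∃ t, (∃ v ∈ V, v ∈ γ.app m t) ∧ F'.map (times f γ.arity) t = r := by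
    obtain ⟨t, h, ht⟩ := γ.weakBeckChevalley_points f V hq hV hr'
    exact ⟨t, ht, h⟩
  -- The new intermediate point `w` may differ from `t`; only its membership in `γ⁻¹(V)` is needed.
  obtain ⟨s, hs, w, ⟨v', hv', hwv⟩, hw⟩ := β.weakBeckChevalley_points (times f γ.arity) (γ.pre V)
    hr ⟨t, ⟨v, hv, ht⟩, rfl⟩ hrange
  have assoc := Nat.mul_assoc m γ.arity β.arity
  refine ⟨F.map (Fin.cast assoc.symm) s, ?_, v', hv', mem_preComp.2 ⟨w, ?_, hwv⟩⟩
  · have := map_times_cast F f γ.arity β.arity (F.map (Fin.cast assoc.symm) s)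
    rw [map_cast_cast, hs] at this
    have h' := congrArg (F.map (Fin.cast (Nat.mul_assoc n γ.arity β.arity).symm)) this
    rwa [map_cast_cast, map_cast_cast] at h'
  · rwa [map_cast_cast]

theorem preComp_isCell (β : Trans F F') (γ : Trans F' F'') : (preComp β γ).IsCell where
  toIsPartialNatTrans := preComp_isPartialNatTrans β γ
  weakBeckChevalley := PreTrans.weakBeckChevalley_of_points (preComp_isPartialNatTrans β γ)
    (preComp_weakBeckChevalley_points β γ)

end Trans

/-! ### Natural transformations as partial ones of arity one. -/

namespace BCNatTrans

variable (β : BCNatTrans F F')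

theorem mem_toPreTrans {n : ℕ} {p : F.obj (n * 1)} {q : F'.obj n} :
    q ∈ β.toPreTrans.app n p ↔ q = β.app n (F.map (single n) p) :=
  Part.mem_some_iff

/-- The preimage of a compact open set under a natural transformation. -/
def pre {n : ℕ} (V : CompactOpens (F'.obj n)) : CompactOpens (F.obj n) :=
  ⟨⟨β.app n ⁻¹' V, V.isCompact.preimage_of_isOpen (β.app n).spectral' V.isOpen⟩,
    V.isOpen.preimage (β.app n).spectral'.continuous⟩

theorem toPreTrans_preimage {n : ℕ} (V : CompactOpens (F'.obj n)) :
    (β.toPreTrans.app n).preimage V =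
      (SetLike.coe (F.preimage (single n) (β.pre V)) : Set (F.obj (n * 1))) := by
  ext p
  constructor
  · rintro ⟨q, hV, hq⟩
    obtain rfl := β.mem_toPreTrans.1 hq
    exact hV
  · exact fun h => ⟨_, h, β.mem_toPreTrans.2 rfl⟩

theorem toPreTrans_natural {n m : ℕ} (f : Fin n → Fin m) (p : F.obj (m * 1)) (q : F'.obj m)
    (h : q ∈ β.toPreTrans.app m p) :
    F'.map f q ∈ β.toPreTrans.app n (F.map (times f 1) p) := by
  obtain rfl := β.mem_toPreTrans.1 h
  rw [mem_toPreTrans, β.natural, F.map_map, F.map_map, times_one]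

theorem toPreTrans_isPartialNatTrans : β.toPreTrans.IsPartialNatTrans where
  isPartialSpectral _ :=
    isPartialSpectral_of_preimage fun V => ⟨_, β.toPreTrans_preimage V⟩
  cartesian _ := PreTrans.cartesian_of_dom_iff fun _ =>
    ⟨fun _ _ => ⟨_, β.mem_toPreTrans.2 rfl⟩, fun _ => ⟨_, β.mem_toPreTrans.2 rfl⟩⟩
  natural := β.toPreTrans_natural

/-- The full Beck–Chevalley condition gives the required point without any range hypothesis; the
bijection between `n` and `n * 1` carries it to the partial form. -/
theorem isCell : β.toPreTrans.IsCell := by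
  refine ⟨β.toPreTrans_isPartialNatTrans, PreTrans.weakBeckChevalley_of_points
    β.toPreTrans_isPartialNatTrans fun {n m} f V p q hq hV _ => ?_⟩
  change F.obj (n * 1) at p
  obtain rfl := β.mem_toPreTrans.1 hq
  obtain ⟨v, hv, hv'⟩ := (β.beckChevalley f V).subset hV
  refine ⟨F.map (unsingle m) v, ?_, β.app m v, hv, β.mem_toPreTrans.2 ?_⟩
  · have h₃ : F.map (single n) (F.map (times f 1) (F.map (unsingle m) v)) =
        F.map (single n) p := by
      rw [F.map_map, times_one, ← F.map_map, F.map_map (single m), unsingle_comp_single,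
        F.map_id_apply]
      exact hv'
    have := congrArg (F.map (unsingle n)) h₃
    rwa [F.map_map, F.map_map (unsingle n), single_comp_unsingle, F.map_id_apply,
      F.map_id_apply] at this
  · rw [F.map_map, unsingle_comp_single, F.map_id_apply]

end BCNatTrans

theorem preId_isCell (F : TypeSpaceFunctor.{u}) : (Trans.preId F).IsCell :=
  BCNatTrans.isCell (𝟙 F)

/-! ### Unit and associativity laws for 1-cells of type space functors. -/

namespace Trans

variable (β : Trans F F') (γ : Trans F' F'') (δ : Trans F'' F₃)

theorem mem_preId {n : ℕ} {p : F.obj (n * 1)} {q : F.obj n} :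
    q ∈ (preId F).app n p ↔ q = F.map (single n) p :=
  Part.mem_some_iff

theorem preId_preComp : preComp ⟨preId F, preId_isCell F⟩ β = β.toPreTrans := by
  have key : ∀ (n : ℕ) (p : F.obj (n * (β.arity * 1))) (q : F'.obj n),
      q ∈ (preComp ⟨preId F, preId_isCell F⟩ β).app n p ↔
        q ∈ β.app n (F.map (Fin.cast (congrArg (n * ·) (Nat.mul_one _).symm)) p) := by
    intro n p q
    have e : F.map (Fin.cast (congrArg (n * ·) (Nat.mul_one _).symm)) p =
        F.map (single _) (F.map (Fin.cast (Nat.mul_assoc n β.arity 1)) p) := by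
      rw [F.map_map]
      congr 2
      funext i
      ext
      simp [single, finProdFinEquiv]
    rw [e]
    refine mem_preComp.trans ⟨?_, fun hq => ⟨_, mem_preId.2 rfl, hq⟩⟩
    rintro ⟨r, hr, hq⟩
    obtain rfl := mem_preId.1 hr
    exact hq
  exact PreTrans.eq_of_app (Nat.mul_one _) key

/-- The regrouping of `n * 1` takes place between `β` and the identity and is moved across `β` by
naturality along a bijection. In the other unit law it acts on `F` alone. -/
theorem preComp_preId : preComp β ⟨preId F', preId_isCell F'⟩ = β.toPreTrans := by
  have key : ∀ (n : ℕ) (p : F.obj (n * (1 * β.arity))) (q : F'.obj n),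
      q ∈ (preComp β ⟨preId F', preId_isCell F'⟩).app n p ↔
        q ∈ β.app n (F.map (Fin.cast (congrArg (n * ·) (Nat.one_mul _).symm)) p) := by
    intro n p q
    have e : F.map (Fin.cast (congrArg (n * ·) (Nat.one_mul _).symm)) p =
        F.map (times (single n) β.arity) (F.map (Fin.cast (Nat.mul_assoc n 1 β.arity)) p) := by
      rw [F.map_map]
      congr 2
      funext p
      obtain ⟨⟨i, j⟩, rfl⟩ := finProdFinEquiv.surjective p
      simp only [Function.comp_apply, times_apply]
      ext
      simp [single, finProdFinEquiv]
    rw [e, β.mem_app_map_iff (single_comp_unsingle n) (unsingle_comp_single n)]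
    refine mem_preComp.trans (exists_congr fun r => and_congr_right fun _ => ?_)
    exact mem_preId.trans eq_comm
  exact PreTrans.eq_of_app (Nat.one_mul _) key

theorem preComp_assoc : preComp ⟨preComp β γ, preComp_isCell β γ⟩ δ =
    preComp β ⟨preComp γ δ, preComp_isCell γ δ⟩ := by
  have key : ∀ (n : ℕ) (p : F.obj (n * (δ.arity * (γ.arity * β.arity)))) (q : F₃.obj n),
      q ∈ (preComp ⟨preComp β γ, preComp_isCell β γ⟩ δ).app n p ↔
        q ∈ (preComp β ⟨preComp γ δ, preComp_isCell γ δ⟩).app n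
          (F.map (Fin.cast (congrArg (n * ·) (Nat.mul_assoc δ.arity γ.arity β.arity))) p) := by
    intro n p q
    have hc : n * δ.arity * γ.arity = n * (δ.arity * γ.arity) := Nat.mul_assoc _ _ _
    have e : F.map (Fin.cast (Nat.mul_assoc (n * δ.arity) γ.arity β.arity))
          (F.map (Fin.cast (Nat.mul_assoc n δ.arity (γ.arity * β.arity))) p) =
        F.map (times (Fin.cast hc) β.arity)
          (F.map (Fin.cast (Nat.mul_assoc n (δ.arity * γ.arity) β.arity))
            (F.map (Fin.cast (congrArg (n * ·) (Nat.mul_assoc δ.arity γ.arity β.arity))) p)) := by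
      simp only [F.map_map]
      congr 2
      funext p
      obtain ⟨⟨i, j⟩, rfl⟩ := finProdFinEquiv.surjective p
      simp only [Function.comp_apply, times_apply]
      ext
      simp [finProdFinEquiv]
    -- The two bracketings differ by a cast in the variables of `F'`, which is pulled back through
    -- `β` by naturality.
    have h := fun r => β.mem_app_map_iff (f := Fin.cast hc) (g := Fin.cast hc.symm) rfl rfl
      (F.map (Fin.cast (Nat.mul_assoc n (δ.arity * γ.arity) β.arity))
        (F.map (Fin.cast (congrArg (n * ·) (Nat.mul_assoc δ.arity γ.arity β.arity))) p)) r
    rw [← e] at h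
    refine mem_preComp.trans (Iff.trans ⟨?_, ?_⟩ mem_preComp.symm)
    · rintro ⟨r, hr, hq⟩
      obtain ⟨s, hs, hr⟩ := mem_preComp.1 hr
      obtain ⟨t, ht, rfl⟩ := (h s).1 hs
      exact ⟨t, ht, mem_preComp.2 ⟨r, hr, hq⟩⟩
    · rintro ⟨t, ht, hq⟩
      obtain ⟨r, hr, hq⟩ := mem_preComp.1 hq
      exact ⟨r, mem_preComp.2 ⟨_, (h _).2 ⟨t, ht, rfl⟩, hr⟩, hq⟩
  exact PreTrans.eq_of_app (Nat.mul_assoc _ _ _).symm key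

end Trans

end TypeSpaceFunctor

end PosLogic

namespace PosLogic

/-! ### Abstract 2-categories -/

namespace TwoCatData

variable {A B : Type u} {C : TwoCatData.{u, v} A} {D : TwoCatData.{u, v} B}

theorem IsStrictTwoCategory.op (h : C.IsStrictTwoCategory) : C.op.IsStrictTwoCategory where
  id_comp₁ f := h.comp₁_id f
  comp₁_id f := h.id_comp₁ f
  assoc₁ f g k := (h.assoc₁ k g f).symm
  id_vcomp α := h.id_vcomp α
  vcomp_id α := h.vcomp_id α
  vcomp_assoc α β γ := h.vcomp_assoc α β γ
  hcomp_id₂ f g := h.hcomp_id₂ g f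
  interchange α α' β β' := h.interchange β β' α α'
  id_hcomp α := h.hcomp_id α
  hcomp_id α := h.id_hcomp α
  hcomp_assoc α β γ := (h.hcomp_assoc γ β α).symm

theorem hcomp_congr {a b c : A} {f f' k k' : C.Hom a b} {g g' l l' : C.Hom b c}
    {α : C.Hom₂ f f'} {α' : C.Hom₂ k k'} {β : C.Hom₂ g g'} {β' : C.Hom₂ l l'}
    (e₁ : f = k) (e₂ : f' = k') (e₃ : g = l) (e₄ : g' = l') (h : HEq α α') (h' : HEq β β') :
    HEq (C.hcomp α β) (C.hcomp α' β') := by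
  subst e₁ e₂ e₃ e₄ h h'
  rfl

theorem vcomp_congr {a b : A} {f g k f' g' k' : C.Hom a b}
    {α : C.Hom₂ f g} {β : C.Hom₂ g k} {α' : C.Hom₂ f' g'} {β' : C.Hom₂ g' k'}
    (e₁ : f = f') (e₂ : g = g') (e₃ : k = k') (h : HEq α α') (h' : HEq β β') :
    HEq (C.vcomp α β) (C.vcomp α' β') := by
  subst e₁ e₂ e₃ h h'
  rfl

theorem id₂_congr {a b : A} {f g : C.Hom a b} (e : f = g) : HEq (C.id₂ f) (C.id₂ g) := by
  rw [e]

end TwoCatData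

section Faithful

variable {A B : Type u} {C : TwoCatData.{u, v} A} {D : TwoCatData.{u, v} B} {obj : A → B}
  {map₁ : ∀ {a b : A}, C.Hom a b → D.Hom (obj a) (obj b)}
  {map₂ : ∀ {a b : A} {f g : C.Hom a b}, C.Hom₂ f g → D.Hom₂ (map₁ f) (map₁ g)}

/-- Injectivity on parallel 2-cells says nothing about 1-cells, so the boundaries must be identified
in the source beforehand. For this reason the laws for 1-cells enter the transfer as hypotheses. -/
theorem heq_of_map₂ (inj : ∀ {a b : A} {f g : C.Hom a b} {α β : C.Hom₂ f g},
      map₂ α = map₂ β → α = β) {a b : A} {f g f' g' : C.Hom a b} (e : f = f') (e' : g = g')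
    {α : C.Hom₂ f g} {α' : C.Hom₂ f' g'} (h : HEq (map₂ α) (map₂ α')) : HEq α α' := by
  subst e e'
  exact heq_of_eq (inj (eq_of_heq h))

/-- The laws for 2-cells are reflected by operations that are injective on 2-cells. -/
theorem IsStrictTwoFunctor.isStrictTwoCategory (hF : IsStrictTwoFunctor C D obj map₁ map₂)
    (hD : D.IsStrictTwoCategory)
    (inj : ∀ {a b : A} {f g : C.Hom a b} {α β : C.Hom₂ f g}, map₂ α = map₂ β → α = β)
    (id_comp₁ : ∀ {a b : A} (f : C.Hom a b), C.comp₁ (C.id₁ a) f = f)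
    (comp₁_id : ∀ {a b : A} (f : C.Hom a b), C.comp₁ f (C.id₁ b) = f)
    (assoc₁ : ∀ {a b c d : A} (f : C.Hom a b) (g : C.Hom b c) (h : C.Hom c d),
      C.comp₁ (C.comp₁ f g) h = C.comp₁ f (C.comp₁ g h)) : C.IsStrictTwoCategory where
  id_comp₁ := id_comp₁
  comp₁_id := comp₁_id
  assoc₁ := assoc₁
  id_vcomp α := inj (by rw [hF.map_vcomp, hF.map_id₂, hD.id_vcomp])
  vcomp_id α := inj (by rw [hF.map_vcomp, hF.map_id₂, hD.vcomp_id])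
  vcomp_assoc α β γ := inj (by simp only [hF.map_vcomp, hD.vcomp_assoc])
  hcomp_id₂ f g := inj <| eq_of_heq <| by
    refine (hF.map_hcomp _ _).trans ?_
    rw [hF.map_id₂, hF.map_id₂, hF.map_id₂, hD.hcomp_id₂]
    exact TwoCatData.id₂_congr (hF.map_comp₁ f g).symm
  interchange α α' β β' := inj <| eq_of_heq <| by
    refine (hF.map_hcomp _ _).trans ?_
    rw [hF.map_vcomp, hF.map_vcomp, hF.map_vcomp, hD.interchange]
    exact TwoCatData.vcomp_congr (hF.map_comp₁ _ _).symm (hF.map_comp₁ _ _).symm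
      (hF.map_comp₁ _ _).symm (hF.map_hcomp _ _).symm (hF.map_hcomp _ _).symm
  id_hcomp {a b f g} α := heq_of_map₂ inj (id_comp₁ f) (id_comp₁ g) <| by
    refine (hF.map_hcomp _ _).trans ?_
    rw [hF.map_id₂]
    refine (TwoCatData.hcomp_congr (hF.map_id₁ a) (hF.map_id₁ a) rfl rfl
      (TwoCatData.id₂_congr (hF.map_id₁ a)) HEq.rfl).trans ?_
    exact hD.id_hcomp _
  hcomp_id {a b f g} α := heq_of_map₂ inj (comp₁_id f) (comp₁_id g) <| by
    refine (hF.map_hcomp _ _).trans ?_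
    rw [hF.map_id₂]
    refine (TwoCatData.hcomp_congr rfl rfl (hF.map_id₁ b) (hF.map_id₁ b)
      HEq.rfl (TwoCatData.id₂_congr (hF.map_id₁ b))).trans ?_
    exact hD.hcomp_id _
  hcomp_assoc α β γ := heq_of_map₂ inj (assoc₁ _ _ _) (assoc₁ _ _ _) <| by
    refine (hF.map_hcomp _ _).trans ?_
    refine (TwoCatData.hcomp_congr (hF.map_comp₁ _ _) (hF.map_comp₁ _ _) rfl rfl
      (hF.map_hcomp _ _) HEq.rfl).trans ?_
    refine (hD.hcomp_assoc _ _ _).trans ?_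
    refine HEq.trans ?_ (hF.map_hcomp _ _).symm
    exact TwoCatData.hcomp_congr rfl rfl (hF.map_comp₁ _ _).symm (hF.map_comp₁ _ _).symm
      HEq.rfl (hF.map_hcomp _ _).symm

end Faithful

namespace CohTheory.Interp

variable {T T' : CohTheory.{u}} {Γ Γ' Δ Δ' : Interp T T'}

theorem IsMor.congr {θ : T'.Lind (Γ.arity + Γ'.arity)} {η : T'.Lind (Δ.arity + Δ'.arity)}
    (h : IsMor Γ Γ' θ) (e : Γ = Δ) (e' : Γ' = Δ') (e₂ : HEq θ η) : IsMor Δ Δ' η := by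
  subst e e' e₂
  exact h

theorem Mor.heq_of_formula {θ : Mor Γ Γ'} {η : Mor Δ Δ'} (e : Γ = Δ) (e' : Γ' = Δ')
    (h : HEq θ.formula η.formula) : HEq θ η := by
  subst e e'
  exact heq_of_eq (Mor.ext_formula (eq_of_heq h))

end CohTheory.Interp

/-! ### Transfer of the 2-categorical structure along `Th`. -/

namespace TypeSpaceFunctor

open CohTheory

variable {F F' F'' : TypeSpaceFunctor.{u}}

/-- The morphism of interpretations given by a morphism of partial natural transformations. -/
def thMor {β β' : Trans F F'} (Θ : Trans.Mor β β') : Interp.Mor (thInterp β) (thInterp β') :=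
  ⟨thMap₂ Θ, thMap₂_isMor Θ⟩

/-- Inclusions of values on one side and entailments on the other are the same by completeness.
Preservation is specialised to atomic formulas for the reverse implication. -/
theorem isMor_iff {β β' : Trans F F'} {Θ : CompactOpens (F.obj (β.arity + β'.arity))} :
    Trans.IsMor β β' Θ ↔ Interp.IsMor (thInterp β) (thInterp β') (cl Θ) := by
  refine ⟨fun h => thMap₂_isMor ⟨Θ, h⟩, fun h => ⟨mkTh_le_iff.1 h.total, mkTh_le_iff.1 h.le_domain,
    fun x x' y => mkTh_le_iff.1 (h.congr_left x x' y),
    fun x y y' => mkTh_le_iff.1 (h.congr_right x y y'), fun U x y => mkTh_le_iff.1 ?_⟩⟩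
  have := h.preserves (F'.atom U id) x y
  erw [onFormula_eq β, onFormula_eq β', interp, preimage_id] at this
  rw [mkTh_and, mkTh_conj]
  exact this

theorem pre_preComp (β : Trans F F') (γ : Trans F' F'') (h : (Trans.preComp β γ).IsCell) {n : ℕ}
    (V : CompactOpens (F''.obj n)) : Trans.pre ⟨Trans.preComp β γ, h⟩ V =
      F.preimage (Fin.cast (Nat.mul_assoc n γ.arity β.arity)) (β.pre (γ.pre V)) :=
  SetLike.coe_injective (Trans.preComp_preimage β γ V)

theorem pre_toPreTrans (β : BCNatTrans F F') {n : ℕ} (V : CompactOpens (F'.obj n)) :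
    Trans.pre ⟨β.toPreTrans, β.isCell⟩ V = F.preimage (single n) (β.pre V) :=
  SetLike.coe_injective (β.toPreTrans_preimage V)

/-- On both sides a symbol goes to the class of an iterated preimage, by `onLind_cl`, and the
regroupings of variables agree. -/
theorem thMap_preComp (β : Trans F F') (γ : Trans F' F'') (h : (Trans.preComp β γ).IsCell) :
    thMap ⟨Trans.preComp β γ, h⟩ = Interp.preComp (thInterp γ) (thInterp β) := by
  have e : ∀ {n : ℕ} (V : CompactOpens (F''.obj n)), cl (Trans.pre ⟨Trans.preComp β γ, h⟩ V) =
      ((thInterp β).onLind (cl (γ.pre V))).subst (Fin.cast (Nat.mul_assoc _ _ _)) := by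
    intro n V
    rw [onLind_cl, pre_preComp]
    exact (cl_subst _ _).symm
  exact congrArg₂ (PreInterp.mk (T := F''.Th) (T' := F.Th) (γ.arity * β.arity)
    (Nat.mul_pos γ.arity_pos β.arity_pos)) (e _) (funext fun n => funext fun V => e (n := n) V)

theorem thMap_preId (h : (Trans.preId F).IsCell) :
    thMap ⟨Trans.preId F, h⟩ = Interp.preId F.Th := by
  have e : ∀ {n : ℕ} (V : CompactOpens (F.obj n)), cl (Trans.pre ⟨Trans.preId F, h⟩ V) =
      (cl V).subst (single n) := by
    intro n V
    rw [cl_subst]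
    exact congrArg cl (pre_toPreTrans (𝟙 F) V)
  refine congrArg₂ (PreInterp.mk (T := F.Th) (T' := F.Th) 1 le_rfl) ?_
    (funext fun n => funext fun V => e (n := n) V)
  refine (e _).trans ?_
  rw [← mkTh_eq_cl]
  rfl

theorem thInterp_preComp (β : Trans F F') (γ : Trans F' F'') (h : (Trans.preComp β γ).IsCell) :
    thInterp ⟨Trans.preComp β γ, h⟩ =
      ⟨Interp.preComp (thInterp γ) (thInterp β), CohTheory.opsClosed.comp₁ _ _⟩ :=
  Interp.ext_pre (thMap_preComp β γ h)

theorem cl_preVcomp {β β' β'' : Trans F F'} (Θ : Trans.Mor β β') (H : Trans.Mor β' β'') :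
    cl (Trans.preVcomp Θ H) = Interp.preVcomp (thMor Θ) (thMor H) := by
  rw [Trans.preVcomp, ← mkTh_eq_cl]
  rfl

theorem cl_preId₂ (β : Trans F F') : cl (Trans.preId₂ β) = Interp.preId₂ (thInterp β) := by
  rw [Trans.preId₂, ← mkTh_eq_cl]
  rfl

/-- The two formulas agree once the preimages under `β` and `β'` are recognised as the actions of
`Th(β)` and `Th(β')`. The arguments change places because `Th` reverses 1-cells. -/
theorem cl_preHcomp {β β' : Trans F F'} {γ γ' : Trans F' F''} (Θ : Trans.Mor β β')
    (H : Trans.Mor γ γ') :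
    cl (Trans.preHcomp Θ H) = Interp.preHcomp (thMor H) (thMor Θ) := by
  have e₁ : (thInterp β).onLind (thMor H).formula = cl (β.pre H.set) := onLind_cl β H.set
  have e₂ : (thInterp β').onLind (thInterp γ').eqv = cl (β'.pre γ'.eqv) := onLind_cl β' γ'.eqv
  rw [Trans.preHcomp, ← mkTh_eq_cl, mkTh_exs, mkTh_and, mkTh_and, mkTh_conj, Interp.preHcomp,
    e₁, e₂]
  rfl

/-- The 1-cells were treated on points. For 2-cells, the class of each composite is the composite of
morphisms of interpretations, and `isMor_iff` reflects the conditions. -/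
theorem opsClosed : OpsClosed.{u} where
  id₁ := preId_isCell
  comp₁ := Trans.preComp_isCell
  id₂ β := isMor_iff.2 (cl_preId₂ β ▸ CohTheory.opsClosed.id₂ (thInterp β))
  vcomp Θ H := isMor_iff.2 (cl_preVcomp Θ H ▸ CohTheory.opsClosed.vcomp (thMor Θ) (thMor H))
  hcomp Θ H := isMor_iff.2 ((CohTheory.opsClosed.hcomp (thMor H) (thMor Θ)).congr
    (thInterp_preComp _ _ _).symm (thInterp_preComp _ _ _).symm
    (heq_of_eq (cl_preHcomp Θ H).symm))

theorem isStrictTwoFunctor_th : IsStrictTwoFunctor (twoCat opsClosed.{u})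
    (CohTheory.twoCat CohTheory.opsClosed).op (fun F => F.Th) (fun β => thInterp β)
    (fun Θ => thMor Θ) where
  map_id₁ F := Interp.ext_pre (thMap_preId (preId_isCell F))
  map_comp₁ β γ := thInterp_preComp β γ _
  map_id₂ β := Interp.Mor.ext_formula (cl_preId₂ β)
  map_vcomp Θ H := Interp.Mor.ext_formula (cl_preVcomp Θ H)
  map_hcomp Θ H := Interp.Mor.heq_of_formula (thInterp_preComp _ _ _) (thInterp_preComp _ _ _)
    (heq_of_eq (cl_preHcomp Θ H))

theorem Trans.Mor.ext_set {β β' : Trans F F'} {Θ H : Trans.Mor β β'} (h : Θ.set = H.set) :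
    Θ = H := by
  cases Θ
  cases H
  cases h
  rfl

/-- By completeness distinct compact open sets give inequivalent formulas, so `Th` is injective on
2-cells and reflects their laws. -/
theorem isStrictTwoCategory : (twoCat opsClosed.{u}).IsStrictTwoCategory :=
  isStrictTwoFunctor_th.isStrictTwoCategory CohTheory.isStrictTwoCategory.op
    (fun h => Trans.Mor.ext_set (cl_injective (congrArg Interp.Mor.formula h)))
    (fun β => Trans.ext_pre (Trans.preId_preComp β))
    (fun β => Trans.ext_pre (Trans.preComp_preId β))
    (fun β γ δ => Trans.ext_pre (Trans.preComp_assoc β γ δ))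

theorem toPreTrans_comp (β : BCNatTrans F F') (γ : BCNatTrans F' F'') :
    BCNatTrans.toPreTrans (F := F) (F' := F'') (β ≫ γ : F ⟶ F'') =
      Trans.preComp ⟨β.toPreTrans, β.isCell⟩ ⟨γ.toPreTrans, γ.isCell⟩ := by
  refine PreTrans.eq_of_app rfl fun n p q => ?_
  change F.obj (n * 1) at p
  have hp : F.map (Fin.cast rfl) p = p := F.map_id_apply p
  refine Iff.trans ?_ (Eq.to_iff (congrArg (fun p => q ∈ (Trans.preComp ⟨β.toPreTrans, β.isCell⟩
    ⟨γ.toPreTrans, γ.isCell⟩).app n p) hp.symm))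
  have e : F.map (single n) p = F.map (single n) (F.map (single (n * 1))
      (F.map (Fin.cast (Nat.mul_assoc n 1 1)) p)) := by
    simp only [F.map_map]
    congr 2
    funext i
    ext
    simp [single, finProdFinEquiv]
  refine (BCNatTrans.mem_toPreTrans _).trans (Iff.trans ?_ Trans.mem_preComp.symm)
  have h : (β ≫ γ : F ⟶ F'').app n (F.map (single n) p) = γ.app n (F'.map (single n)
      (β.app (n * 1) (F.map (single (n * 1))
        (F.map (Fin.cast (Nat.mul_assoc n 1 1)) p)))) := by
    rw [β.natural, ← e]
    rfl
  constructor
  · exact fun hq => ⟨_, β.mem_toPreTrans.2 rfl, γ.mem_toPreTrans.2 (hq.trans h)⟩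
  · rintro ⟨r, hr, hq⟩
    obtain rfl := β.mem_toPreTrans.1 hr
    exact (γ.mem_toPreTrans.1 hq).trans h.symm

theorem bcClosed : BCClosed opsClosed.{u} where
  isCell β := BCNatTrans.isCell β
  id _ := rfl
  comp β γ := Trans.ext_pre (toPreTrans_comp β γ)

/-- Equality is the image of the whole space under the substitution of `1` for `0`, so the full
Beck–Chevalley condition for that map says that the preimage of equality is equality. -/
theorem isStrong_thInterp (β : BCNatTrans F F') :
    (thInterp ⟨β.toPreTrans, β.isCell⟩).IsStrong := by
  refine ⟨rfl, fun j => ?_⟩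
  obtain rfl : j = (0 : Fin 1) := Subsingleton.elim (α := Fin 1) _ _
  have e : β.pre (F'.interp (.eq 0 1)) = F.interp (n := 2) (.eq 0 1) :=
    SetLike.coe_injective (β.beckChevalley (Function.update id 0 1) ⊤)
  have e' : cl (Trans.pre ⟨β.toPreTrans, β.isCell⟩ (F'.interp (n := 2) (.eq 0 1))) =
      (mkTh (F := F) (.eq 0 1)).subst (single 2) := by
    rw [pre_toPreTrans, e, mkTh_eq_cl]
    exact (cl_subst _ _).symm
  exact e'

end TypeSpaceFunctor

end PosLogic

theorem mainTheorem5 :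
    ∃ (hC : CohTheory.OpsClosed.{u}) (hF : TypeSpaceFunctor.OpsClosed.{u})
      (hC₂ : (CohTheory.twoCat hC).IsStrictTwoCategory)
      (_ : (TypeSpaceFunctor.twoCat hF).IsStrictTwoCategory)
      (hT : TypeSpaceFunctor.ThClosed.{u}),
      IsStrictTwoFunctor (TypeSpaceFunctor.twoCat hF)
        (CohTheory.twoCat hC).op
        (fun F => F.Th)
        (fun β => ⟨TypeSpaceFunctor.thMap β, hT.isInterp β⟩)
        (fun Θ => ⟨TypeSpaceFunctor.thMap₂ Θ, hT.isMor Θ⟩) ∧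
      ∃ (hS : CohTheory.StrongClosed hC)
        (hN : TypeSpaceFunctor.BCClosed hF)
        (hTS : ∀ {F F' : TypeSpaceFunctor.{u}} (β : F ⟶ F'),
          CohTheory.Interp.IsStrong
            ⟨TypeSpaceFunctor.thMap ⟨β.toPreTrans, hN.isCell β⟩, hT.isInterp _⟩)
        (Φ : TypeSpaceFunctor.{u} ⥤ (CohTheory.StrongCat hC hC₂ hS)ᵒᵖ),
        Φ.toPrefunctor =
          { obj := fun F => Opposite.op F.Th
            map := fun β => Quiver.Hom.op
              ⟨⟨TypeSpaceFunctor.thMap ⟨β.toPreTrans, hN.isCell β⟩, hT.isInterp _⟩,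
                hTS β⟩ } := by
  refine ⟨CohTheory.opsClosed, TypeSpaceFunctor.opsClosed, CohTheory.isStrictTwoCategory,
    TypeSpaceFunctor.isStrictTwoCategory, TypeSpaceFunctor.thClosed,
    TypeSpaceFunctor.isStrictTwoFunctor_th, CohTheory.strongClosed, TypeSpaceFunctor.bcClosed,
    TypeSpaceFunctor.isStrong_thInterp, ?_, ?_⟩
  · exact
      { obj := fun F => Opposite.op F.Th
        map := fun β => Quiver.Hom.op
          ⟨TypeSpaceFunctor.thInterp ⟨β.toPreTrans, β.isCell⟩,
            TypeSpaceFunctor.isStrong_thInterp β⟩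
        map_id := fun F => congrArg Quiver.Hom.op
          (Subtype.ext (TypeSpaceFunctor.isStrictTwoFunctor_th.map_id₁ F))
        map_comp := fun β γ => congrArg Quiver.Hom.op (Subtype.ext
          ((congrArg TypeSpaceFunctor.thInterp (TypeSpaceFunctor.bcClosed.comp β γ)).trans
            (TypeSpaceFunctor.isStrictTwoFunctor_th.map_comp₁ _ _))) }
  · rfl
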